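/- Conventions. An AuxPDA is a nondeterministic pushdown automaton with a two-way read-only input tape (with end markers) and an additional work tape, such that (i) on inputs of length $n$ only $O(\log n)$ cells of the work tape are used, and (ii) for some fixed polynomial $p$, every computation path on an input of length $n$ has length at most $p(n)$. It is one-way if it never moves the input head to the left. A finitely generated group $G$ belongs to the class OW-AuxPDA if for some finite symmetric generating set $\Sigma\subseteq G$ the word problem $\{w\in\Sigma^* \mid w=1 \text{ in } G\}$ is the language accepted by a one-way AuxPDA. $\mathsf{LogCFL}$ is the class of all languages (over finite alphabets) that are logspace many-one reducible to a context-free language. An acyclic NFA over a finite alphabet $\Sigma$ is a tuple $\mathcal{A}=(Q,\Sigma,\Delta,q_0,F)$ with a finite set $Q$ of states, a finite set $\Delta\subseteq Q\times\Sigma^*\times Q$ of transitions labelled with words, an initial state $q_0\in Q$ and a set $F\subseteq Q$ of final states, such that the relation $\{(p,q)\mid \exists w\in\Sigma^*:(p,w,q)\in\Delta\}$ is acyclic. It is encoded as a string by naming its states by pairwise different bit strings and listing its states, initial state, final states and transitions. The membership problem for acyclic NFAs over $G$ with respect to $\Sigma$ is the set of all encodings of acyclic NFAs over $\Sigma$ that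 accept some word $w\in\Sigma^*$ with $w=1$ in $G$. Theorem. If the group $G$ belongs to the class OW-AuxPDA, then for every finite symmetric generating set $\Sigma$ of $G$ the membership problem for acyclic NFAs over $G$ with respect to $\Sigma$ belongs to $\mathsf{LogCFL}$. -/

import Mathlib

universe u v

/-! ### Machines -/

/-- What the input head can see: a letter, or one of the two end markers. -/
inductive InputSym (α : Type u) : Type u
  | leftEnd : InputSym α
  | letter : α → InputSym α
  | rightEnd : InputSym α

/-- A head movement. -/
inductive HeadMove : Type
  | left
  | stay
  | right

/-- The symbol at position `i` of the input tape holding `w = a₁ ⋯ aₙ`: position `0` carries the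
left end marker, position `i` with `1 ≤ i ≤ n` carries `aᵢ`, position `n + 1` the right end
marker. -/
def inputAt {α : Type u} (w : List α) : ℕ → InputSym α
  | 0 => InputSym.leftEnd
  | i + 1 =>
    match w[i]? with
    | some a => InputSym.letter a
    | none => InputSym.rightEnd

/-- Movement of the input head on an input of length `n`; it cannot leave the positions
`0, …, n + 1`. -/
def HeadMove.moveInput (n : ℕ) : HeadMove → ℕ → ℕ
  | HeadMove.left, i => i - 1
  | HeadMove.stay, i => i
  | HeadMove.right, i => min (i + 1) (n + 1)

/-- Movement of the head of a work tape whose cells are `0, 1, 2, …`; a left move in cell `0` has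
no effect. -/
def HeadMove.moveWork : HeadMove → ℕ → ℕ
  | HeadMove.left, i => i - 1
  | HeadMove.stay, i => i
  | HeadMove.right, i => i + 1

/-- One elementary operation on a pushdown store. -/
inductive StackOp (Γ : Type) : Type
  | keep : StackOp Γ
  | push : Γ → StackOp Γ
  | pop : StackOp Γ

/-- The effect of a stack operation; the top of the stack is the head of the list, and popping the
empty stack has no effect. -/
def StackOp.apply {Γ : Type} : StackOp Γ → List Γ → List Γ
  | StackOp.keep, s => s
  | StackOp.push g, s => g :: s
  | StackOp.pop, s => s.tail

/-- What an auxiliary pushdown automaton does in one step. -/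
structure AuxPDAAction (Q W Γ : Type) : Type where
  /-- the next state -/
  next : Q
  /-- the movement of the input head -/
  inputMove : HeadMove
  /-- the symbol written into the scanned cell of the work tape -/
  write : W
  /-- the movement of the work head -/
  workMove : HeadMove
  /-- the operation on the pushdown store -/
  stackOp : StackOp Γ

/-- The program of an auxiliary pushdown automaton: a nondeterministic pushdown automaton with a
two-way read-only input tape with end markers and an additional work tape. The bounds on space and
time are the predicates `AuxPDA.LogSpaceBounded` and `AuxPDA.PolyTimeBounded` below. -/
structure AuxPDA (α : Type u) where
  /-- the states -/
  State : Type
  /-- the symbols of the work tape -/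
  Work : Type
  /-- the symbols of the pushdown store -/
  Stack : Type
  finiteState : Finite State
  finiteWork : Finite Work
  finiteStack : Finite Stack
  /-- the initial state -/
  start : State
  /-- the accepting states -/
  accept : Set State
  /-- the blank symbol of the work tape -/
  blank : Work
  /-- the possible actions, depending on the state, the scanned input symbol, the scanned symbol
  of the work tape, and the top of the stack (`none` if the stack is empty) -/
  step : State → InputSym α → Work → Option Stack → Set (AuxPDAAction State Work Stack)

namespace AuxPDA

variable {α : Type u}

/-- A configuration. -/
structure Cfg (M : AuxPDA α) : Type where
  state : M.State
  inputPos : ℕ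
  tape : ℕ → M.Work
  workPos : ℕ
  stack : List M.Stack

/-- The initial configuration: the input head scans the first letter (the right end marker if the
input is empty), the work tape is blank, and the stack is empty. -/
def init (M : AuxPDA α) : M.Cfg where
  state := M.start
  inputPos := 1
  tape := fun _ => M.blank
  workPos := 0
  stack := []

/-- The configuration that results from an action on an input of length `n`. -/
def doAction (M : AuxPDA α) (n : ℕ) (a : AuxPDAAction M.State M.Work M.Stack) (c : M.Cfg) :
    M.Cfg where
  state := a.next
  inputPos := a.inputMove.moveInput n c.inputPos
  tape := Function.update c.tape c.workPos a.write
  workPos := a.workMove.moveWork c.workPos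
  stack := a.stackOp.apply c.stack

/-- `c'` is a successor configuration of `c` on the input `w`. -/
def Next (M : AuxPDA α) (w : List α) (c c' : M.Cfg) : Prop :=
  ∃ a ∈ M.step c.state (inputAt w c.inputPos) (c.tape c.workPos) c.stack.head?,
    c' = M.doAction w.length a c

/-- There is a computation path of length `t` on the input `w` from the initial configuration
to `c`. -/
inductive ReachesIn (M : AuxPDA α) (w : List α) : ℕ → M.Cfg → Prop
  | zero : ReachesIn M w 0 M.init
  | succ {t : ℕ} {c c' : M.Cfg} : ReachesIn M w t c → M.Next w c c' → ReachesIn M w (t + 1) c'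

/-- On inputs of length `n` only the first `O(log n)` cells of the work tape are ever visited. -/
def LogSpaceBounded (M : AuxPDA α) : Prop :=
  ∃ C : ℕ, ∀ (w : List α) (t : ℕ) (c : M.Cfg), M.ReachesIn w t c →
    c.workPos < C * (Nat.log 2 w.length + 1)

/-- Every computation path on an input of length `n` has length at most `p(n)`, for some fixed
polynomial `p`. -/
def PolyTimeBounded (M : AuxPDA α) : Prop :=
  ∃ p : Polynomial ℕ, ∀ (w : List α) (t : ℕ) (c : M.Cfg), M.ReachesIn w t c →
    t ≤ p.eval w.length

/-- The input head never moves to the left. -/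
def OneWay (M : AuxPDA α) : Prop :=
  ∀ q x b s, ∀ a ∈ M.step q x b s, a.inputMove ≠ HeadMove.left

/-- The accepted language. -/
def language (M : AuxPDA α) : Language α :=
  {w | ∃ t c, M.ReachesIn w t c ∧ c.state ∈ M.accept}

end AuxPDA

/-- `L` is recognized by a one-way auxiliary pushdown automaton which is logspace bounded and
polynomially time bounded. -/
def IsOneWayAuxPDALanguage {α : Type u} [Finite α] (L : Language α) : Prop :=
  ∃ M : AuxPDA α, M.OneWay ∧ M.LogSpaceBounded ∧ M.PolyTimeBounded ∧ M.language = L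

/-- What a deterministic transducer with `k` work tapes does in one step. -/
structure TransducerAction (Q W : Type) (k : ℕ) (β : Type v) where
  /-- the next state -/
  next : Q
  /-- the movement of the input head -/
  inputMove : HeadMove
  /-- the symbols written into the scanned cells of the work tapes -/
  write : Fin k → W
  /-- the movements of the work heads -/
  workMove : Fin k → HeadMove
  /-- the word appended to the output -/
  output : List β

/-- A deterministic Turing machine with a two-way read-only input tape with end markers, finitely
many work tapes, and a write-only output tape. -/
structure Transducer (α : Type u) (β : Type v) where
  /-- the states -/
  State : Type
  /-- the symbols of the work tapes -/
  Work : Type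
  finiteState : Finite State
  finiteWork : Finite Work
  /-- the number of work tapes -/
  numTapes : ℕ
  /-- the initial state -/
  start : State
  /-- the blank symbol of the work tapes -/
  blank : Work
  /-- the action, depending on the state and the scanned symbols; `none` means that the machine
  halts -/
  step : State → InputSym α → (Fin numTapes → Work) →
    Option (TransducerAction State Work numTapes β)

namespace Transducer

variable {α : Type u} {β : Type v}

/-- A configuration, together with the output produced so far. -/
structure Cfg (M : Transducer α β) where
  state : M.State
  inputPos : ℕ
  tape : Fin M.numTapes → ℕ → M.Work
  workPos : Fin M.numTapes → ℕ
  output : List β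

/-- The initial configuration. -/
def init (M : Transducer α β) : M.Cfg where
  state := M.start
  inputPos := 1
  tape := fun _ _ => M.blank
  workPos := fun _ => 0
  output := []

/-- The action to be performed in a configuration on the input `w`, if there is one. -/
def action (M : Transducer α β) (w : List α) (c : M.Cfg) :
    Option (TransducerAction M.State M.Work M.numTapes β) :=
  M.step c.state (inputAt w c.inputPos) (fun i => c.tape i (c.workPos i))

/-- The configuration that results from an action on an input of length `n`. -/
def doAction (M : Transducer α β) (n : ℕ) (a : TransducerAction M.State M.Work M.numTapes β)
    (c : M.Cfg) : M.Cfg where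
  state := a.next
  inputPos := a.inputMove.moveInput n c.inputPos
  tape := fun i => Function.update (c.tape i) (c.workPos i) (a.write i)
  workPos := fun i => (a.workMove i).moveWork (c.workPos i)
  output := c.output ++ a.output

/-- The configuration `c` is reached from the initial configuration on the input `w`. -/
inductive Reaches (M : Transducer α β) (w : List α) : M.Cfg → Prop
  | init : Reaches M w M.init
  | step {c : M.Cfg} {a : TransducerAction M.State M.Work M.numTapes β} :
      Reaches M w c → M.action w c = some a → Reaches M w (M.doAction w.length a c)

/-- On inputs of length `n` only the first `O(log n)` cells of each work tape are ever visited. -/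
def LogSpaceBounded (M : Transducer α β) : Prop :=
  ∃ C : ℕ, ∀ (w : List α) (c : M.Cfg), M.Reaches w c →
    ∀ i, c.workPos i < C * (Nat.log 2 w.length + 1)

/-- On every input `w` the machine halts with output `f w`. -/
def Computes (M : Transducer α β) (f : List α → List β) : Prop :=
  ∀ w, ∃ c, M.Reaches w c ∧ M.action w c = none ∧ c.output = f w

end Transducer

/-- `f` is computable in logarithmic space. -/
def LogSpaceComputable {α : Type u} {β : Type v} [Finite α] [Finite β]
    (f : List α → List β) : Prop :=
  ∃ M : Transducer α β, M.LogSpaceBounded ∧ M.Computes f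

/-- The complexity class LogCFL: the language `L` is reducible to a context-free language by a
logspace (many-one) reduction. -/
def InLogCFL {α : Type u} [Finite α] (L : Language α) : Prop :=
  ∃ (β : Type) (_ : Finite β) (K : Language β) (f : List α → List β),
    K.IsContextFree ∧ LogSpaceComputable f ∧ ∀ w, w ∈ L ↔ f w ∈ K

/-! ### Groups and their word problems -/

/-- `S` is a finite symmetric generating set of the group `G`. -/
def IsSymmGenSet {G : Type u} [Group G] (S : Finset G) : Prop :=
  (∀ a ∈ S, a⁻¹ ∈ S) ∧ Subgroup.closure (S : Set G) = ⊤

/-- The group element represented by a word over `S`. -/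
def wordValue {G : Type u} [Group G] {S : Finset G} (w : List S) : G :=
  (w.map Subtype.val).prod

/-- The word problem of `G` with respect to `S`. -/
def wordProblem {G : Type u} [Group G] (S : Finset G) : Language S :=
  {w | wordValue w = 1}

/-- The group `G` is finitely generated and belongs to the class OW-AuxPDA: its word problem, with
respect to some finite symmetric generating set, is recognized by a one-way AuxPDA. -/
def InOWAuxPDA (G : Type u) [Group G] : Prop :=
  ∃ S : Finset G, IsSymmGenSet S ∧ IsOneWayAuxPDALanguage (wordProblem S)

/-! ### Acyclic automata -/

/-- A nondeterministic finite automaton with state set `Q` and input alphabet `α` whose transitions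
are labelled with words. -/
structure WordNFA (α : Type u) (Q : Type) where
  /-- the transition triples -/
  trans : Finset (Q × List α × Q)
  /-- the initial state -/
  start : Q
  /-- the final states -/
  final : Finset Q

namespace WordNFA

variable {α : Type u} {Q : Type}

/-- `A.Path p w q`: some path of transitions from `p` to `q` spells the word `w`. -/
inductive Path (A : WordNFA α Q) : Q → List α → Q → Prop
  | nil (q : Q) : Path A q [] q
  | cons {p q r : Q} {x y : List α} :
      (p, x, q) ∈ A.trans → Path A q y r → Path A p (x ++ y) r

/-- The accepted language. -/
def language (A : WordNFA α Q) : Language α :=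
  {w | ∃ q ∈ A.final, A.Path A.start w q}

/-- The relation "there is a transition from `p` to `q`" has no cycle. -/
def Acyclic (A : WordNFA α Q) : Prop :=
  ∀ q, ¬ Relation.TransGen (fun p p' => ∃ x, (p, x, p') ∈ A.trans) q q

end WordNFA

/-- The alphabet in which automata over the input alphabet `α` are written down. -/
inductive NFASym (α : Type u) : Type u
  | bit : Bool → NFASym α
  | letter : α → NFASym α
  | comma : NFASym α
  | bar : NFASym α

instance instFiniteNFASym {α : Type u} [Finite α] : Finite (NFASym α) :=
  Finite.of_injective (β := α ⊕ (Bool ⊕ Bool))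
    (fun s => match s with
      | NFASym.letter a => Sum.inl a
      | NFASym.bit b => Sum.inr (Sum.inl b)
      | NFASym.comma => Sum.inr (Sum.inr true)
      | NFASym.bar => Sum.inr (Sum.inr false))
    (by intro s t h; cases s <;> cases t <;> simp_all)

/-- A state, written as a bit string. -/
def codeState {α : Type u} {Q : Type} (name : Q → List Bool) (q : Q) : List (NFASym α) :=
  (name q).map NFASym.bit

/-- The string `q₁,⋯qₖ,|s|f₁,⋯fₗ,|p₁,x₁,r₁,⋯pₘ,xₘ,rₘ,` that lists the states `qᵢ`, the initial
state `s`, the final states `fᵢ` and the transitions `(pᵢ, xᵢ, rᵢ)`. -/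
def codeNFA {α : Type u} {Q : Type} (name : Q → List Bool) (states : List Q) (start : Q)
    (final : List Q) (trans : List (Q × List α × Q)) : List (NFASym α) :=
  states.flatMap (fun q => codeState name q ++ [NFASym.comma]) ++ [NFASym.bar] ++
  codeState name start ++ [NFASym.bar] ++
  final.flatMap (fun q => codeState name q ++ [NFASym.comma]) ++ [NFASym.bar] ++
  trans.flatMap (fun t =>
    codeState name t.1 ++ [NFASym.comma] ++ t.2.1.map NFASym.letter ++ [NFASym.comma] ++
      codeState name t.2.2 ++ [NFASym.comma])

/-- The string `s` is an encoding of the automaton `A`: the states are named by pairwise different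
bit strings, and `Q`, the final states and the transitions are listed in any order. -/
def WordNFA.IsEncoding {α : Type u} {Q : Type} (A : WordNFA α Q) (s : List (NFASym α)) : Prop :=
  ∃ (name : Q → List Bool) (states final : List Q) (trans : List (Q × List α × Q)),
    Function.Injective name ∧ (∀ q, q ∈ states) ∧ (∀ q, q ∈ final ↔ q ∈ A.final) ∧
    (∀ t, t ∈ trans ↔ t ∈ A.trans) ∧ s = codeNFA name states A.start final trans

/-- The membership problem for acyclic NFAs over `G` with respect to `S`: the encodings of acyclic
NFAs with input alphabet `S` that accept a word representing the identity of `G`. -/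
def acyclicNFAMembership {G : Type u} [Group G] (S : Finset G) : Language (NFASym S) :=
  {s | ∃ (Q : Type) (_ : Finite Q) (A : WordNFA S Q), A.Acyclic ∧ A.IsEncoding s ∧
    ∃ w ∈ A.language, wordValue w = 1}

/-! The target of the reduction is one fixed context-free language, `stackProgramLanguage`:
straight-line programs of pushes, pops and optional blocks that can take the empty stack to the
empty stack. Entered brackets are no-ops and a skipped block is a nested word, so two nonterminals
suffice for a grammar (`stackProgramLanguage_isContextFree`). A logspace transducer can print
whatever a program with nested loops prints, provided that the loops are bounded by a polynomial of
the input length (`EProg.logSpaceComputable`). The nondeterminism of a pushdown machine becomes the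
choice of the blocks to be skipped, and its polynomially many steps are unrolled by the loops. In
effect this reproves that a nondeterministic auxiliary pushdown computation in logarithmic space and
polynomial time reduces to a context-free language.

Numbers below a polynomial bound `N` are kept in unary on the stack. `Programmable` collects the
relations on stacks of numbers that such printed programs realize; they are closed under
composition, choice, bounded guessing and iteration. `Tst` consists of the predicates that can be
certified in this way, `Dec` of those whose negations can be certified as well.

Three conditions on an input string have to be certified. That it encodes an automaton with all
occurring states listed is a matter of a finite automaton and of comparing names (`Dec.wellFormed`,
`Dec.allListed`). Acyclicity is the absence of a reachability pattern; it is certified by inductive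
counting in the manner of Immerman and Szelepcsényi: the number of ends of walks of length `k + 1`
is certified from the number for length `k` (`countStep_iff`, `Tst.acyclic`).

The remaining condition is that some accepted word represents the identity. Here one-wayness is
decisive. A path of the automaton is guessed letter by letter and each letter is fed to the machine
for the word problem as soon as it is guessed; since the machine never returns to a letter, a
pointer into the encoding replaces the input head. The two halves of the work tape are coded by
numbers, and the pushdown store of the machine lies on the same stack below them
(`Coding.simulated_simStep`, `Coding.exists_acceptance`). In an acyclic automaton a path has no more
transitions than there are states (`Accepts.le`), so the word read has polynomial length. Hence the
machine takes polynomially many steps and its tape codes are polynomial, so all numbers and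
iteration counts stay within one bound `N`.

The generating set of the automaton may differ from that of the machine. Each generator is replaced
by a fixed word over the other set, and the pointer has a second coordinate that walks through this
word. -/

/-! ### A context-free language of stack programs -/

/-- The instructions of a stack program: a letter is pushed or popped, and a block enclosed by `lb`
and `rb` may be skipped. -/
inductive Tok : Type
  | push : Bool → Tok
  | pop : Bool → Tok
  | lb : Tok
  | rb : Tok

instance : Finite Tok :=
  Finite.of_injective (β := (Bool ⊕ Bool) ⊕ Bool)
    (fun s => match s with
      | Tok.push b => Sum.inl (Sum.inl b)
      | Tok.pop b => Sum.inl (Sum.inr b)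
      | Tok.lb => Sum.inr true
      | Tok.rb => Sum.inr false)
    (by intro s t h; cases s <;> cases t <;> simp_all)

/-- Programs whose blocks are properly nested. -/
inductive Nested : List Tok → Prop
  | nil : Nested []
  | push (b : Bool) {w : List Tok} : Nested w → Nested (Tok.push b :: w)
  | pop (b : Bool) {w : List Tok} : Nested w → Nested (Tok.pop b :: w)
  | block {u v : List Tok} : Nested u → Nested v → Nested (Tok.lb :: u ++ Tok.rb :: v)

/-- `Run w σ τ`: the program `w` can transform the stack `σ` into the stack `τ`. -/
inductive Run : List Tok → List Bool → List Bool → Prop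
  | nil (σ : List Bool) : Run [] σ σ
  | push {b : Bool} {w : List Tok} {σ τ : List Bool} : Run w (b :: σ) τ → Run (Tok.push b :: w) σ τ
  | pop {b : Bool} {w : List Tok} {σ τ : List Bool} : Run w σ τ → Run (Tok.pop b :: w) (b :: σ) τ
  | lb {w : List Tok} {σ τ : List Bool} : Run w σ τ → Run (Tok.lb :: w) σ τ
  | rb {w : List Tok} {σ τ : List Bool} : Run w σ τ → Run (Tok.rb :: w) σ τ
  | skip {u w : List Tok} {σ τ : List Bool} :
      Nested u → Run w σ τ → Run (Tok.lb :: u ++ Tok.rb :: w) σ τ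

/-- The programs that can transform the empty stack into the empty stack, as an inductive
predicate that follows the rules of a context-free grammar. -/
inductive Bal : List Tok → Prop
  | nil : Bal []
  | lb {w : List Tok} : Bal w → Bal (Tok.lb :: w)
  | rb {w : List Tok} : Bal w → Bal (Tok.rb :: w)
  | skip {u w : List Tok} : Nested u → Bal w → Bal (Tok.lb :: u ++ Tok.rb :: w)
  | pair (b : Bool) {u v : List Tok} : Bal u → Bal v → Bal (Tok.push b :: u ++ Tok.pop b :: v)

theorem Run.append {u v : List Tok} {σ ρ τ : List Bool} (hu : Run u σ ρ) (hv : Run v ρ τ) :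
    Run (u ++ v) σ τ := by
  induction hu with
  | nil => exact hv
  | push _ ih => exact (ih hv).push
  | pop _ ih => exact (ih hv).pop
  | lb _ ih => exact (ih hv).lb
  | rb _ ih => exact (ih hv).rb
  | skip hj _ ih => simpa using Run.skip hj (ih hv)

/-- A balanced program pops only what it has pushed, so an arbitrary stack may lie underneath. -/
theorem Bal.run {w : List Tok} (h : Bal w) (σ : List Bool) : Run w σ σ := by
  induction h generalizing σ with
  | nil => exact Run.nil σ
  | lb _ ih => exact (ih σ).lb
  | rb _ ih => exact (ih σ).rb
  | skip hj _ ih => exact (ih σ).skip hj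
  | pair b _ _ ihu ihv => exact ((ihu (b :: σ)).append (ihv σ).pop).push

/-- Programs that can empty the stack `σ`, one balanced piece for each gap between the letters. -/
def Empties : List Bool → List Tok → Prop
  | [], w => Bal w
  | b :: σ, w => ∃ u v, w = u ++ Tok.pop b :: v ∧ Bal u ∧ Empties σ v

theorem Empties.prepend {x : List Tok} (hx : ∀ u, Bal u → Bal (x ++ u)) {σ : List Bool}
    {w : List Tok} (h : Empties σ w) : Empties σ (x ++ w) := by
  cases σ with
  | nil => exact hx w h
  | cons b σ =>
    obtain ⟨u, v, rfl, hu, hv⟩ := h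
    exact ⟨x ++ u, v, by simp, hx u hu, hv⟩

/-- The program is cut at the moments when the letters of the initial stack are popped; between two
cuts it is balanced. Since entered brackets are no-ops, a push and its matching pop may lie on
different sides of a bracket. -/
theorem Run.empties {w : List Tok} {σ τ : List Bool} (h : Run w σ τ) (hτ : τ = []) :
    Empties σ w := by
  induction h with
  | nil σ => subst hτ; exact Bal.nil
  | @push b _ _ _ _ ih =>
    -- The first gap `u` ends with the pop that matches this push. Together they form a balanced
    -- piece, which is absorbed into the next gap.
    obtain ⟨u, v, rfl, hu, hv⟩ := ih hτ
    have := hv.prepend (x := Tok.push b :: u ++ [Tok.pop b])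
      (fun w hw => by simpa using Bal.pair b hu hw)
    simpa using this
  | pop _ ih => exact ⟨[], _, rfl, Bal.nil, ih hτ⟩
  | lb _ ih => exact (ih hτ).prepend (x := [Tok.lb]) fun _ h => h.lb
  | rb _ ih => exact (ih hτ).prepend (x := [Tok.rb]) fun _ h => h.rb
  | @skip u _ _ _ hj _ ih =>
    simpa using (ih hτ).prepend (x := Tok.lb :: u ++ [Tok.rb]) fun w hw => by
      simpa using Bal.skip hj hw

theorem bal_iff_run {w : List Tok} : Bal w ↔ Run w [] [] :=
  ⟨fun h => h.run [], fun h => h.empties rfl⟩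

/-- The programs that can transform the empty stack into the empty stack. -/
def stackProgramLanguage : Language Tok := {w | Run w [] []}

/-! ### A context-free grammar for the balanced stack programs. -/

namespace StackGrammar

open Symbol

/-- The rules of a grammar for `stackProgramLanguage`; the nonterminal `true` generates the balanced
programs, the nonterminal `false` the nested ones. -/
def ruleList : List (ContextFreeRule Tok Bool) :=
  [⟨true, []⟩,
   ⟨true, [terminal Tok.lb, nonterminal true]⟩,
   ⟨true, [terminal Tok.rb, nonterminal true]⟩,
   ⟨true, [terminal Tok.lb, nonterminal false, terminal Tok.rb, nonterminal true]⟩,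
   ⟨true, [terminal (Tok.push true), nonterminal true, terminal (Tok.pop true), nonterminal true]⟩,
   ⟨true, [terminal (Tok.push false), nonterminal true, terminal (Tok.pop false),
      nonterminal true]⟩,
   ⟨false, []⟩,
   ⟨false, [terminal (Tok.push true), nonterminal false]⟩,
   ⟨false, [terminal (Tok.push false), nonterminal false]⟩,
   ⟨false, [terminal (Tok.pop true), nonterminal false]⟩,
   ⟨false, [terminal (Tok.pop false), nonterminal false]⟩,
   ⟨false, [terminal Tok.lb, nonterminal false, terminal Tok.rb, nonterminal false]⟩]

open Classical in
/-- A grammar for `stackProgramLanguage`. -/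
noncomputable abbrev grammar : ContextFreeGrammar Tok where
  NT := Bool
  initial := true
  rules := ruleList.toFinset

/-- The language generated by a symbol. -/
def symLanguage : Symbol Tok Bool → Language Tok
  | terminal t => {[t]}
  | nonterminal true => {w | Bal w}
  | nonterminal false => {w | Nested w}

/-- The language generated by a sentential form. -/
def formLanguage (u : List (Symbol Tok Bool)) : Language Tok := (u.map symLanguage).prod

theorem formLanguage_append (u v : List (Symbol Tok Bool)) :
    formLanguage (u ++ v) = formLanguage u * formLanguage v := by
  simp [formLanguage]

theorem mem_formLanguage_nil {w : List Tok} : w ∈ formLanguage [] ↔ w = [] := by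
  simp [formLanguage, Language.mem_one]

theorem mem_formLanguage_terminal {t : Tok} {u : List (Symbol Tok Bool)} {w : List Tok} :
    w ∈ formLanguage (terminal t :: u) ↔ ∃ v ∈ formLanguage u, w = t :: v := by
  simp only [formLanguage, List.map_cons, List.prod_cons, symLanguage, Language.mem_mul]
  constructor
  · rintro ⟨a, rfl, b, hb, rfl⟩
    exact ⟨b, hb, rfl⟩
  · rintro ⟨v, hv, rfl⟩
    exact ⟨[t], rfl, v, hv, rfl⟩

theorem mem_formLanguage_nonterminal {n : Bool} {u : List (Symbol Tok Bool)} {w : List Tok} :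
    w ∈ formLanguage (nonterminal n :: u) ↔
      ∃ x ∈ symLanguage (nonterminal n), ∃ v ∈ formLanguage u, w = x ++ v := by
  simp only [formLanguage, List.map_cons, List.prod_cons, Language.mem_mul]
  constructor
  · rintro ⟨a, ha, b, hb, rfl⟩
    exact ⟨a, ha, b, hb, rfl⟩
  · rintro ⟨a, ha, b, hb, rfl⟩
    exact ⟨a, ha, b, hb, rfl⟩

theorem formLanguage_output_le {r : ContextFreeRule Tok Bool} (hr : r ∈ ruleList) :
    formLanguage r.output ≤ symLanguage (nonterminal r.input) := by
  rintro w (hw : w ∈ formLanguage r.output)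
  change w ∈ symLanguage (nonterminal r.input)
  simp only [ruleList, List.mem_cons, List.not_mem_nil, or_false] at hr
  rcases hr with rfl | rfl | rfl | rfl | rfl | rfl | rfl | rfl | rfl | rfl | rfl | rfl <;>
    simp only [mem_formLanguage_nil, mem_formLanguage_terminal, mem_formLanguage_nonterminal] at hw
  · subst hw; exact Bal.nil
  · obtain ⟨_, ⟨x, hx, _, rfl, rfl⟩, rfl⟩ := hw
    rw [List.append_nil]; exact Bal.lb hx
  · obtain ⟨_, ⟨x, hx, _, rfl, rfl⟩, rfl⟩ := hw
    rw [List.append_nil]; exact Bal.rb hx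
  · obtain ⟨_, ⟨x, hx, _, ⟨_, ⟨y, hy, _, rfl, rfl⟩, rfl⟩, rfl⟩, rfl⟩ := hw
    rw [List.append_nil]; exact Bal.skip hx hy
  · obtain ⟨_, ⟨x, hx, _, ⟨_, ⟨y, hy, _, rfl, rfl⟩, rfl⟩, rfl⟩, rfl⟩ := hw
    rw [List.append_nil]; exact Bal.pair true hx hy
  · obtain ⟨_, ⟨x, hx, _, ⟨_, ⟨y, hy, _, rfl, rfl⟩, rfl⟩, rfl⟩, rfl⟩ := hw
    rw [List.append_nil]; exact Bal.pair false hx hy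
  · subst hw; exact Nested.nil
  · obtain ⟨_, ⟨x, hx, _, rfl, rfl⟩, rfl⟩ := hw
    rw [List.append_nil]; exact Nested.push true hx
  · obtain ⟨_, ⟨x, hx, _, rfl, rfl⟩, rfl⟩ := hw
    rw [List.append_nil]; exact Nested.push false hx
  · obtain ⟨_, ⟨x, hx, _, rfl, rfl⟩, rfl⟩ := hw
    rw [List.append_nil]; exact Nested.pop true hx
  · obtain ⟨_, ⟨x, hx, _, rfl, rfl⟩, rfl⟩ := hw
    rw [List.append_nil]; exact Nested.pop false hx
  · obtain ⟨_, ⟨x, hx, _, ⟨_, ⟨y, hy, _, rfl, rfl⟩, rfl⟩, rfl⟩, rfl⟩ := hw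
    rw [List.append_nil]; exact Nested.block hx hy

theorem mem_rules {r : ContextFreeRule Tok Bool} : r ∈ grammar.rules ↔ r ∈ ruleList := by
  simp [grammar]

/-- The language of a sentential form is a product of languages, and a rule replaces one factor by a
smaller one. A terminal word belongs to its own form, hence to the language of any form from which
it is derived. -/
theorem formLanguage_le_of_derives {u v : List (Symbol Tok Bool)}
    (h : grammar.Derives u v) : formLanguage v ≤ formLanguage u := by
  induction h with
  | refl => exact le_rfl
  | tail _ hp ih =>
    refine le_trans ?_ ih
    obtain ⟨r, hr, hrw⟩ := hp
    obtain ⟨p, q, rfl, rfl⟩ := hrw.exists_parts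
    have h1 : formLanguage r.output ≤ formLanguage [nonterminal r.input] := by
      simpa [formLanguage] using formLanguage_output_le (mem_rules.1 hr)
    simp only [formLanguage_append]
    exact mul_le_mul' (mul_le_mul' le_rfl h1) le_rfl

theorem mem_formLanguage_map (w : List Tok) : w ∈ formLanguage (w.map terminal) := by
  induction w with
  | nil => exact mem_formLanguage_nil.2 rfl
  | cons t w ih => exact mem_formLanguage_terminal.2 ⟨w, ih, rfl⟩

theorem derives_rule {n : Bool} {o : List (Symbol Tok Bool)} (h : ⟨n, o⟩ ∈ ruleList) :
    grammar.Derives [nonterminal n] o :=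
  ContextFreeGrammar.Produces.single ⟨⟨n, o⟩, mem_rules.2 h, ContextFreeRule.Rewrites.input_output⟩

theorem derives_terminal_cons {t : Tok} {x y : List (Symbol Tok Bool)}
    (h : grammar.Derives x y) : grammar.Derives (terminal t :: x) (terminal t :: y) :=
  h.append_left [terminal t]

theorem derives_append {x x' y y' : List (Symbol Tok Bool)}
    (h : grammar.Derives x x') (h' : grammar.Derives y y') :
    grammar.Derives (x ++ y) (x' ++ y') :=
  (h.append_right y).trans (h'.append_left x')

theorem derives_four {n m : Bool} {s t : Tok} {u v : List Tok}
    (h : ⟨n, [terminal s, nonterminal m, terminal t, nonterminal n]⟩ ∈ ruleList)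
    (hu : grammar.Derives [nonterminal m] (u.map terminal))
    (hv : grammar.Derives [nonterminal n] (v.map terminal)) :
    grammar.Derives [nonterminal n] ((s :: u ++ t :: v).map terminal) := by
  refine (derives_rule h).trans ?_
  have := derives_terminal_cons (t := s) (derives_append hu (derives_terminal_cons (t := t) hv))
  simpa using this

theorem Nested.derives {w : List Tok} (h : Nested w) :
    grammar.Derives [nonterminal false] (w.map terminal) := by
  induction h with
  | nil => exact derives_rule (by simp [ruleList])
  | push b _ ih =>
    exact (derives_rule (o := [terminal (Tok.push b), nonterminal false])
      (by cases b <;> simp [ruleList])).trans (derives_terminal_cons ih)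
  | pop b _ ih =>
    exact (derives_rule (o := [terminal (Tok.pop b), nonterminal false])
      (by cases b <;> simp [ruleList])).trans (derives_terminal_cons ih)
  | block _ _ ihu ihv => exact derives_four (by simp [ruleList]) ihu ihv

theorem Bal.derives {w : List Tok} (h : Bal w) :
    grammar.Derives [nonterminal true] (w.map terminal) := by
  induction h with
  | nil => exact derives_rule (by simp [ruleList])
  | lb _ ih =>
    exact (derives_rule (o := [terminal Tok.lb, nonterminal true]) (by simp [ruleList])).trans
      (derives_terminal_cons ih)
  | rb _ ih =>
    exact (derives_rule (o := [terminal Tok.rb, nonterminal true]) (by simp [ruleList])).trans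
      (derives_terminal_cons ih)
  | skip hj _ ih => exact derives_four (by simp [ruleList]) (Nested.derives hj) ih
  | pair b _ _ ihu ihv => exact derives_four (by cases b <;> simp [ruleList]) ihu ihv

theorem mem_language {w : List Tok} : w ∈ grammar.language ↔ Bal w := by
  constructor
  · intro h
    have := formLanguage_le_of_derives h (mem_formLanguage_map w)
    have h2 := mem_formLanguage_nonterminal.1 this
    obtain ⟨x, hx, v, hv, rfl⟩ := h2
    rw [mem_formLanguage_nil.1 hv, List.append_nil]
    exact hx
  · exact Bal.derives

end StackGrammar

theorem stackProgramLanguage_isContextFree : stackProgramLanguage.IsContextFree :=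
  ⟨StackGrammar.grammar, by
    ext w
    rw [StackGrammar.mem_language, bal_iff_run]
    rfl⟩

/-! ### Structured logspace programs -/

/-- The contents of a machine with one work tape. -/
structure Mem (W : Type) (β : Type v) where
  inputPos : ℕ
  tape : ℕ → W
  workPos : ℕ
  output : List β

/-- One step of a machine with one work tape. -/
structure FragAction (W : Type) (β : Type v) where
  inputMove : HeadMove
  write : W
  workMove : HeadMove
  output : List β

/-- The effect of a step on an input of length `n`. -/
def FragAction.apply {W : Type} {β : Type v} (n : ℕ) (a : FragAction W β) (m : Mem W β) :
    Mem W β where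
  inputPos := a.inputMove.moveInput n m.inputPos
  tape := Function.update m.tape m.workPos a.write
  workPos := a.workMove.moveWork m.workPos
  output := m.output ++ a.output

/-- A deterministic machine with one work tape which exits with a Boolean result. -/
structure Frag (α : Type u) (β : Type v) (W : Type) where
  State : Type
  finiteState : Finite State
  start : State
  step : State → InputSym α → W → (State ⊕ Bool) × FragAction W β

namespace Frag

variable {α : Type u} {β : Type v} {W : Type}

/-- `F.Exec w B q m b m'`: on the input `w` and from the state `q` and the memory `m`, the machine
exits with result `b` and memory `m'`; before that, the work head stays below `B`. -/
inductive Exec (F : Frag α β W) (w : List α) (B : ℕ) : F.State → Mem W β → Bool → Mem W β → Prop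
  | done {q : F.State} {m : Mem W β} {b : Bool} {a : FragAction W β} : m.workPos < B →
      F.step q (inputAt w m.inputPos) (m.tape m.workPos) = (Sum.inr b, a) →
      Exec F w B q m b (a.apply w.length m)
  | next {q q' : F.State} {m m' : Mem W β} {b : Bool} {a : FragAction W β} : m.workPos < B →
      F.step q (inputAt w m.inputPos) (m.tape m.workPos) = (Sum.inl q', a) →
      Exec F w B q' (a.apply w.length m) b m' → Exec F w B q m b m'

/-- Execution from the initial state. -/
def Does (F : Frag α β W) (w : List α) (B : ℕ) (m : Mem W β) (b : Bool) (m' : Mem W β) : Prop :=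
  F.Exec w B F.start m b m'

/-- Run `F`, and then `G b` if the result of `F` is `b`. -/
def bind (F : Frag α β W) (G : Bool → Frag α β W) : Frag α β W where
  State := F.State ⊕ (Σ b, (G b).State)
  finiteState := by
    have := F.finiteState
    have := fun b => (G b).finiteState
    infer_instance
  start := Sum.inl F.start
  step s x y :=
    match s with
    | Sum.inl q =>
      match F.step q x y with
      | (Sum.inl q', a) => (Sum.inl (Sum.inl q'), a)
      | (Sum.inr b, a) => (Sum.inl (Sum.inr ⟨b, (G b).start⟩), a)
    | Sum.inr ⟨b, q⟩ =>
      match (G b).step q x y with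
      | (Sum.inl q', a) => (Sum.inl (Sum.inr ⟨b, q'⟩), a)
      | (Sum.inr c, a) => (Sum.inr c, a)

theorem Does.bind {F : Frag α β W} {G : Bool → Frag α β W} {w : List α} {B : ℕ}
    {m m' m'' : Mem W β} {b c : Bool} (h : F.Does w B m b m') (h' : (G b).Does w B m' c m'') :
    (F.bind G).Does w B m c m'' := by
  have key : ∀ {q m}, (G b).Exec w B q m c m'' →
      (F.bind G).Exec w B (Sum.inr ⟨b, q⟩) m c m'' := by
    intro q m he
    induction he with
    | done h1 h2 => exact Exec.done h1 (by simp [Frag.bind, h2])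
    | next h1 h2 _ ih =>
      exact Exec.next h1 (a := _) (q' := Sum.inr ⟨b, _⟩) (by simp [Frag.bind, h2]) (ih h')
  have key2 : ∀ {q m}, F.Exec w B q m b m' → (F.bind G).Exec w B (Sum.inl q) m c m'' := by
    intro q m he
    induction he with
    | done h1 h2 =>
      exact Exec.next h1 (q' := Sum.inr ⟨_, (G _).start⟩) (by simp only [Frag.bind, h2]) (key h')
    | @next _ q' _ _ _ _ h1 h2 _ ih =>
      exact Exec.next (F := F.bind G) (q' := (Sum.inl q' : F.State ⊕ _)) h1
        (by simp only [Frag.bind, h2]) (ih h h' key)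
  exact key2 h

/-- Run `F` until its result is `false`. -/
def loop (F : Frag α β W) : Frag α β W where
  State := F.State
  finiteState := F.finiteState
  start := F.start
  step q x y :=
    match F.step q x y with
    | (Sum.inl q', a) => (Sum.inl q', a)
    | (Sum.inr true, a) => (Sum.inl F.start, a)
    | (Sum.inr false, a) => (Sum.inr false, a)

theorem Does.loop_false {F : Frag α β W} {w : List α} {B : ℕ} {m m' : Mem W β}
    (h : F.Does w B m false m') : F.loop.Does w B m false m' := by
  have key : ∀ {q m b}, F.Exec w B q m b m' → b = false → F.loop.Exec w B q m false m' := by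
    intro q m b he hb
    induction he with
    | done h1 h2 => subst hb; exact Exec.done h1 (by simp only [Frag.loop, h2])
    | next h1 h2 _ ih => exact Exec.next h1 (by simp only [Frag.loop, h2]) (ih h hb)
  exact key h rfl

theorem Does.loop_true {F : Frag α β W} {w : List α} {B : ℕ} {m m' m'' : Mem W β} {c : Bool}
    (h : F.Does w B m true m') (h' : F.loop.Does w B m' c m'') : F.loop.Does w B m c m'' := by
  have key : ∀ {q m b}, F.Exec w B q m b m' → b = true → F.loop.Exec w B q m c m'' := by
    intro q m b he hb
    induction he with
    | done h1 h2 =>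
      subst hb
      exact Exec.next (F := F.loop) h1 (q' := F.start) (by simp only [Frag.loop, h2]) h'
    | next h1 h2 _ ih => exact Exec.next h1 (by simp only [Frag.loop, h2]) (ih h h' hb)
  exact key h rfl

/-- A single step. -/
def prim (f : InputSym α → W → Bool × FragAction W β) : Frag α β W where
  State := Unit
  finiteState := inferInstance
  start := ()
  step _ x y := (Sum.inr (f x y).1, (f x y).2)

theorem does_prim {f : InputSym α → W → Bool × FragAction W β} {w : List α} {B : ℕ}
    {m : Mem W β} (h : m.workPos < B) :
    (prim f).Does w B m (f (inputAt w m.inputPos) (m.tape m.workPos)).1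
      ((f (inputAt w m.inputPos) (m.tape m.workPos)).2.apply w.length m) :=
  Exec.done h rfl

/-- A machine fragment as a transducer that halts when the fragment exits. -/
def toTransducer (F : Frag α β W) (finiteWork : Finite W) (blank : W) : Transducer α β where
  State := F.State ⊕ Unit
  Work := W
  finiteState := by
    have := F.finiteState
    infer_instance
  finiteWork := finiteWork
  numTapes := 1
  start := Sum.inl F.start
  blank := blank
  step s x y :=
    match s with
    | Sum.inl q => some
        { next := Sum.map id (fun _ => ()) (F.step q x (y 0)).1
          inputMove := (F.step q x (y 0)).2.inputMove
          write := fun _ => (F.step q x (y 0)).2.write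
          workMove := fun _ => (F.step q x (y 0)).2.workMove
          output := (F.step q x (y 0)).2.output }
    | Sum.inr _ => none

/-- The configuration of the transducer that corresponds to a state and a memory. -/
def toCfg (F : Frag α β W) (finiteWork : Finite W) (blank : W) (s : F.State ⊕ Unit)
    (m : Mem W β) : (F.toTransducer finiteWork blank).Cfg where
  state := s
  inputPos := m.inputPos
  tape := fun _ => m.tape
  workPos := fun _ => m.workPos
  output := m.output

/-- The memory at the beginning of a computation. -/
def initMem (β : Type v) (blank : W) : Mem W β where
  inputPos := 1
  tape := fun _ => blank
  workPos := 0
  output := []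

theorem action_toCfg_inl (F : Frag α β W) (finiteWork : Finite W) (blank : W) (q : F.State)
    (m : Mem W β) (w : List α) {s : F.State ⊕ Bool} {a : FragAction W β}
    (h : F.step q (inputAt w m.inputPos) (m.tape m.workPos) = (s, a)) :
    ∃ a', (F.toTransducer finiteWork blank).action w (F.toCfg finiteWork blank (Sum.inl q) m)
        = some a' ∧ (F.toTransducer finiteWork blank).doAction w.length a'
          (F.toCfg finiteWork blank (Sum.inl q) m) =
          F.toCfg finiteWork blank (Sum.map id (fun _ => ()) s) (a.apply w.length m) := by
  refine ⟨_, rfl, ?_⟩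
  simp only [Transducer.doAction, toCfg, FragAction.apply, h]
  rfl

/-- The transducer is deterministic, so every reachable configuration lies on the one computation
described by the `Exec` derivation. The head bound recorded in that derivation thus holds for all
reachable configurations. -/
theorem toTransducer_reaches (F : Frag α β W) (finiteWork : Finite W) (blank : W) {w : List α}
    {B : ℕ} {b : Bool} {m' : Mem W β} (h : F.Does w B (initMem β blank) b m')
    {c : (F.toTransducer finiteWork blank).Cfg}
    (hc : (F.toTransducer finiteWork blank).Reaches w c) :
    (∃ q m, c = F.toCfg finiteWork blank (Sum.inl q) m ∧ F.Exec w B q m b m') ∨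
      c = F.toCfg finiteWork blank (Sum.inr ()) m' := by
  induction hc with
  | init => exact Or.inl ⟨F.start, initMem β blank, rfl, h⟩
  | @step c a _ ha ih =>
    rcases ih with ⟨q, m, rfl, he⟩ | rfl
    · cases he with
      | done h1 h2 =>
        obtain ⟨a', h3, h4⟩ := action_toCfg_inl F finiteWork blank q m w h2
        obtain rfl : a' = a := Option.some.inj (h3.symm.trans ha)
        exact Or.inr h4
      | next h1 h2 h5 =>
        obtain ⟨a', h3, h4⟩ := action_toCfg_inl F finiteWork blank q m w h2
        obtain rfl : a' = a := Option.some.inj (h3.symm.trans ha)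
        exact Or.inl ⟨_, _, h4, h5⟩
    · simp [Transducer.action, toCfg, toTransducer] at ha

theorem exec_reaches (F : Frag α β W) (finiteWork : Finite W) (blank : W) {w : List α}
    {B : ℕ} {b : Bool} {q : F.State} {m m' : Mem W β} (h : F.Exec w B q m b m')
    (hc : (F.toTransducer finiteWork blank).Reaches w (F.toCfg finiteWork blank (Sum.inl q) m)) :
    (F.toTransducer finiteWork blank).Reaches w (F.toCfg finiteWork blank (Sum.inr ()) m') := by
  induction h with
  | done h1 h2 =>
    obtain ⟨a', h3, h4⟩ := action_toCfg_inl F finiteWork blank _ _ w h2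
    exact h4 ▸ Transducer.Reaches.step hc h3
  | next h1 h2 _ ih =>
    obtain ⟨a', h3, h4⟩ := action_toCfg_inl F finiteWork blank _ _ w h2
    exact ih (by have := Transducer.Reaches.step hc h3; rwa [h4] at this)

theorem logSpaceComputable [Finite α] [Finite β] (F : Frag α β W) (finiteWork : Finite W)
    (blank : W) (f : List α → List β) (B : List α → ℕ) (C : ℕ)
    (hB : ∀ w, B w ≤ C * (Nat.log 2 w.length + 1))
    (hF : ∀ w, ∃ b m', F.Does w (B w) (initMem β blank) b m' ∧ m'.workPos < B w ∧
      m'.output = f w) : LogSpaceComputable f := by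
  refine ⟨F.toTransducer finiteWork blank, ⟨C, ?_⟩, ?_⟩
  · intro w c hc i
    obtain ⟨b, m', h, hlt, -⟩ := hF w
    refine lt_of_lt_of_le ?_ (hB w)
    rcases toTransducer_reaches F finiteWork blank h hc with ⟨q, m, rfl, he⟩ | rfl
    · cases he with
      | done h1 _ => exact h1
      | next h1 _ _ => exact h1
    · exact hlt
  · intro w
    obtain ⟨b, m', h, -, hout⟩ := hF w
    exact ⟨_, exec_reaches F finiteWork blank h Transducer.Reaches.init, rfl, hout⟩

end Frag

/-! ### Sweeps over the work tape -/

/-- The symbols of the work tape: a blank, the left end mark, and cells. -/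
inductive TapeSym (C : Type) : Type
  | blank : TapeSym C
  | mark : TapeSym C
  | cell : C → TapeSym C

instance {C : Type} [Finite C] : Finite (TapeSym C) :=
  Finite.of_injective (β := Option (Option C))
    (fun s => match s with
      | TapeSym.blank => none
      | TapeSym.mark => some none
      | TapeSym.cell c => some (some c))
    (by intro s t h; cases s <;> cases t <;> simp_all)

/-- The work tape that holds a list of cells between the left end mark and blanks. -/
def tapeOf {C : Type} (l : List C) : ℕ → TapeSym C
  | 0 => TapeSym.mark
  | i + 1 =>
    match l[i]? with
    | some c => TapeSym.cell c
    | none => TapeSym.blank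

theorem tapeOf_append_cons {C : Type} (l l' : List C) (x : C) :
    tapeOf (l ++ x :: l') (l.length + 1) = TapeSym.cell x := by
  simp [tapeOf]

theorem tapeOf_length_succ {C : Type} (l : List C) :
    tapeOf l (l.length + 1) = TapeSym.blank := by
  simp [tapeOf]

theorem update_tapeOf {C : Type} (l l' : List C) (x y : C) :
    Function.update (tapeOf (l ++ x :: l')) (l.length + 1) (TapeSym.cell y) =
      tapeOf (l ++ y :: l') := by
  funext i
  cases i with
  | zero => simp [tapeOf]
  | succ i =>
    rcases lt_trichotomy i l.length with h | rfl | h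
    · rw [Function.update_of_ne (by omega)]
      simp [tapeOf, List.getElem?_append_left h]
    · simp [tapeOf]
    · rw [Function.update_of_ne (by omega)]
      obtain ⟨k, rfl⟩ : ∃ k, i = l.length + (k + 1) := ⟨i - l.length - 1, by omega⟩
      simp [tapeOf, List.getElem?_append_right]

theorem update_tapeOf_end {C : Type} (l : List C) (y : C) :
    Function.update (tapeOf l) (l.length + 1) (TapeSym.cell y) = tapeOf (l ++ [y]) := by
  funext i
  cases i with
  | zero => simp [tapeOf]
  | succ i =>
    rcases lt_trichotomy i l.length with h | rfl | h
    · rw [Function.update_of_ne (by omega)]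
      simp [tapeOf, List.getElem?_append_left h]
    · simp [tapeOf]
    · rw [Function.update_of_ne (by omega)]
      simp only [tapeOf]
      rw [List.getElem?_eq_none (by omega), List.getElem?_eq_none (by simp; omega)]

/-- The memory in which the work head rests on the left end mark. -/
def restMem {C : Type} {β : Type v} (p : ℕ) (cells : List C) (out : List β) :
    Mem (TapeSym C) β where
  inputPos := p
  tape := tapeOf cells
  workPos := 0
  output := out

/-- The run of a Mealy machine with two states over a list. -/
def mealy {C : Type} (δ : Bool → C → Bool × C) : Bool → List C → Bool × List C
  | c, [] => (c, [])
  | c, x :: xs => ((mealy δ (δ c x).1 xs).1, (δ c x).2 :: (mealy δ (δ c x).1 xs).2)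

theorem length_mealy {C : Type} (δ : Bool → C → Bool × C) (c : Bool) (l : List C) :
    (mealy δ c l).2.length = l.length := by
  induction l generalizing c with
  | nil => rfl
  | cons x l ih => simp [mealy, ih]

/-- The run of a Mealy machine that may append a cell at the end if it ends in state `true`. -/
def mealyExt {C : Type} (δ : Bool → C → Bool × C) (ext : Option C) (c : Bool) (l : List C) :
    Bool × List C :=
  match ext, (mealy δ c l).1 with
  | some e, true => (false, (mealy δ c l).2 ++ [e])
  | _, b => (b, (mealy δ c l).2)

namespace Frag

variable {α : Type u} {β : Type v} {C : Type}

/-- Run a Mealy machine over the cells from left to right, and return to the left end mark. -/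
def sweep (δ : Bool → C → Bool × C) (ext : Option C) (c₀ : Bool) : Frag α β (TapeSym C) where
  State := Bool × Bool
  finiteState := inferInstance
  start := (true, c₀)
  step s _ y :=
    match s, y with
    | (true, c), TapeSym.mark =>
        (Sum.inl (true, c), ⟨HeadMove.stay, TapeSym.mark, HeadMove.right, []⟩)
    | (true, c), TapeSym.cell x =>
        (Sum.inl (true, (δ c x).1), ⟨HeadMove.stay, TapeSym.cell (δ c x).2, HeadMove.right, []⟩)
    | (true, c), TapeSym.blank =>
        match ext, c with
        | some e, true =>
            (Sum.inl (false, false), ⟨HeadMove.stay, TapeSym.cell e, HeadMove.left, []⟩)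
        | _, c => (Sum.inl (false, c), ⟨HeadMove.stay, TapeSym.blank, HeadMove.left, []⟩)
    | (false, c), TapeSym.cell x =>
        (Sum.inl (false, c), ⟨HeadMove.stay, TapeSym.cell x, HeadMove.left, []⟩)
    | (false, c), TapeSym.mark => (Sum.inr c, ⟨HeadMove.stay, TapeSym.mark, HeadMove.stay, []⟩)
    | (false, c), TapeSym.blank => (Sum.inr c, ⟨HeadMove.stay, TapeSym.blank, HeadMove.stay, []⟩)

theorem sweep_back (δ : Bool → C → Bool × C) (ext : Option C) (c₀ c : Bool) (w : List α) {B : ℕ}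
    (p : ℕ) (cells : List C) (out : List β) {i : ℕ} (hi : i ≤ cells.length) (hB : i < B) :
    (sweep (α := α) δ ext c₀).Exec w B (false, c) ⟨p, tapeOf cells, i, out⟩ c
      (restMem p cells out) := by
  induction i with
  | zero =>
    have h := Exec.done (F := sweep (α := α) (β := β) δ ext c₀) (w := w) (B := B) (q := (false, c))
      (m := ⟨p, tapeOf cells, 0, out⟩) hB (b := c)
      (a := ⟨HeadMove.stay, TapeSym.mark, HeadMove.stay, []⟩) rfl
    convert h using 1
    simp only [restMem, FragAction.apply, HeadMove.moveInput, HeadMove.moveWork, List.append_nil,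
      Mem.mk.injEq, true_and, and_true]
    exact (Function.update_eq_self 0 (tapeOf cells)).symm
  | succ i ih =>
    have hx : tapeOf cells (i + 1) = TapeSym.cell (cells[i]'hi) := by
      simp [tapeOf, List.getElem?_eq_getElem (show i < cells.length from hi)]
    refine Exec.next (q' := (false, c)) (a := ⟨HeadMove.stay, TapeSym.cell (cells[i]'hi),
      HeadMove.left, []⟩) hB ?_ ?_
    · simp only [sweep, hx]
    · have := ih (by omega) (by omega)
      convert this using 1
      simp only [FragAction.apply, HeadMove.moveInput, HeadMove.moveWork, List.append_nil,
        Mem.mk.injEq, true_and, and_true, Nat.add_sub_cancel]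
      rw [← hx, Function.update_eq_self]

/-- Induction on the cells still to be visited; `pre` consists of the cells already rewritten. -/
theorem sweep_fwd (δ : Bool → C → Bool × C) (ext : Option C) (c₀ c : Bool) (w : List α) {B : ℕ}
    (p : ℕ) (pre post : List C) (out : List β) (hB : pre.length + post.length + 1 < B) :
    (sweep (α := α) δ ext c₀).Exec w B (true, c) ⟨p, tapeOf (pre ++ post), pre.length + 1, out⟩
      (mealyExt δ ext c post).1 (restMem p (pre ++ (mealyExt δ ext c post).2) out) := by
  induction post generalizing pre c with
  | nil =>
    have hback : ∀ b, Function.update (tapeOf pre) (pre.length + 1) TapeSym.blank = tapeOf pre →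
      (sweep (α := α) δ ext c₀).Exec w B (false, b) (FragAction.apply w.length
        ⟨HeadMove.stay, TapeSym.blank, HeadMove.left, []⟩ ⟨p, tapeOf pre, pre.length + 1, out⟩) b
        (restMem p pre out) := by
      intro b hb
      simp only [FragAction.apply, HeadMove.moveInput, HeadMove.moveWork, List.append_nil, hb,
        Nat.add_sub_cancel]
      exact sweep_back δ ext c₀ b w p pre out le_rfl (by omega)
    have hupd : Function.update (tapeOf pre) (pre.length + 1) TapeSym.blank = tapeOf pre := by
      rw [← tapeOf_length_succ pre, Function.update_eq_self]
    simp only [List.append_nil]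
    rcases ext with _ | e
    · refine Exec.next (q' := (false, c)) (a := ⟨HeadMove.stay, TapeSym.blank, HeadMove.left, []⟩)
        (by simpa using hB) (by simp [sweep, tapeOf_length_succ]) ?_
      simpa [mealyExt, mealy] using hback c hupd
    · cases c with
      | false =>
        refine Exec.next (q' := (false, false))
          (a := ⟨HeadMove.stay, TapeSym.blank, HeadMove.left, []⟩)
          (by simpa using hB) (by simp [sweep, tapeOf_length_succ]) ?_
        simpa [mealyExt, mealy] using hback false hupd
      -- A carry out of the last cell is absorbed by a new cell, so that a number may gain a digit.
      | true =>
        refine Exec.next (q' := (false, false))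
          (a := ⟨HeadMove.stay, TapeSym.cell e, HeadMove.left, []⟩)
          (by simpa using hB) (by simp [sweep, tapeOf_length_succ]) ?_
        simp only [FragAction.apply, HeadMove.moveInput, HeadMove.moveWork, List.append_nil,
          Nat.add_sub_cancel, update_tapeOf_end]
        exact sweep_back δ (some e) c₀ false w p (pre ++ [e]) out (by simp) (by omega)
  | cons x post ih =>
    refine Exec.next (q' := (true, (δ c x).1))
      (a := ⟨HeadMove.stay, TapeSym.cell (δ c x).2, HeadMove.right, []⟩)
      (by simp only [List.length_cons] at hB; dsimp; omega)
      (by simp only [sweep, tapeOf_append_cons]) ?_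
    have := ih (δ c x).1 (pre ++ [(δ c x).2]) (by simp at hB ⊢; omega)
    simp only [List.append_assoc, List.singleton_append, List.length_append, List.length_singleton]
      at this
    convert this using 1
    · simp only [FragAction.apply, HeadMove.moveInput, HeadMove.moveWork, List.append_nil,
        update_tapeOf]
    · simp only [mealyExt, mealy]
      split <;> simp_all
    · simp only [mealyExt, mealy]
      split <;> simp_all

theorem does_sweep (δ : Bool → C → Bool × C) (ext : Option C) (c₀ : Bool) (w : List α) {B : ℕ}
    (p : ℕ) (cells : List C) (out : List β) (hB : cells.length + 1 < B) :
    (sweep (α := α) δ ext c₀).Does w B (restMem p cells out)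
      (mealyExt δ ext c₀ cells).1 (restMem p (mealyExt δ ext c₀ cells).2 out) := by
  refine Exec.next (q' := (true, c₀)) (a := ⟨HeadMove.stay, TapeSym.mark, HeadMove.right, []⟩)
    (by simp only [restMem]; omega) rfl ?_
  have := sweep_fwd δ ext c₀ c₀ w p [] cells out (by simpa using hB)
  rw [List.nil_append, List.nil_append] at this
  convert this using 1
  simp only [restMem, FragAction.apply, HeadMove.moveInput, HeadMove.moveWork, List.append_nil,
    Mem.mk.injEq, true_and, and_true, List.length_nil]
  exact Function.update_eq_self 0 (tapeOf cells)

/-- Write the word `o` and move the input head; the result depends on the scanned input symbol. -/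
def inputStep (f : InputSym α → Bool × HeadMove × List β) : Frag α β (TapeSym C) :=
  prim fun x y => ((f x).1, ⟨(f x).2.1, y, HeadMove.stay, (f x).2.2⟩)

theorem does_inputStep (f : InputSym α → Bool × HeadMove × List β) (w : List α) {B : ℕ}
    (p : ℕ) (cells : List C) (out : List β) (hB : 0 < B) :
    (inputStep f).Does w B (restMem p cells out) (f (inputAt w p)).1
      (restMem ((f (inputAt w p)).2.1.moveInput w.length p) cells
        (out ++ (f (inputAt w p)).2.2)) := by
  have h := does_prim (f := fun x y => ((f x).1, (⟨(f x).2.1, y, HeadMove.stay, (f x).2.2⟩ :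
    FragAction (TapeSym C) β))) (w := w) (B := B) (m := restMem p cells out) hB
  convert h using 1
  · rfl
  · rfl
  · simp only [restMem, FragAction.apply, HeadMove.moveWork, Mem.mk.injEq, true_and, and_true]
    exact (Function.update_eq_self 0 (tapeOf cells)).symm

end Frag

/-! ### Programs that print words -/

/-- Extend an environment by a value for the innermost variable. -/
def consEnv (x : ℕ) (e : ℕ → ℕ) : ℕ → ℕ
  | 0 => x
  | i + 1 => e i

/-- Programs with nested loops that print a word depending on an input word. Variables are
de Bruijn indices. -/
inductive EProg (α : Type u) (β : Type v) : Type (max u v)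
  | nil : EProg α β
  | emit : β → EProg α β
  | seq : EProg α β → EProg α β → EProg α β
  /-- the body is executed for all values of a new variable below a bound, in decreasing order; the
  bound is the value of a variable, or the global bound -/
  | loop : Option ℕ → EProg α β → EProg α β
  /-- a test of the input symbol at the position which is the sum of a constant and some
  variables -/
  | ifSym : ℕ → List ℕ → (InputSym α → Bool) → EProg α β → EProg α β → EProg α β

namespace EProg

variable {α : Type u} {β : Type v}

/-- The bound of a loop. -/
def bnd (N : ℕ) (e : ℕ → ℕ) : Option ℕ → ℕ
  | none => N
  | some i => e i

/-- The word printed by a program. -/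
def out (N : ℕ) (w : List α) : EProg α β → (ℕ → ℕ) → List β
  | nil, _ => []
  | emit b, _ => [b]
  | seq p q, e => out N w p e ++ out N w q e
  | loop b p, e => (List.range (bnd N e b)).reverse.flatMap fun x => out N w p (consEnv x e)
  | ifSym c l P p q, e =>
    if P (inputAt w (c + (l.map e).sum)) then out N w p e else out N w q e

/-- The number of registers needed in addition to those for the free variables. -/
def depth : EProg α β → ℕ
  | nil => 0
  | emit _ => 0
  | seq p q => max p.depth q.depth
  | loop _ p => p.depth + 1
  | ifSym _ _ _ p q => max 1 (max p.depth q.depth)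

end EProg

/-! ### Registers -/

section Registers

variable {K D : ℕ}

/-- The value of a track of the cells, read as a number in base `D`. -/
def trackVal (t : Fin K) (cells : List (Fin K → Fin D)) : ℕ :=
  Nat.ofDigits D (cells.map fun c => (c t : ℕ))

theorem trackVal_cons (t : Fin K) (x : Fin K → Fin D) (cells : List (Fin K → Fin D)) :
    trackVal t (x :: cells) = x t + D * trackVal t cells := by
  simp [trackVal, Nat.ofDigits_cons]

theorem trackVal_mealy_of_ne {δ : Bool → (Fin K → Fin D) → Bool × (Fin K → Fin D)} {t : Fin K}
    (h : ∀ c x, (δ c x).2 t = x t) (c : Bool) (cells : List (Fin K → Fin D)) :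
    trackVal t (mealy δ c cells).2 = trackVal t cells := by
  induction cells generalizing c with
  | nil => rfl
  | cons x cells ih => simp [mealy, trackVal_cons, h, ih]

/-- Copy the track `i` to the track `t`. -/
def copyTrack (i t : Fin K) (c : Bool) (x : Fin K → Fin D) : Bool × (Fin K → Fin D) :=
  (c, Function.update x t (x i))

theorem trackVal_copyTrack (i t : Fin K) (c : Bool) (cells : List (Fin K → Fin D)) :
    trackVal t (mealy (copyTrack i t) c cells).2 = trackVal i cells := by
  induction cells generalizing c with
  | nil => rfl
  | cons x cells ih => simp [mealy, trackVal_cons, ih, copyTrack]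

theorem trackVal_copyTrack_of_ne {i t s : Fin K} (h : s ≠ t) (c : Bool)
    (cells : List (Fin K → Fin D)) :
    trackVal s (mealy (copyTrack i t) c cells).2 = trackVal s cells :=
  trackVal_mealy_of_ne (fun _ _ => Function.update_of_ne h _ _) c cells

/-- Decrement the track `t` if the carry is set. -/
def decTrack (t : Fin K) (c : Bool) (x : Fin K → Fin D) : Bool × (Fin K → Fin D) :=
  if c then
    if (x t : ℕ) = 0 then (true, Function.update x t ⟨D - 1, by have := (x t).2; omega⟩)
    else (false, Function.update x t ⟨(x t : ℕ) - 1, by have := (x t).2; omega⟩)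
  else (false, x)

theorem mealy_decTrack_false (t : Fin K) (cells : List (Fin K → Fin D)) :
    mealy (decTrack t) false cells = (false, cells) := by
  induction cells with
  | nil => rfl
  | cons x cells ih => simp [mealy, decTrack, ih]

/-- The value is zero only if all digits are, and then the borrow leaves the last cell. This is the
zero test of all loops. -/
theorem mealy_decTrack_zero (t : Fin K) (cells : List (Fin K → Fin D))
    (h : trackVal t cells = 0) : (mealy (decTrack t) true cells).1 = true := by
  induction cells with
  | nil => rfl
  | cons x cells ih =>
    rw [trackVal_cons] at h
    have hD : 0 < D := lt_of_le_of_lt (Nat.zero_le _) (x t).2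
    have h1 : (x t : ℕ) = 0 := by omega
    have h2 : trackVal t cells = 0 := by
      have : D * trackVal t cells = 0 := by omega
      exact (Nat.mul_eq_zero.1 this).resolve_left hD.ne'
    simp [mealy, decTrack, h1, ih h2]

/-- The borrow turns low zeros into `D - 1` and is absorbed by the first nonzero digit, which exists
because the value is positive. -/
theorem mealy_decTrack_succ (t : Fin K) (cells : List (Fin K → Fin D)) {x : ℕ}
    (h : trackVal t cells = x + 1) : (mealy (decTrack t) true cells).1 = false ∧
      trackVal t (mealy (decTrack t) true cells).2 = x := by
  induction cells generalizing x with
  | nil => simp [trackVal] at h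
  | cons y cells ih =>
    rw [trackVal_cons] at h
    have hD : 0 < D := lt_of_le_of_lt (Nat.zero_le _) (y t).2
    by_cases h1 : (y t : ℕ) = 0
    · obtain ⟨z, hz⟩ : ∃ z, trackVal t cells = z + 1 := by
        refine Nat.exists_eq_succ_of_ne_zero fun h0 => ?_
        rw [h0] at h
        omega
      obtain ⟨h2, h3⟩ := ih hz
      rw [hz, h1, Nat.mul_succ] at h
      have hmod : decTrack t true y =
          (true, Function.update y t ⟨D - 1, by have := (y t).2; omega⟩) := by
        simp [decTrack, h1]
      simp only [mealy, hmod, h2, trackVal_cons, h3, Function.update_self, true_and]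
      omega
    · have hmod : decTrack t true y =
          (false, Function.update y t ⟨(y t : ℕ) - 1, by have := (y t).2; omega⟩) := by
        simp [decTrack, h1]
      simp only [mealy, hmod, mealy_decTrack_false, trackVal_cons, Function.update_self, true_and]
      omega

theorem trackVal_decTrack_of_ne {t s : Fin K} (h : s ≠ t) (c : Bool)
    (cells : List (Fin K → Fin D)) :
    trackVal s (mealy (decTrack t) c cells).2 = trackVal s cells :=
  trackVal_mealy_of_ne (fun c x => by
    unfold decTrack
    split_ifs
    · exact Function.update_of_ne h _ _
    · exact Function.update_of_ne h _ _
    · rfl) c cells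

end Registers

namespace Frag

variable {α : Type u} {β : Type v} {K D : ℕ}

/-- Fragments whose cells hold `K` tracks of digits in base `D`. -/
abbrev RegFrag (α : Type u) (β : Type v) (K D : ℕ) := Frag α β (TapeSym (Fin K → Fin D))

/-- Do nothing. -/
def exit (b : Bool) : RegFrag α β K D := inputStep fun _ => (b, HeadMove.stay, [])

theorem does_exit (b : Bool) (w : List α) {B : ℕ} (p : ℕ) (cells : List (Fin K → Fin D))
    (out : List β) (hB : 0 < B) :
    (exit b : RegFrag α β K D).Does w B (restMem p cells out) b (restMem p cells out) := by
  have := does_inputStep (α := α) (fun _ => (b, HeadMove.stay, [])) w p cells out hB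
  rw [List.append_nil] at this
  exact this

theorem does_sweep_none (δ : Bool → (Fin K → Fin D) → Bool × (Fin K → Fin D)) (c₀ : Bool)
    (w : List α) {B : ℕ} (p : ℕ) (cells : List (Fin K → Fin D)) (out : List β)
    (hB : cells.length + 1 < B) :
    (sweep δ none c₀ : RegFrag α β K D).Does w B (restMem p cells out)
      (mealy δ c₀ cells).1 (restMem p (mealy δ c₀ cells).2 out) :=
  does_sweep δ none c₀ w p cells out hB

/-- Decrement the track `t` and execute the body, until the value of the track is `0`. -/
def countdown (t : Fin K) (F : RegFrag α β K D) : RegFrag α β K D :=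
  loop (bind (sweep (decTrack t) none true) fun b =>
    if b then exit false else bind F fun _ => exit true)

/-- A loop rule whose invariant `S x` is indexed by the current value of the counter. The end is
recognized by a borrow that leaves the last cell, so on exit the counter has been decremented once
beyond zero and holds no useful value; this is why the final tape is the decremented one. -/
theorem does_countdown {t : Fin K} {F : RegFrag α β K D} {w : List α} {ℓ : ℕ}
    (S : ℕ → ℕ → List (Fin K → Fin D) → List β → Prop)
    (hS : ∀ x p cells out, S x p cells out → cells.length = ℓ ∧ trackVal t cells = x)
    (hF : ∀ x p cells out, S (x + 1) p cells out → ∃ b p' cells' out',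
      F.Does w (ℓ + 2) (restMem p (mealy (decTrack t) true cells).2 out) b
        (restMem p' cells' out') ∧ S x p' cells' out')
    {x p : ℕ} {cells : List (Fin K → Fin D)} {out : List β} (h : S x p cells out) :
    ∃ p' cells' out', (countdown t F).Does w (ℓ + 2) (restMem p cells out) false
      (restMem p' (mealy (decTrack t) true cells').2 out') ∧ S 0 p' cells' out' := by
  induction x generalizing p cells out with
  | zero =>
    obtain ⟨hl, hv⟩ := hS _ _ _ _ h
    refine ⟨p, cells, out, ?_, h⟩
    apply Does.loop_false
    have h1 := does_sweep_none (decTrack t) true w p cells out (B := ℓ + 2) (by omega)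
    rw [mealy_decTrack_zero t cells hv] at h1
    exact h1.bind (does_exit false w p _ out (by omega))
  | succ x ih =>
    obtain ⟨hl, hv⟩ := hS _ _ _ _ h
    obtain ⟨b, p', cells', out', h2, h3⟩ := hF _ _ _ _ h
    obtain ⟨p'', cells'', out'', h4, h5⟩ := ih h3
    refine ⟨p'', cells'', out'', ?_, h5⟩
    refine Does.loop_true ?_ h4
    have h1 := does_sweep_none (decTrack t) true w p cells out (B := ℓ + 2) (by omega)
    rw [(mealy_decTrack_succ t cells hv).1] at h1
    exact h1.bind (h2.bind (does_exit true w p' _ out' (by omega)))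

/-- Move the input head to the left end marker. -/
def rewind : RegFrag α β K D :=
  loop (inputStep fun x =>
    match x with
    | InputSym.leftEnd => (false, HeadMove.stay, [])
    | _ => (true, HeadMove.left, []))

theorem does_rewind (w : List α) {B : ℕ} (p : ℕ) (cells : List (Fin K → Fin D))
    (out : List β) (hB : 0 < B) :
    (rewind : RegFrag α β K D).Does w B (restMem p cells out) false (restMem 0 cells out) := by
  induction p with
  | zero =>
    apply Does.loop_false
    simpa [inputAt, HeadMove.moveInput] using does_inputStep (α := α) (fun x =>
      match x with
      | InputSym.leftEnd => (false, HeadMove.stay, [])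
      | _ => (true, HeadMove.left, [])) w 0 cells out hB
  | succ p ih =>
    refine Does.loop_true ?_ ih
    have := does_inputStep (α := α) (fun x =>
      match x with
      | InputSym.leftEnd => (false, HeadMove.stay, [])
      | _ => (true, HeadMove.left, [])) w (p + 1) cells out hB
    have h : inputAt w (p + 1) ≠ InputSym.leftEnd := by
      simp only [inputAt]
      split <;> simp
    revert this
    generalize inputAt w (p + 1) = y at h
    cases y with
    | leftEnd => exact absurd rfl h
    | letter a => simp [HeadMove.moveInput]
    | rightEnd => simp [HeadMove.moveInput]

/-- Move the input head one step to the right. -/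
def stepRight : RegFrag α β K D := inputStep fun _ => (true, HeadMove.right, [])

theorem does_stepRight (w : List α) {B : ℕ} (k : ℕ) (cells : List (Fin K → Fin D))
    (out : List β) (hB : 0 < B) :
    (stepRight : RegFrag α β K D).Does w B (restMem (min k (w.length + 1)) cells out) true
      (restMem (min (k + 1) (w.length + 1)) cells out) := by
  have := does_inputStep (α := α) (fun _ => (true, HeadMove.right, []))
    w (min k (w.length + 1)) cells out hB
  rw [List.append_nil] at this
  have h : min (k + 1) (w.length + 1) = min (min k (w.length + 1) + 1) (w.length + 1) := by omega
  rw [h]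
  exact this

/-- Move the input head `c` steps to the right. -/
def moveRight : ℕ → RegFrag α β K D
  | 0 => exit true
  | c + 1 => bind stepRight fun _ => moveRight c

theorem does_moveRight (c : ℕ) (w : List α) {B : ℕ} (k : ℕ) (cells : List (Fin K → Fin D))
    (out : List β) (hB : 0 < B) :
    (moveRight c : RegFrag α β K D).Does w B (restMem (min k (w.length + 1)) cells out) true
      (restMem (min (k + c) (w.length + 1)) cells out) := by
  induction c generalizing k with
  | zero => exact does_exit true w _ cells out hB
  | succ c ih =>
    have := ih (k + 1)
    rw [show k + 1 + c = k + (c + 1) by omega] at this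
    exact (does_stepRight w k cells out hB).bind this

/-- Move the input head to the right by the sum of the values of some tracks. -/
def moveTracks (t : Fin K) : List (Fin K) → RegFrag α β K D
  | [] => exit true
  | i :: l => bind (sweep (copyTrack i t) none true) fun _ =>
      bind (countdown t stepRight) fun _ => moveTracks t l

/-- Each summand is copied to the scratch track `t` and counted down there with one step to the
right each time. The head stops at the right end marker, hence the truncation at `w.length + 1`. -/
theorem does_moveTracks (t : Fin K) (l : List (Fin K)) (hl : t ∉ l) (w : List α) {ℓ : ℕ} (k : ℕ)
    (cells : List (Fin K → Fin D)) (out : List β) (hℓ : cells.length = ℓ) :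
    ∃ cells', (moveTracks t l : RegFrag α β K D).Does w (ℓ + 2)
      (restMem (min k (w.length + 1)) cells out) true
      (restMem (min (k + (l.map fun i => trackVal i cells).sum) (w.length + 1)) cells' out) ∧
      cells'.length = ℓ ∧ ∀ s, s ≠ t → trackVal s cells' = trackVal s cells := by
  induction l generalizing k cells with
  | nil => exact ⟨cells, does_exit true w _ cells out (by omega), hℓ, fun _ _ => rfl⟩
  | cons i l ih =>
    simp only [List.mem_cons, not_or] at hl
    have h1 := does_sweep_none (copyTrack i t) true w (min k (w.length + 1)) cells out
      (B := ℓ + 2) (by omega)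
    obtain ⟨p', cells', out', h2, hl', hv', -, rfl, rfl, hs'⟩ := does_countdown
      (F := stepRight) (w := w) (t := t) (ℓ := ℓ)
      -- Invariant: with `x` left on the scratch track, the head has moved by the value of track `i`
      -- minus `x`.
      (fun x p c o => c.length = ℓ ∧ trackVal t c = x ∧ x ≤ trackVal i cells ∧
        p = min (k + (trackVal i cells - x)) (w.length + 1) ∧ o = out ∧
        ∀ s, s ≠ t → trackVal s c = trackVal s cells)
      (fun x p c o h => ⟨h.1, h.2.1⟩)
      (by
        rintro x p c o ⟨g1, g2, g3, rfl, rfl, h5⟩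
        refine ⟨true, _, _, _, does_stepRight w _ _ _ (by omega), ?_⟩
        refine ⟨by rw [length_mealy, g1], (mealy_decTrack_succ t c g2).2, by omega, ?_, rfl, ?_⟩
        · congr 1
          omega
        · intro s hs
          rw [trackVal_decTrack_of_ne hs, h5 s hs])
      (x := trackVal i cells) (p := min k (w.length + 1))
      (cells := (mealy (copyTrack i t) true cells).2) (out := out)
      ⟨by rw [length_mealy, hℓ], trackVal_copyTrack _ _ _ _, le_rfl, by simp, rfl,
        fun s hs => trackVal_copyTrack_of_ne hs _ _⟩
    obtain ⟨cells'', h3, h4, h5⟩ := ih hl.2 (k + trackVal i cells)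
      (mealy (decTrack t) true cells').2 (by rw [length_mealy, hl'])
    refine ⟨cells'', ?_, h4, fun s hs => ?_⟩
    · refine h1.bind (h2.bind ?_)
      rw [List.map_cons, List.sum_cons, ← add_assoc]
      rw [Nat.sub_zero]
      convert h3 using 5
      refine List.map_congr_left fun j hj => ?_
      have hjt : j ≠ t := fun h => hl.2 (h ▸ hj)
      rw [trackVal_decTrack_of_ne hjt, hs' j hjt]
    · rw [h5 s hs, trackVal_decTrack_of_ne hs, hs' s hs]

/-- Move the input head to the position which is the sum of a constant and some tracks. -/
def goTo (t : Fin K) (c : ℕ) (l : List (Fin K)) : RegFrag α β K D :=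
  bind rewind fun _ => bind (moveRight c) fun _ => moveTracks t l

theorem does_goTo (t : Fin K) (c : ℕ) (l : List (Fin K)) (hl : t ∉ l) (w : List α) {ℓ : ℕ} (p : ℕ)
    (cells : List (Fin K → Fin D)) (out : List β) (hℓ : cells.length = ℓ) :
    ∃ cells', (goTo t c l : RegFrag α β K D).Does w (ℓ + 2) (restMem p cells out) true
      (restMem (min (c + (l.map fun i => trackVal i cells).sum) (w.length + 1)) cells' out) ∧
      cells'.length = ℓ ∧ ∀ s, s ≠ t → trackVal s cells' = trackVal s cells := by
  obtain ⟨cells', h, h'⟩ := does_moveTracks t l hl w c cells out hℓ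
  refine ⟨cells', (does_rewind w p cells out (by omega)).bind (Does.bind (b := true) ?_ h), h'⟩
  have := does_moveRight c w 0 cells out (B := ℓ + 2) (by omega)
  simpa using this

/-- Every position beyond the last letter shows the right end marker, so stopping the head there
does not change the symbol seen. -/
theorem inputAt_min (w : List α) (k : ℕ) : inputAt w (min k (w.length + 1)) = inputAt w k := by
  rcases le_or_gt k (w.length + 1) with h | h
  · rw [min_eq_left h]
  · rw [min_eq_right h.le]
    obtain ⟨j, rfl⟩ : ∃ j, k = j + 1 := ⟨k - 1, by omega⟩
    simp only [inputAt]
    rw [List.getElem?_eq_none le_rfl, List.getElem?_eq_none (by omega)]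

end Frag

namespace EProg

open Frag

variable {α : Type u} {β : Type v} {K D : ℕ}

/-- The tracks of the variables in the scope of a new variable. -/
def consTrack (t : Fin K) (ρ : Option ℕ → Fin K) : Option ℕ → Fin K
  | some 0 => t
  | some (i + 1) => ρ (some i)
  | none => ρ none

/-- Fragments that implement a program, given the tracks that hold the bound and the variables. -/
theorem exists_frag (p : EProg α β) (d : ℕ) (hd : d + p.depth ≤ K) (ρ : Option ℕ → Fin K)
    (hρ : ∀ o, (ρ o : ℕ) < d) :
    ∃ F : RegFrag α β K D, ∀ (w : List α) (N : ℕ) (e : ℕ → ℕ) (ℓ pos : ℕ)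
      (cells : List (Fin K → Fin D)) (o : List β), cells.length = ℓ →
      (∀ b, trackVal (ρ b) cells = bnd N e b) →
      ∃ c pos' cells', F.Does w (ℓ + 2) (restMem pos cells o) c
        (restMem pos' cells' (o ++ p.out N w e)) ∧ cells'.length = ℓ ∧
        ∀ s : Fin K, (s : ℕ) < d → trackVal s cells' = trackVal s cells := by
  induction p generalizing d ρ with
  | nil =>
    refine ⟨exit true, fun w N e ℓ pos cells o hℓ h => ⟨true, pos, cells, ?_, hℓ, fun _ _ => rfl⟩⟩
    simpa [out] using does_exit true w pos cells o (by omega)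
  | emit b =>
    refine ⟨inputStep fun _ => (true, HeadMove.stay, [b]), fun w N e ℓ pos cells o hℓ h =>
      ⟨true, pos, cells, ?_, hℓ, fun _ _ => rfl⟩⟩
    exact does_inputStep (fun _ => (true, HeadMove.stay, [b])) w pos cells o (by omega)
  | seq p q ihp ihq =>
    simp only [depth] at hd
    obtain ⟨F, hF⟩ := ihp d (by omega) ρ hρ
    obtain ⟨G, hG⟩ := ihq d (by omega) ρ hρ
    refine ⟨bind F fun _ => G, fun w N e ℓ pos cells o hℓ h => ?_⟩
    obtain ⟨c, pos', cells', h1, h2, h3⟩ := hF w N e ℓ pos cells o hℓ h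
    obtain ⟨c', pos'', cells'', h4, h5, h6⟩ := hG w N e ℓ pos' cells' (o ++ p.out N w e) h2
      (fun b => by rw [h3 _ (hρ b), h b])
    rw [List.append_assoc] at h4
    exact ⟨c', pos'', cells'', h1.bind h4, h5, fun s hs => by rw [h6 s hs, h3 s hs]⟩
  | loop b p ih =>
    simp only [depth] at hd
    have hdK : d < K := by omega
    have hne : ∀ s : Fin K, (s : ℕ) < d → s ≠ ⟨d, hdK⟩ := by
      rintro s hs rfl
      exact lt_irrefl _ hs
    obtain ⟨F, hF⟩ := ih (d + 1) (by omega) (consTrack ⟨d, hdK⟩ ρ) (by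
      rintro (_ | _ | i)
      · exact (hρ none).trans (Nat.lt_succ_self d)
      · exact Nat.lt_succ_self d
      · exact (hρ (some i)).trans (Nat.lt_succ_self d))
    -- Counting down happens on a copy of the bound in track `d`, which leaves the original intact.
    -- For the body, track `d` is the innermost variable, and only later tracks are free.
    refine ⟨bind (sweep (copyTrack (ρ b) ⟨d, hdK⟩) none true) fun _ => countdown ⟨d, hdK⟩ F,
      fun w N e ℓ pos cells o hℓ h => ?_⟩
    have h1 := does_sweep_none (copyTrack (ρ b) ⟨d, hdK⟩) true w pos cells o
      (B := ℓ + 2) (by omega)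
    obtain ⟨p', cells', out', h2, hl', hv', ho', hs'⟩ := does_countdown
      (F := F) (w := w) (t := ⟨d, hdK⟩) (ℓ := ℓ)
      -- Invariant: the output so far, followed by what the values below `x` will print, is the
      -- complete output.
      (fun x _ c o' => c.length = ℓ ∧ trackVal ⟨d, hdK⟩ c = x ∧
        o' ++ ((List.range x).reverse.flatMap fun x => p.out N w (consEnv x e)) =
          o ++ (loop b p).out N w e ∧
        ∀ s : Fin K, (s : ℕ) < d → trackVal s c = trackVal s cells)
      (fun x p c o h => ⟨h.1, h.2.1⟩)
      (by
        rintro x pos₁ c o₁ ⟨h1, h2, h3, h4⟩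
        obtain ⟨b', pos₂, c', h5, h6, h7⟩ := hF w N (consEnv x e) ℓ pos₁
          (mealy (decTrack ⟨d, hdK⟩) true c).2 o₁ (by rw [length_mealy, h1]) (by
            rintro (_ | _ | i)
            · exact (trackVal_decTrack_of_ne (hne _ (hρ _)) _ _).trans
                ((h4 _ (hρ _)).trans (h none))
            · exact (mealy_decTrack_succ _ c h2).2
            · exact (trackVal_decTrack_of_ne (hne _ (hρ _)) _ _).trans
                ((h4 _ (hρ _)).trans (h (some i))))
        refine ⟨b', pos₂, c', _, h5, h6, ?_, ?_, fun s hs => ?_⟩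
        · rw [h7 _ (Nat.lt_succ_self d), (mealy_decTrack_succ _ c h2).2]
        · rw [← h3, List.range_succ, List.reverse_append]
          simp
        · rw [h7 s (hs.trans (Nat.lt_succ_self d)), trackVal_decTrack_of_ne (hne s hs), h4 s hs])
      (x := bnd N e b) (p := pos)
      (cells := (mealy (copyTrack (ρ b) ⟨d, hdK⟩) true cells).2) (out := o)
      ⟨by rw [length_mealy, hℓ], by rw [trackVal_copyTrack, h b], rfl,
        fun s hs => trackVal_copyTrack_of_ne (hne s hs) _ _⟩
    simp only [List.range_zero, List.reverse_nil, List.flatMap_nil, List.append_nil] at ho'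
    subst ho'
    refine ⟨_, _, _, h1.bind h2, by rw [length_mealy, hl'], fun s hs => ?_⟩
    rw [trackVal_decTrack_of_ne (hne s hs), hs' s hs]
  | ifSym c l P p q ihp ihq =>
    simp only [depth] at hd
    have hdK : d < K := by omega
    have hne : ∀ s : Fin K, (s : ℕ) < d → s ≠ ⟨d, hdK⟩ := by
      rintro s hs rfl
      exact lt_irrefl _ hs
    obtain ⟨F, hF⟩ := ihp d (by omega) ρ hρ
    obtain ⟨G, hG⟩ := ihq d (by omega) ρ hρ
    -- Track `d` holds no variable here and serves as scratch space for moving the head.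
    refine ⟨bind (goTo ⟨d, hdK⟩ c (l.map fun i => ρ (some i))) fun _ =>
      bind (inputStep fun x => (P x, HeadMove.stay, [])) fun b => if b then F else G,
      fun w N e ℓ pos cells o hℓ h => ?_⟩
    obtain ⟨cells', h1, h2, h3⟩ := does_goTo ⟨d, hdK⟩ c (l.map fun i => ρ (some i)) (by
      simp only [List.mem_map, not_exists, not_and]
      exact fun i _ => hne _ (hρ _)) w pos cells o hℓ
    have hsum : ((l.map fun i => ρ (some i)).map fun i => trackVal i cells) = l.map e := by
      rw [List.map_map]
      exact List.map_congr_left fun i _ => h (some i)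
    rw [hsum] at h1
    have h4 := does_inputStep (fun x => (P x, HeadMove.stay, [])) w
      (min (c + (l.map e).sum) (w.length + 1)) cells' o (B := ℓ + 2) (by omega)
    rw [inputAt_min, List.append_nil] at h4
    have h5 : ∀ b, trackVal (ρ b) cells' = bnd N e b := fun b => by
      rw [h3 _ (hne _ (hρ b)), h b]
    by_cases hP : P (inputAt w (c + (l.map e).sum))
    · obtain ⟨c', pos', cells'', h6, h7, h8⟩ := hF w N e ℓ _ cells' o h2 h5
      refine ⟨c', pos', cells'', h1.bind (h4.bind ?_), h7, fun s hs => ?_⟩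
      · simp only [hP, if_true, out]
        exact h6
      · rw [h8 s hs, h3 s (hne s hs)]
    · obtain ⟨c', pos', cells'', h6, h7, h8⟩ := hG w N e ℓ _ cells' o h2 h5
      refine ⟨c', pos', cells'', h1.bind (h4.bind ?_), h7, fun s hs => ?_⟩
      · simp only [hP, out]
        exact h6
      · rw [h8 s hs, h3 s (hne s hs)]

end EProg

/-- The number of binary digits of `n + 1` where `n` is the length of a word. -/
def binLength {α : Type u} (w : List α) : ℕ := (Nat.digits 2 (w.length + 1)).length

/-! ### Computing the global loop bound from the input length, in logarithmic space. -/

namespace EProg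

open Frag

variable {α : Type u} {β : Type v} {k D : ℕ}

/-- The cell that holds a binary digit in the first track. -/
def binCell (b : ℕ) (t : Fin (k + 2)) : Fin (D + 2) := if t = 0 ∧ b ≠ 0 then 1 else 0

/-- The Mealy machine that increments a binary number in the first track. -/
def incTrack (c : Bool) (x : Fin (k + 2) → Fin (D + 2)) : Bool × (Fin (k + 2) → Fin (D + 2)) :=
  if c then if x 0 = 0 then (false, binCell 1) else (true, binCell 0) else (false, x)

theorem mealyExt_cons {C : Type} (δ : Bool → C → Bool × C) (ext : Option C) (c : Bool) (x : C)
    (l : List C) : mealyExt δ ext c (x :: l) =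
      ((mealyExt δ ext (δ c x).1 l).1, (δ c x).2 :: (mealyExt δ ext (δ c x).1 l).2) := by
  simp only [mealyExt, mealy]
  split <;> simp_all

theorem mealyExt_incTrack_false (l : List (Fin (k + 2) → Fin (D + 2))) :
    mealyExt incTrack (some (binCell 1)) false l = (false, l) := by
  induction l with
  | nil => rfl
  | cons x l ih => rw [mealyExt_cons]; simp [incTrack, ih]

/-- Induction from `n / 2` to `n`: a low digit 0 stops the carry, a low digit 1 passes it on. The
extension cell supplies the new leading digit. -/
theorem mealyExt_incTrack (n : ℕ) :
    mealyExt (incTrack (k := k) (D := D)) (some (binCell 1)) true ((Nat.digits 2 n).map binCell) =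
      (false, (Nat.digits 2 (n + 1)).map binCell) := by
  induction n using Nat.strong_induction_on with
  | _ n ih =>
    rcases Nat.eq_zero_or_pos n with rfl | hn
    · simp [mealyExt, mealy]
    · rw [Nat.digits_def' (by norm_num) hn, Nat.digits_def' (by norm_num) (Nat.succ_pos n),
        List.map_cons, mealyExt_cons, List.map_cons]
      rcases Nat.mod_two_eq_zero_or_one n with h | h
      · have h1 : (n + 1) % 2 = 1 := by omega
        have h2 : (n + 1) / 2 = n / 2 := by omega
        have h3 : incTrack true (binCell (n % 2) : Fin (k + 2) → Fin (D + 2)) =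
            (false, binCell 1) := by
          simp [incTrack, binCell, h]
        rw [h1, h2, h3]
        simp [mealyExt_incTrack_false]
      · have h1 : (n + 1) % 2 = 0 := by omega
        have h2 : (n + 1) / 2 = n / 2 + 1 := by omega
        have h3 : incTrack true (binCell (n % 2) : Fin (k + 2) → Fin (D + 2)) =
            (true, binCell 0) := by
          simp [incTrack, binCell, h]
        rw [h1, h2, h3, ih (n / 2) (by omega)]

/-- Increment the binary number in the first track. -/
def increment : RegFrag α β (k + 2) (D + 2) := sweep incTrack (some (binCell 1)) true

theorem does_increment (w : List α) {B : ℕ} (p n : ℕ) (out : List β)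
    (hB : (Nat.digits 2 n).length + 1 < B) :
    (increment : RegFrag α β (k + 2) (D + 2)).Does w B
      (restMem p ((Nat.digits 2 n).map binCell) out) false
      (restMem p ((Nat.digits 2 (n + 1)).map binCell) out) := by
  have := does_sweep (incTrack (k := k) (D := D)) (some (binCell 1)) true w p
    ((Nat.digits 2 n).map binCell) out (B := B) (by simpa using hB)
  rw [mealyExt_incTrack] at this
  exact this

/-- Increment the binary number in the first track by the number of letters to the right of the
input head. -/
def countInput : RegFrag α β (k + 2) (D + 2) :=
  Frag.loop (Frag.bind (inputStep fun x =>
      match x with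
      | InputSym.rightEnd => (false, HeadMove.stay, [])
      | _ => (true, HeadMove.right, []))
    fun b => if b then Frag.bind increment fun _ => exit true else exit false)

/-- Here `j` is the number of letters not yet read, and the number on the tape always equals the
head position. Counting from 1 gives at least one digit, and so a nonempty register tape, even on
the empty input. -/
theorem does_countInput (w : List α) (j : ℕ) (out : List β) (hj : j ≤ w.length) :
    (countInput : RegFrag α β (k + 2) (D + 2)).Does w (binLength w + 2)
      (restMem (w.length - j + 1) ((Nat.digits 2 (w.length - j + 1)).map binCell) out) false
      (restMem (w.length + 1) ((Nat.digits 2 (w.length + 1)).map binCell) out) := by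
  induction j with
  | zero =>
    apply Does.loop_false
    have h1 := does_inputStep (α := α) (fun x =>
      match x with
      | InputSym.rightEnd => (false, HeadMove.stay, [])
      | _ => (true, HeadMove.right, [])) w (w.length - 0 + 1)
      ((Nat.digits 2 (w.length - 0 + 1)).map (binCell (k := k) (D := D))) out
      (B := binLength w + 2) (by omega)
    have h2 : inputAt w (w.length - 0 + 1) = InputSym.rightEnd := by simp [inputAt]
    rw [h2, List.append_nil] at h1
    exact h1.bind (does_exit false w _ _ out (by omega))
  | succ j ih =>
    refine Does.loop_true ?_ (ih (by omega))
    have h1 := does_inputStep (α := α) (fun x =>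
      match x with
      | InputSym.rightEnd => (false, HeadMove.stay, [])
      | _ => (true, HeadMove.right, [])) w (w.length - (j + 1) + 1)
      ((Nat.digits 2 (w.length - (j + 1) + 1)).map (binCell (k := k) (D := D))) out
      (B := binLength w + 2) (by omega)
    have h2 : inputAt w (w.length - (j + 1) + 1) =
        InputSym.letter (w[w.length - (j + 1)]'(by omega)) := by
      simp only [inputAt]
      rw [List.getElem?_eq_getElem (by omega)]
    rw [h2, List.append_nil] at h1
    have h3 : min (w.length - (j + 1) + 1 + 1) (w.length + 1) = w.length - j + 1 := by omega
    simp only [HeadMove.moveInput, h3] at h1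
    have h4 : w.length - (j + 1) + 1 = w.length - j := by omega
    rw [h4] at h1 ⊢
    refine h1.bind (Does.bind (does_increment w _ _ out ?_) (does_exit true w _ _ out (by omega)))
    have := Nat.le_length_digits_le 2 (w.length - j) (w.length + 1) (by omega)
    unfold binLength
    omega

/-- Set all digits of the first track to the maximal value. -/
def maxTrack (c : Bool) (x : Fin (k + 2) → Fin (D + 2)) : Bool × (Fin (k + 2) → Fin (D + 2)) :=
  (c, Function.update x 0 (Fin.last (D + 1)))

theorem trackVal_maxTrack (c : Bool) (l : List (Fin (k + 2) → Fin (D + 2))) :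
    trackVal 0 (mealy maxTrack c l).2 + 1 = (D + 2) ^ l.length := by
  induction l generalizing c with
  | nil => simp [mealy, trackVal]
  | cons x l ih =>
    have := ih (maxTrack c x).1
    rw [List.length_cons, pow_succ, ← this]
    simp only [mealy, trackVal_cons, maxTrack, Function.update_self, Fin.val_last]
    ring

theorem trackVal_one_binCell (l : List ℕ) :
    trackVal 1 (l.map (binCell (k := k) (D := D))) = 0 := by
  induction l with
  | nil => rfl
  | cons x l ih => rw [List.map_cons, trackVal_cons, ih]; simp [binCell]

/-- The global bound on loops. -/
def loopBound (D : ℕ) (w : List α) : ℕ := (D + 2) ^ binLength w - 1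

/-- Counting the input lays out `binLength w` cells. Filling one track with the largest digit then
yields the bound `(D + 2) ^ binLength w - 1`, a polynomial in the input length whose degree is
governed by `D`. -/
theorem logSpaceComputable [Finite α] [Finite β] (p : EProg α β) (D : ℕ) :
    LogSpaceComputable fun w => p.out (loopBound D w) w fun _ => 0 := by
  obtain ⟨F, hF⟩ := exists_frag (K := p.depth + 2) (D := D + 2) p 2 (by omega)
    -- Track 0 holds the global bound. All free variables have the value 0 and share track 1, so two
    -- tracks suffice besides those for the loops.
    (fun o => match o with | none => 0 | some _ => 1) (by rintro (_ | _) <;> simp)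
  refine Frag.logSpaceComputable
    (bind (prim fun _ _ => (true, ⟨HeadMove.stay, TapeSym.mark, HeadMove.stay, []⟩)) fun _ =>
      bind increment fun _ => bind countInput fun _ => bind (sweep maxTrack none true) fun _ => F)
    inferInstance TapeSym.blank _ (fun w => binLength w + 2) 4 (fun w => ?_) (fun w => ?_)
  -- There are `Nat.log 2 (n + 1) + 1` cells, two more positions are allowed for the sweeps, and
  -- `Nat.log 2 (n + 1)` exceeds `Nat.log 2 n` by at most 1; this gives the constant 4.
  · rw [binLength, Nat.length_digits 2 _ (by norm_num) (by omega)]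
    have : Nat.log 2 (w.length + 1) ≤ Nat.log 2 w.length + 1 := by
      rcases Nat.eq_zero_or_pos w.length with h | h
      · simp [h]
      · rw [← Nat.log_mul_base (by norm_num) h.ne']
        exact Nat.log_mono_right (by omega)
    omega
  · have h0 := does_prim (f := fun (_ : InputSym α) (_ : TapeSym (Fin (p.depth + 2) →
      Fin (D + 2))) => (true, (⟨HeadMove.stay, TapeSym.mark, HeadMove.stay, []⟩ :
        FragAction _ β))) (w := w) (B := binLength w + 2) (m := initMem β TapeSym.blank)
        (by simp [initMem])
    have hm : FragAction.apply w.length (⟨HeadMove.stay, TapeSym.mark, HeadMove.stay, []⟩ :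
        FragAction (TapeSym (Fin (p.depth + 2) → Fin (D + 2))) β) (initMem β TapeSym.blank) =
        restMem 1 ((Nat.digits 2 0).map binCell) [] := by
      simp only [FragAction.apply, initMem, restMem, HeadMove.moveInput, HeadMove.moveWork,
        Mem.mk.injEq, List.append_nil, true_and, and_true]
      funext i
      cases i <;> simp [tapeOf]
    rw [hm] at h0
    have h1 := does_increment (k := p.depth) (D := D) (β := β) w (B := binLength w + 2) 1 0 []
      (by simp)
    have h2 := does_countInput (k := p.depth) (D := D) (β := β) w w.length [] le_rfl
    simp only [Nat.sub_self, Nat.zero_add] at h2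
    have h3 := does_sweep_none (K := p.depth + 2) (D := D + 2) (β := β) maxTrack true w
      (w.length + 1) ((Nat.digits 2 (w.length + 1)).map binCell) [] (B := binLength w + 2)
      (by simp [binLength])
    obtain ⟨c, pos, cells, h4, -, -⟩ := hF w (loopBound D w) (fun _ => 0) (binLength w)
      (w.length + 1) (mealy maxTrack true ((Nat.digits 2 (w.length + 1)).map binCell)).2 []
      (by rw [length_mealy, List.length_map, binLength]) (by
        rintro (_ | i)
        · have := trackVal_maxTrack (k := p.depth) (D := D) true
            ((Nat.digits 2 (w.length + 1)).map binCell)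
          rw [List.length_map] at this
          simp only [bnd, loopBound, binLength]
          omega
        · exact (trackVal_mealy_of_ne (fun c x => by
            simp [maxTrack]) _ _).trans (trackVal_one_binCell _))
    exact ⟨c, _, h0.bind (h1.bind (h2.bind (h3.bind h4))), by simp [restMem], by simp [restMem]⟩

end EProg

/-! ### Stack programs -/

theorem run_push_iff {b : Bool} {w : List Tok} {σ τ : List Bool} :
    Run (Tok.push b :: w) σ τ ↔ Run w (b :: σ) τ :=
  ⟨fun h => by cases h; assumption, Run.push⟩

theorem run_pop_iff {b : Bool} {w : List Tok} {σ τ : List Bool} :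
    Run (Tok.pop b :: w) σ τ ↔ ∃ σ', σ = b :: σ' ∧ Run w σ' τ :=
  ⟨fun h => by cases h; exact ⟨_, rfl, by assumption⟩, by rintro ⟨_, rfl, h⟩; exact h.pop⟩

theorem run_rb_iff {w : List Tok} {σ τ : List Bool} : Run (Tok.rb :: w) σ τ ↔ Run w σ τ :=
  ⟨fun h => by cases h; assumption, Run.rb⟩

/-- A nested word contains no unmatched bracket, so the closing bracket of a block is uniquely
determined. Skipping is therefore unambiguous. -/
theorem Nested.append_rb_inj {u u' v v' : List Tok} (hu : Nested u) (hu' : Nested u')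
    (h : u ++ Tok.rb :: v = u' ++ Tok.rb :: v') : u = u' ∧ v = v' := by
  induction hu generalizing u' v v' with
  | nil => cases hu' <;> simp_all
  | push b _ ih =>
    cases hu' with
    | nil => simp at h
    | push _ h' =>
      simp only [List.cons_append, List.cons.injEq] at h
      obtain ⟨rfl, rfl⟩ := ih h' h.2
      simp [h.1]
    | pop _ h' => simp at h
    | block _ _ => simp at h
  | pop b _ ih =>
    cases hu' with
    | nil => simp at h
    | push _ h' => simp at h
    | pop _ h' =>
      simp only [List.cons_append, List.cons.injEq] at h
      obtain ⟨rfl, rfl⟩ := ih h' h.2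
      simp [h.1]
    | block _ _ => simp at h
  | block _ _ ih1 ih2 =>
    cases hu' with
    | nil => simp at h
    | push _ h' => simp at h
    | pop _ h' => simp at h
    | block h1 h2 =>
      simp only [List.cons_append, List.append_assoc, List.cons.injEq, true_and] at h
      obtain ⟨rfl, h'⟩ := ih1 h1 h
      obtain ⟨rfl, rfl⟩ := ih2 h2 h'
      simp

theorem Nested.append {u v : List Tok} (hu : Nested u) (hv : Nested v) : Nested (u ++ v) := by
  induction hu with
  | nil => exact hv
  | push b _ ih => exact ih.push b
  | pop b _ ih => exact ih.pop b
  | block h1 _ _ ih => simpa using Nested.block h1 ih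

theorem run_block_iff {u w : List Tok} (hu : Nested u) {σ τ : List Bool} :
    Run (Tok.lb :: (u ++ Tok.rb :: w)) σ τ ↔ Run w σ τ ∨ Run (u ++ Tok.rb :: w) σ τ := by
  constructor
  · intro h
    generalize hx : Tok.lb :: (u ++ Tok.rb :: w) = x at h
    cases h with
    | lb h =>
      simp only [List.cons.injEq, true_and] at hx
      subst hx
      exact Or.inr h
    | skip hu' h =>
      simp only [List.cons_append, List.cons.injEq, true_and] at hx
      obtain ⟨rfl, rfl⟩ := hu.append_rb_inj hu' hx
      exact Or.inl h
    | _ => simp at hx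
  · rintro (h | h)
    · exact Run.skip hu h
    · exact h.lb

/-- A stack of numbers, each number in unary. -/
def codeStack : List ℕ → List Bool
  | [] => []
  | x :: σ => List.replicate x true ++ false :: codeStack σ

/-- A stack program realizes a relation on stacks of numbers. -/
def Realizes (p : List Tok) (R : List ℕ → List ℕ → Prop) : Prop :=
  Nested p ∧ ∀ rest σ τ, Run (p ++ rest) (codeStack σ) τ ↔
    ∃ ρ, R σ ρ ∧ Run rest (codeStack ρ) τ

/-- The composition of the relations `R (n - 1), …, R 0`. -/
def compDown {S : Type*} (R : ℕ → S → S → Prop) : ℕ → S → S → Prop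
  | 0 => Eq
  | n + 1 => fun σ τ => ∃ ρ, R n σ ρ ∧ compDown R n ρ τ

namespace Realizes

variable {p q : List Tok} {R R' : List ℕ → List ℕ → Prop}

theorem congr (h : Realizes p R) (hR : ∀ σ τ, R σ τ ↔ R' σ τ) : Realizes p R' := by
  obtain rfl : R = R' := by
    funext σ τ
    exact propext (hR σ τ)
  exact h

theorem nil : Realizes [] Eq := ⟨Nested.nil, fun rest σ τ => by simp⟩

theorem seq (hp : Realizes p R) (hq : Realizes q R') :
    Realizes (p ++ q) fun σ τ => ∃ ρ, R σ ρ ∧ R' ρ τ := by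
  refine ⟨hp.1.append hq.1, fun rest σ τ => ?_⟩
  rw [List.append_assoc, hp.2]
  constructor
  · rintro ⟨ρ, h1, h2⟩
    obtain ⟨ρ', h3, h4⟩ := (hq.2 _ _ _).1 h2
    exact ⟨ρ', ⟨ρ, h1, h3⟩, h4⟩
  · rintro ⟨ρ', ⟨ρ, h1, h3⟩, h4⟩
    exact ⟨ρ, h1, (hq.2 _ _ _).2 ⟨ρ', h3, h4⟩⟩

theorem opt (hp : Realizes p R) :
    Realizes (Tok.lb :: p ++ [Tok.rb]) fun σ τ => σ = τ ∨ R σ τ := by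
  refine ⟨Nested.block hp.1 Nested.nil, fun rest σ τ => ?_⟩
  have : Tok.lb :: p ++ [Tok.rb] ++ rest = Tok.lb :: (p ++ Tok.rb :: rest) := by simp
  rw [this, run_block_iff hp.1, hp.2]
  constructor
  · rintro (h | ⟨ρ, h1, h2⟩)
    · exact ⟨σ, Or.inl rfl, h⟩
    · exact ⟨ρ, Or.inr h1, run_rb_iff.1 h2⟩
  · rintro ⟨ρ, rfl | h1, h2⟩
    · exact Or.inl h2
    · exact Or.inr ⟨ρ, h1, run_rb_iff.2 h2⟩

theorem loop {p : ℕ → List Tok} {R : ℕ → List ℕ → List ℕ → Prop}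
    (hp : ∀ x, Realizes (p x) (R x)) (n : ℕ) :
    Realizes ((List.range n).reverse.flatMap p) (compDown R n) := by
  induction n with
  | zero => simpa [compDown] using nil
  | succ n ih =>
    rw [List.range_succ, List.reverse_append]
    rw [List.reverse_singleton, List.singleton_append, List.flatMap_cons]
    exact (hp n).seq ih

/-- Pushing one at a time lays the new letters over the old; as they are all equal, their order is
irrelevant. -/
theorem run_pushes (x : ℕ) (rest : List Tok) (σ τ : List Bool) :
    Run (List.replicate x (Tok.push true) ++ rest) σ τ ↔
      Run rest (List.replicate x true ++ σ) τ := by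
  induction x generalizing σ with
  | zero => simp
  | succ x ih =>
    rw [List.replicate_succ, List.cons_append, run_push_iff, ih, List.replicate_succ',
      List.append_assoc]
    rfl

theorem push (x : ℕ) : Realizes (Tok.push false :: List.replicate x (Tok.push true))
    fun σ τ => τ = x :: σ := by
  constructor
  · refine Nested.push _ ?_
    induction x with
    | zero => exact Nested.nil
    | succ x ih => exact ih.push _
  · intro rest σ τ
    rw [List.cons_append, run_push_iff, run_pushes]
    simp [codeStack]

/-- The separator `false` lies below the unary digits. Too few or too many pops of `true` meet the
wrong letter, so popping a number compares it exactly with the top. -/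
theorem run_pops (x y : ℕ) (rest : List Tok) (σ τ : List Bool) :
    Run (List.replicate x (Tok.pop true) ++ Tok.pop false :: rest)
      (List.replicate y true ++ false :: σ) τ ↔ x = y ∧ Run rest σ τ := by
  induction x generalizing y with
  | zero =>
    cases y with
    | zero => simp [run_pop_iff]
    | succ y => simp [run_pop_iff, List.replicate_succ]
  | succ x ih =>
    cases y with
    | zero => simp [run_pop_iff, List.replicate_succ]
    | succ y => simp [run_pop_iff, List.replicate_succ, ih]

theorem pop (x : ℕ) : Realizes (List.replicate x (Tok.pop true) ++ [Tok.pop false])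
    fun σ τ => σ = x :: τ := by
  constructor
  · induction x with
    | zero => exact Nested.nil.pop _
    | succ x ih => exact ih.pop _
  · intro rest σ τ
    rw [List.append_assoc, List.singleton_append]
    cases σ with
    | nil =>
      cases x <;> simp [codeStack, run_pop_iff, List.replicate_succ]
    | cons y σ =>
      rw [codeStack, run_pops]
      constructor
      · rintro ⟨rfl, h⟩
        exact ⟨σ, rfl, h⟩
      · rintro ⟨ρ, h, h'⟩
        obtain ⟨rfl, rfl⟩ := List.cons.inj h
        exact ⟨rfl, h'⟩

end Realizes

/-! ### Programmable relations -/

variable {α : Type u}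

/-- A sum of a constant and variables. -/
class Lin (t : List α → (ℕ → ℕ) → ℕ) : Prop where
  exists_eq : ∃ (c : ℕ) (l : List ℕ), ∀ w e, t w e = c + (l.map e).sum

instance Lin.var (i : ℕ) : Lin (fun (_ : List α) e => e i) := ⟨0, [i], by simp⟩

instance Lin.const (c : ℕ) : Lin (fun (_ : List α) _ => c) := ⟨c, [], by simp⟩

instance Lin.add (t u : List α → (ℕ → ℕ) → ℕ) [ht : Lin t] [hu : Lin u] :
    Lin (fun w e => t w e + u w e) := by
  obtain ⟨c, l, h⟩ := ht
  obtain ⟨d, m, h'⟩ := hu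
  exact ⟨c + d, l ++ m, fun w e => by simp [h, h']; ring⟩

instance Lin.const_mul (b : ℕ) (t : List α → (ℕ → ℕ) → ℕ) [ht : Lin t] :
    Lin (fun w e => b * t w e) := by
  induction b with
  | zero => simpa using Lin.const (α := α) 0
  | succ b ih => simpa [Nat.succ_mul] using Lin.add (fun w e => b * t w e) t

instance Lin.rename (t : List α → (ℕ → ℕ) → ℕ) (g : ℕ → ℕ) [ht : Lin t] :
    Lin (fun w e => t w fun i => e (g i)) := by
  obtain ⟨c, l, h⟩ := ht
  exact ⟨c, l.map g, fun w e => by simp [h, Function.comp_def]⟩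

/-- A relation on stacks of numbers, depending on an input word and an environment, which is
realized by a program with the global bound `N`. -/
def Programmable (N : List α → ℕ) (R : List α → (ℕ → ℕ) → List ℕ → List ℕ → Prop) : Prop :=
  ∃ p : EProg α Tok, ∀ w e, Realizes (p.out (N w) w e) (R w e)

namespace Programmable

variable {N : List α → ℕ} {R R' : List α → (ℕ → ℕ) → List ℕ → List ℕ → Prop}

theorem congr (h : Programmable N R) (hR : ∀ w e σ τ, R w e σ τ ↔ R' w e σ τ) :
    Programmable N R' := by
  obtain ⟨p, hp⟩ := h
  exact ⟨p, fun w e => (hp w e).congr (hR w e)⟩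

theorem nil : Programmable N fun _ _ σ τ => σ = τ := ⟨EProg.nil, fun _ _ => Realizes.nil⟩

theorem seq (h : Programmable N R) (h' : Programmable N R') :
    Programmable N fun w e σ τ => ∃ ρ, R w e σ ρ ∧ R' w e ρ τ := by
  obtain ⟨p, hp⟩ := h
  obtain ⟨q, hq⟩ := h'
  exact ⟨p.seq q, fun w e => (hp w e).seq (hq w e)⟩

theorem opt (h : Programmable N R) : Programmable N fun w e σ τ => σ = τ ∨ R w e σ τ := by
  obtain ⟨p, hp⟩ := h
  refine ⟨(EProg.emit Tok.lb).seq (p.seq (EProg.emit Tok.rb)), fun w e => ?_⟩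
  simpa [EProg.out] using (hp w e).opt

/-- The bound of a loop. -/
def bound (N : List α → ℕ) (b : Option ℕ) (w : List α) (e : ℕ → ℕ) : ℕ := EProg.bnd (N w) e b

theorem loop (b : Option ℕ) {R : List α → (ℕ → ℕ) → ℕ → List ℕ → List ℕ → Prop}
    (h : Programmable N fun w e => R w (fun i => e (i + 1)) (e 0)) :
    Programmable N fun w e => compDown (R w e) (bound N b w e) := by
  obtain ⟨p, hp⟩ := h
  exact ⟨EProg.loop b p, fun w e => Realizes.loop (fun x => hp w (consEnv x e)) _⟩

/-- A constant is unrolled into single emissions, and each variable of the sum becomes the bound of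
a loop. -/
theorem replicate (t : List α → (ℕ → ℕ) → ℕ) [ht : Lin t] (b : Tok) :
    ∃ p : EProg α Tok, ∀ M w e, p.out M w e = List.replicate (t w e) b := by
  obtain ⟨c, l, h⟩ := ht
  have h1 : ∃ p : EProg α Tok, ∀ M w e, p.out M w e = List.replicate c b := by
    induction c generalizing t with
    | zero => exact ⟨EProg.nil, fun M w e => rfl⟩
    | succ c ih =>
      obtain ⟨p, hp⟩ := ih (fun w e => c + (l.map e).sum) (fun w e => rfl)
      exact ⟨(EProg.emit b).seq p, fun M w e => by simp [EProg.out, hp, List.replicate_succ]⟩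
  have h2 : ∃ p : EProg α Tok, ∀ M w e, p.out M w e = List.replicate (l.map e).sum b := by
    clear h
    induction l with
    | nil => exact ⟨EProg.nil, fun M w e => rfl⟩
    | cons i l ih =>
      obtain ⟨p, hp⟩ := ih
      refine ⟨(EProg.loop (some i) (EProg.emit b)).seq p, fun M w e => ?_⟩
      have h3 : ∀ n, (List.range n).reverse.flatMap (fun _ => [b]) = List.replicate n b := by
        intro n
        induction n with
        | zero => rfl
        | succ n ih => rw [List.range_succ, List.reverse_append]; simp_all [List.replicate_succ]
      simp only [EProg.out, EProg.bnd, h3, hp, List.map_cons, List.sum_cons, List.replicate_add]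
  obtain ⟨p, hp⟩ := h1
  obtain ⟨q, hq⟩ := h2
  exact ⟨p.seq q, fun M w e => by
    simp only [EProg.out, hp, hq, h, List.replicate_add]⟩

theorem push (t : List α → (ℕ → ℕ) → ℕ) [Lin t] :
    Programmable N fun w e σ τ => τ = t w e :: σ := by
  obtain ⟨p, hp⟩ := replicate t (Tok.push true)
  refine ⟨(EProg.emit (Tok.push false)).seq p, fun w e => ?_⟩
  simpa [EProg.out, hp] using Realizes.push (t w e)

theorem pop (t : List α → (ℕ → ℕ) → ℕ) [Lin t] :
    Programmable N fun w e σ τ => σ = t w e :: τ := by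
  obtain ⟨p, hp⟩ := replicate t (Tok.pop true)
  refine ⟨p.seq (EProg.emit (Tok.pop false)), fun w e => ?_⟩
  simpa [EProg.out, hp] using Realizes.pop (t w e)

/-- Exactly one of a sequence of alternatives is executed. -/
theorem compDown_choice (R : ℕ → List ℕ → List ℕ → Prop) (n : ℕ) (σ τ : List ℕ) :
    compDown (fun x σ τ => σ = τ ∨ ∃ ρ, σ = 0 :: ρ ∧ ∃ ρ', R x ρ ρ' ∧ τ = 1 :: ρ') n σ τ ↔
      σ = τ ∨ ∃ ρ, σ = 0 :: ρ ∧ ∃ ρ', (∃ x < n, R x ρ ρ') ∧ τ = 1 :: ρ' := by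
  induction n generalizing σ with
  | zero => simp [compDown]
  | succ n ih =>
    simp only [compDown, ih]
    constructor
    · rintro ⟨ρ₁, rfl | ⟨ρ, rfl, ρ', h, rfl⟩, h'⟩
      · rcases h' with rfl | ⟨ρ, rfl, ρ', ⟨x, hx, h⟩, rfl⟩
        · exact Or.inl rfl
        · exact Or.inr ⟨ρ, rfl, ρ', ⟨x, by omega, h⟩, rfl⟩
      · rcases h' with rfl | ⟨ρ, h1, -⟩
        · exact Or.inr ⟨ρ, rfl, ρ', ⟨n, by omega, h⟩, rfl⟩
        · simp at h1
    · rintro (rfl | ⟨ρ, rfl, ρ', ⟨x, hx, h⟩, rfl⟩)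
      · exact ⟨σ, Or.inl rfl, Or.inl rfl⟩
      · rcases Nat.lt_succ_iff_lt_or_eq.1 hx with hx | rfl
        · exact ⟨_, Or.inl rfl, Or.inr ⟨ρ, rfl, ρ', ⟨x, hx, h⟩, rfl⟩⟩
        · exact ⟨_, Or.inr ⟨ρ, rfl, ρ', h, rfl⟩, Or.inl rfl⟩

/-- Optional blocks alone do not enforce a choice. A flag 0 is pushed, each block exchanges it for 1
around its alternative, and a final pop of 1 succeeds only if exactly one block was executed. -/
theorem exB (b : Option ℕ) {R : List α → (ℕ → ℕ) → ℕ → List ℕ → List ℕ → Prop}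
    (h : Programmable N fun w e => R w (fun i => e (i + 1)) (e 0)) :
    Programmable N fun w e σ τ => ∃ x < bound N b w e, R w e x σ τ := by
  refine ((push fun _ _ => 0).seq (Programmable.seq (Programmable.loop b
    (R := fun w e x σ τ => σ = τ ∨ ∃ ρ, σ = 0 :: ρ ∧ ∃ ρ', R w e x ρ ρ' ∧ τ = 1 :: ρ')
    ((pop fun _ _ => 0).seq (h.seq (push fun _ _ => 1))).opt) (pop fun _ _ => 1))).congr ?_
  intro w e σ τ
  simp [compDown_choice]

theorem ex {R : List α → (ℕ → ℕ) → ℕ → List ℕ → List ℕ → Prop}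
    (h : Programmable N fun w e => R w (fun i => e (i + 1)) (e 0)) :
    Programmable N fun w e σ τ => ∃ x < N w, R w e x σ τ := exB none h

theorem or (h : Programmable N R) (h' : Programmable N R') :
    Programmable N fun w e σ τ => R w e σ τ ∨ R' w e σ τ := by
  refine ((push fun _ _ => 0).seq (Programmable.seq
    ((pop fun _ _ => 0).seq (h.seq (push fun _ _ => 1))).opt (Programmable.seq
    ((pop fun _ _ => 0).seq (h'.seq (push fun _ _ => 1))).opt (pop fun _ _ => 1)))).congr ?_
  intro w e σ τ
  constructor
  · rintro ⟨_, rfl, _, rfl | ⟨_, h1, _, h2, rfl⟩, _, rfl | ⟨_, h3, _, h4, rfl⟩, h5⟩ <;> simp_all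
  · rintro (h | h)
    · exact ⟨_, rfl, _, Or.inr ⟨_, rfl, _, h, rfl⟩, _, Or.inl rfl, rfl⟩
    · exact ⟨_, rfl, _, Or.inl rfl, _, Or.inr ⟨_, rfl, _, h, rfl⟩, rfl⟩

theorem fail : Programmable N fun _ _ _ _ => False :=
  ((push fun _ _ => 0).seq (pop fun _ _ => 1)).congr (by simp)

theorem exFinite {ι : Type*} [Finite ι] {R : ι → List α → (ℕ → ℕ) → List ℕ → List ℕ → Prop}
    (h : ∀ i, Programmable N (R i)) : Programmable N fun w e σ τ => ∃ i, R i w e σ τ := by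
  classical
  have := Fintype.ofFinite ι
  have key : ∀ l : List ι, Programmable N fun w e σ τ => ∃ i ∈ l, R i w e σ τ := by
    intro l
    induction l with
    | nil => exact fail.congr (by simp)
    | cons i l ih => exact ((h i).or ih).congr (by simp)
  exact (key Finset.univ.toList).congr (by simp)

/-- The test is made while the program is being printed, so both outcomes are available. This is the
source of all predicates in `Dec`. -/
theorem ite (t : List α → (ℕ → ℕ) → ℕ) [ht : Lin t] (P : InputSym α → Prop)
    (h : Programmable N R) (h' : Programmable N R') :
    Programmable N fun w e σ τ => (P (inputAt w (t w e)) ∧ R w e σ τ) ∨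
      (¬ P (inputAt w (t w e)) ∧ R' w e σ τ) := by
  classical
  obtain ⟨p, hp⟩ := h
  obtain ⟨q, hq⟩ := h'
  obtain ⟨c, l, h⟩ := ht
  refine ⟨EProg.ifSym c l (fun x => decide (P x)) p q, fun w e => ?_⟩
  by_cases hP : P (inputAt w (t w e))
  · simpa [EProg.out, hP, ← h w e] using hp w e
  · simpa [EProg.out, hP, ← h w e] using hq w e

end Programmable

/-! ### Testable and decidable predicates -/

/-- A predicate which can be tested by a stack program. -/
def Tst (N : List α → ℕ) (φ : List α → (ℕ → ℕ) → Prop) : Prop :=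
  Programmable N fun w e σ τ => σ = τ ∧ φ w e

namespace Tst

open Programmable

variable {N : List α → ℕ} {φ ψ : List α → (ℕ → ℕ) → Prop}

theorem congr (h : Tst N φ) (hφ : ∀ w e, φ w e ↔ ψ w e) : Tst N ψ :=
  Programmable.congr h fun w e σ τ => by rw [hφ]

theorem and (h : Tst N φ) (h' : Tst N ψ) : Tst N fun w e => φ w e ∧ ψ w e :=
  (h.seq h').congr fun w e σ τ => by
    constructor
    · rintro ⟨_, ⟨rfl, h⟩, rfl, h'⟩
      exact ⟨rfl, h, h'⟩
    · rintro ⟨rfl, h, h'⟩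
      exact ⟨_, ⟨rfl, h⟩, rfl, h'⟩

theorem or (h : Tst N φ) (h' : Tst N ψ) : Tst N fun w e => φ w e ∨ ψ w e :=
  (Programmable.or h h').congr fun _ _ _ _ => by tauto

theorem true : Tst N fun _ _ => True := nil.congr (by simp)

theorem false : Tst N fun _ _ => False := fail.congr (by simp)

theorem exB (b : Option ℕ) {φ : List α → (ℕ → ℕ) → ℕ → Prop}
    (h : Tst N fun w e => φ w (fun i => e (i + 1)) (e 0)) :
    Tst N fun w e => ∃ x < bound N b w e, φ w e x :=
  (Programmable.exB b (R := fun w e x σ τ => σ = τ ∧ φ w e x) h).congr fun _ _ _ _ => by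
    constructor
    · rintro ⟨x, hx, rfl, h⟩
      exact ⟨rfl, x, hx, h⟩
    · rintro ⟨rfl, x, hx, h⟩
      exact ⟨x, hx, rfl, h⟩

theorem compDown_test (φ : ℕ → Prop) (n : ℕ) (σ τ : List ℕ) :
    compDown (fun x σ τ => σ = τ ∧ φ x) n σ τ ↔ σ = τ ∧ ∀ x < n, φ x := by
  induction n generalizing σ with
  | zero => simp [compDown]
  | succ n ih =>
    simp only [compDown, ih]
    constructor
    · rintro ⟨_, ⟨rfl, h⟩, rfl, h'⟩
      refine ⟨rfl, fun x hx => ?_⟩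
      rcases Nat.lt_succ_iff_lt_or_eq.1 hx with hx | rfl
      · exact h' x hx
      · exact h
    · rintro ⟨rfl, h⟩
      exact ⟨_, ⟨rfl, h n n.lt_succ_self⟩, rfl, fun x hx => h x (hx.trans n.lt_succ_self)⟩

theorem allB (b : Option ℕ) {φ : List α → (ℕ → ℕ) → ℕ → Prop}
    (h : Tst N fun w e => φ w (fun i => e (i + 1)) (e 0)) :
    Tst N fun w e => ∀ x < bound N b w e, φ w e x :=
  (Programmable.loop b (R := fun w e x σ τ => σ = τ ∧ φ w e x) h).congr fun _ _ _ _ =>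
    compDown_test _ _ _ _

theorem eq (t u : List α → (ℕ → ℕ) → ℕ) [Lin t] [Lin u] : Tst N fun w e => t w e = u w e :=
  ((push t).seq (pop u)).congr fun w e σ τ => by
    constructor
    · rintro ⟨_, rfl, h⟩
      simp_all
    · rintro ⟨rfl, h⟩
      exact ⟨_, rfl, by rw [h]⟩

theorem exFinite {ι : Type*} [Finite ι] {φ : ι → List α → (ℕ → ℕ) → Prop}
    (h : ∀ i, Tst N (φ i)) : Tst N fun w e => ∃ i, φ i w e :=
  (Programmable.exFinite h).congr fun w e σ τ => by
    constructor
    · rintro ⟨x, rfl, h⟩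
      exact ⟨rfl, x, h⟩
    · rintro ⟨rfl, x, h⟩
      exact ⟨x, rfl, h⟩

end Tst

/-- A predicate which can be tested by a stack program, and whose negation can be tested, too. -/
def Dec (N : List α → ℕ) (φ : List α → (ℕ → ℕ) → Prop) : Prop :=
  Tst N φ ∧ Tst N fun w e => ¬ φ w e

namespace Dec

open Programmable

variable {N : List α → ℕ} {φ ψ : List α → (ℕ → ℕ) → Prop}

theorem congr (h : Dec N φ) (hφ : ∀ w e, φ w e ↔ ψ w e) : Dec N ψ :=
  ⟨h.1.congr hφ, h.2.congr fun w e => not_congr (hφ w e)⟩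

theorem not (h : Dec N φ) : Dec N fun w e => ¬ φ w e :=
  ⟨h.2, h.1.congr fun _ _ => not_not.symm⟩

theorem and (h : Dec N φ) (h' : Dec N ψ) : Dec N fun w e => φ w e ∧ ψ w e :=
  ⟨h.1.and h'.1, (h.2.or h'.2).congr fun w e => by tauto⟩

theorem or (h : Dec N φ) (h' : Dec N ψ) : Dec N fun w e => φ w e ∨ ψ w e :=
  ⟨h.1.or h'.1, (h.2.and h'.2).congr fun w e => by tauto⟩

theorem exB (b : Option ℕ) {φ : List α → (ℕ → ℕ) → ℕ → Prop}
    (h : Dec N fun w e => φ w (fun i => e (i + 1)) (e 0)) :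
    Dec N fun w e => ∃ x < bound N b w e, φ w e x :=
  ⟨Tst.exB b h.1, (Tst.allB b (φ := fun w e x => ¬ φ w e x) h.2).congr fun w e => by
    push Not; rfl⟩

theorem allB (b : Option ℕ) {φ : List α → (ℕ → ℕ) → ℕ → Prop}
    (h : Dec N fun w e => φ w (fun i => e (i + 1)) (e 0)) :
    Dec N fun w e => ∀ x < bound N b w e, φ w e x :=
  (exB b (φ := fun w e x => ¬ φ w e x) h.not).not.congr fun w e => by push Not; rfl

theorem ex {φ : List α → (ℕ → ℕ) → ℕ → Prop}
    (h : Dec N fun w e => φ w (fun i => e (i + 1)) (e 0)) :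
    Dec N fun w e => ∃ x < N w, φ w e x := exB none h

theorem all {φ : List α → (ℕ → ℕ) → ℕ → Prop}
    (h : Dec N fun w e => φ w (fun i => e (i + 1)) (e 0)) :
    Dec N fun w e => ∀ x < N w, φ w e x := allB none h

theorem allVar {φ : List α → (ℕ → ℕ) → ℕ → Prop} (j : ℕ)
    (h : Dec N fun w e => φ w (fun i => e (i + 1)) (e 0)) :
    Dec N fun w e => ∀ x < e j, φ w e x := allB (some j) h

theorem sym (t : List α → (ℕ → ℕ) → ℕ) [Lin t] (P : InputSym α → Prop) :
    Dec N fun w e => P (inputAt w (t w e)) := by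
  have h := fun {φ ψ : List α → (ℕ → ℕ) → Prop} (h : Tst N φ) (h' : Tst N ψ) =>
    Programmable.ite t P h h'
  refine ⟨(h Tst.true Tst.false).congr fun w e σ τ => by tauto,
    (h Tst.false Tst.true).congr fun w e σ τ => by tauto⟩

end Dec

/-! ### Acyclicity by inductive counting -/

/-- Iteration peels off its first factor by definition. For a constant relation the last factor can
be peeled off instead, which is how walks are extended. -/
theorem compDown_const_succ {S : Type*} (R : S → S → Prop) (n : ℕ) (σ τ : S) :
    compDown (fun _ => R) (n + 1) σ τ ↔ ∃ ρ, compDown (fun _ => R) n σ ρ ∧ R ρ τ := by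
  induction n generalizing σ with
  | zero => simp [compDown]
  | succ n ih =>
    rw [compDown]
    constructor
    · rintro ⟨ρ, h, h'⟩
      obtain ⟨ρ', h1, h2⟩ := (ih ρ).1 h'
      exact ⟨ρ', ⟨ρ, h, h1⟩, h2⟩
    · rintro ⟨ρ', ⟨ρ, h, h1⟩, h2⟩
      exact ⟨ρ, h, (ih ρ).2 ⟨ρ', h1, h2⟩⟩

/-! ### Inductive counting of the ends of walks in a finite graph. -/

section Walks

variable (M : ℕ) (V : ℕ → Prop) (E : ℕ → ℕ → Prop)

/-- Some walk of length `k` through vertices below `M` ends in `v`. -/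
def EndsWalk : ℕ → ℕ → Prop
  | 0, v => v < M ∧ V v
  | k + 1, v => v < M ∧ ∃ u < M, EndsWalk k u ∧ E u v

open Classical in
/-- The number of vertices in which a walk of length `k` ends. -/
noncomputable def walkCount (k : ℕ) : ℕ := ((Finset.range M).filter (EndsWalk M V E k)).card

variable {M V E}

theorem EndsWalk.lt {k v : ℕ} (h : EndsWalk M V E k v) : v < M := by
  cases k <;> exact h.1

/-- The number 0 is kept out of the vertex set, so that the count stays strictly below `M` and can
be guessed like any other bounded number. -/
theorem walkCount_lt (hM : 0 < M) (hV : ¬ V 0) (hE : ∀ u, ¬ E u 0) (k : ℕ) :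
    walkCount M V E k < M := by
  classical
  rw [walkCount]
  calc _ < (Finset.range M).card := by
        refine Finset.card_lt_card ((Finset.filter_ssubset).2 ⟨0, by simpa using hM, ?_⟩)
        cases k with
        | zero => exact fun h => hV h.2
        | succ k =>
          rintro ⟨-, u, -, -, h⟩
          exact hE u h
    _ = M := by simp

theorem endsWalk_of_transGen (hE : ∀ u v, E u v → V u ∧ V v) (hV : ∀ v, V v → v < M) (k : ℕ)
    {v : ℕ} (h : Relation.TransGen E v v) : EndsWalk M V E k v := by
  induction k generalizing v with
  | zero =>
    obtain ⟨u, -, h2⟩ := Relation.TransGen.tail'_iff.1 h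
    exact ⟨hV _ (hE _ _ h2).2, (hE _ _ h2).2⟩
  | succ k ih =>
    obtain ⟨u, h1, h2⟩ := Relation.TransGen.tail'_iff.1 h
    -- The cycle is rotated by one edge, so that it passes through the predecessor `u` and the
    -- induction hypothesis applies to `u`.
    exact ⟨hV _ (hE _ _ h2).2, u, hV _ (hE _ _ h2).1, ih (Relation.TransGen.head' h2 h1), h2⟩

/-- Without cycles no vertex of the walk occurs among its own strict predecessors, so each edge adds
a new element to `s`. -/
theorem le_card_of_endsWalk (h : ∀ v, ¬ Relation.TransGen E v v) {k v : ℕ}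
    (hk : EndsWalk M V E k v) : ∃ s ⊆ Finset.range M, k ≤ s.card ∧
      ∀ u, u ∈ s → Relation.TransGen E u v := by
  induction k generalizing v with
  | zero => exact ⟨∅, by simp, by simp, by simp⟩
  | succ k ih =>
    obtain ⟨-, u, hu, hw, he⟩ := hk
    obtain ⟨s, hs, hc, ht⟩ := ih hw
    refine ⟨insert u s, ?_, ?_, ?_⟩
    · intro x hx
      rcases Finset.mem_insert.1 hx with rfl | hx
      · simpa using hu
      · exact hs hx
    · rw [Finset.card_insert_of_notMem fun hus => h u (ht u hus)]
      omega
    · intro x hx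
      rcases Finset.mem_insert.1 hx with rfl | hx
      · exact Relation.TransGen.single he
      · exact (ht x hx).tail he

/-- A cycle supports walks of every length. Conversely, a walk of length `M` without repetition
would need `M + 1` vertices below `M`. -/
theorem walkCount_eq_zero_iff (hE : ∀ u v, E u v → V u ∧ V v) (hV : ∀ v, V v → v < M) :
    walkCount M V E M = 0 ↔ ∀ v, ¬ Relation.TransGen E v v := by
  classical
  rw [walkCount, Finset.card_eq_zero, Finset.filter_eq_empty_iff]
  constructor
  · intro h v hv
    have := endsWalk_of_transGen hE hV M hv
    exact h (by simpa using this.lt) this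
  · intro h v hv hw
    obtain ⟨s, hs, hc, ht⟩ := le_card_of_endsWalk h hw
    have h1 : insert v s ⊆ Finset.range M := by
      intro x hx
      rcases Finset.mem_insert.1 hx with rfl | hx
      · exact hv
      · exact hs hx
    have h2 := Finset.card_le_card h1
    rw [Finset.card_insert_of_notMem fun hvs => h v (ht v hvs), Finset.card_range] at h2
    omega

/-- If `c` is the number of ends of walks of length `k`, then this says that no walk of length
`k + 1` ends in `v`. -/
def NotNext (M : ℕ) (V : ℕ → Prop) (E : ℕ → ℕ → Prop) (k c v : ℕ) : Prop :=
  ∃ U ⊆ Finset.range M, (∀ u ∈ U, EndsWalk M V E k u ∧ ¬ E u v) ∧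
    (∀ u < M, u ∉ U → True) ∧ c = U.card

/-- This is the core of inductive counting. A set of certified ends that has the correct cardinality
must contain all ends; if none of its members has an edge to `v`, no longer walk reaches `v`. The
vacuous clause of `NotNext` only gives it the shape provided by `Tst.count`. -/
theorem notNext_iff {k v : ℕ} (hv : v < M) :
    NotNext M V E k (walkCount M V E k) v ↔ ¬ EndsWalk M V E (k + 1) v := by
  classical
  constructor
  · rintro ⟨U, hU, h1, -, h2⟩ ⟨-, u, hu, hw, he⟩
    have h3 : U = (Finset.range M).filter (EndsWalk M V E k) := by
      refine Finset.eq_of_subset_of_card_le (fun x hx => ?_) h2.le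
      exact Finset.mem_filter.2 ⟨hU hx, (h1 x hx).1⟩
    have h4 : u ∈ U := by
      rw [h3]
      exact Finset.mem_filter.2 ⟨by simpa using hu, hw⟩
    exact (h1 u h4).2 he
  · intro h
    refine ⟨(Finset.range M).filter (EndsWalk M V E k), Finset.filter_subset _ _, fun u hu => ?_,
      fun _ _ _ => trivial, rfl⟩
    have hu' := (Finset.mem_filter.1 hu).2
    exact ⟨hu', fun he => h ⟨hv, u, hu'.lt, hu', he⟩⟩

/-- If `c` is the number of ends of walks of length `k`, then this says that `c'` is the number of
ends of walks of length `k + 1`. -/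
def CountStep (M : ℕ) (V : ℕ → Prop) (E : ℕ → ℕ → Prop) (k c c' : ℕ) : Prop :=
  ∃ U ⊆ Finset.range M, (∀ v ∈ U, EndsWalk M V E (k + 1) v) ∧
    (∀ v < M, v ∉ U → NotNext M V E k c v) ∧ c' = U.card

/-- Each vertex is certified to be an end or not to be one, and the correctness of the previous
count makes the negative certificates sound. Hence `U` is exactly the set of ends. -/
theorem countStep_iff {k c' : ℕ} :
    CountStep M V E k (walkCount M V E k) c' ↔ c' = walkCount M V E (k + 1) := by
  classical
  constructor
  · rintro ⟨U, hU, h1, h2, rfl⟩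
    rw [walkCount]
    congr 1
    ext v
    simp only [Finset.mem_filter, Finset.mem_range]
    constructor
    · intro h
      exact ⟨by simpa using hU h, h1 v h⟩
    · rintro ⟨hv, hw⟩
      by_contra hvU
      exact (notNext_iff hv).1 (h2 v hv hvU) hw
  · rintro rfl
    refine ⟨(Finset.range M).filter (EndsWalk M V E (k + 1)), Finset.filter_subset _ _,
      fun v hv => (Finset.mem_filter.1 hv).2, fun v hv hvU => (notNext_iff hv).2 fun hw => ?_, rfl⟩
    exact hvU (Finset.mem_filter.2 ⟨by simpa using hv, hw⟩)

end Walks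

/-! ### Stack programs that certify cardinalities, walks and acyclicity. -/

section Programs

open Programmable

variable {α : Type u} {N : List α → ℕ}

/-- A counter lies on top of the stack. Each pass either raises it, at the price of certifying `φ
x`, or leaves it unchanged, at the price of certifying `ψ x`; `U` records the passes of the first
kind. The two predicates need not exclude each other. -/
theorem compDown_count (M : ℕ) (φ ψ : ℕ → Prop) (n d : ℕ) (hd : d + n ≤ M) (ρ τ : List ℕ) :
    compDown (fun x σ τ => (∃ ρ, (σ = ρ ∧ φ x) ∧ ∃ d < M, ∃ ρ', ρ = d :: ρ' ∧ τ = (d + 1) :: ρ') ∨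
      (σ = τ ∧ ψ x)) n (d :: ρ) τ ↔
      ∃ U ⊆ Finset.range n, (∀ v ∈ U, φ v) ∧ (∀ v < n, v ∉ U → ψ v) ∧ τ = (d + U.card) :: ρ := by
  classical
  induction n generalizing d with
  | zero =>
    simp only [compDown, Finset.range_zero, Finset.subset_empty, exists_eq_left]
    simp [eq_comm]
  | succ n ih =>
    rw [compDown]
    constructor
    · rintro ⟨ρ₁, ⟨_, ⟨rfl, h1⟩, d', hd', ρ', h2, rfl⟩ | ⟨rfl, h1⟩, h⟩
      · obtain ⟨rfl, rfl⟩ := List.cons.inj h2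
        obtain ⟨U, hU, h3, h4, rfl⟩ := (ih (d + 1) (by omega)).1 h
        have hn : n ∉ U := fun hn => by simpa using hU hn
        refine ⟨insert n U, ?_, ?_, ?_, ?_⟩
        · rw [Finset.range_add_one]
          exact Finset.insert_subset_insert _ hU
        · intro v hv
          rcases Finset.mem_insert.1 hv with rfl | hv
          · exact h1
          · exact h3 v hv
        · intro v hv hvU
          simp only [Finset.mem_insert, not_or] at hvU
          exact h4 v (by omega) hvU.2
        · rw [Finset.card_insert_of_notMem hn]
          congr 1
          omega
      · obtain ⟨U, hU, h3, h4, rfl⟩ := (ih d (by omega)).1 h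
        refine ⟨U, hU.trans (Finset.range_mono (Nat.le_succ n)), h3, fun v hv hvU => ?_, rfl⟩
        rcases Nat.lt_succ_iff_lt_or_eq.1 hv with hv | rfl
        · exact h4 v hv hvU
        · exact h1
    · rintro ⟨U, hU, h3, h4, rfl⟩
      by_cases hn : n ∈ U
      · refine ⟨(d + 1) :: ρ, Or.inl ⟨_, ⟨rfl, h3 n hn⟩, d, by omega, ρ, rfl, rfl⟩,
          (ih (d + 1) (by omega)).2 ⟨U.erase n, ?_, ?_, ?_, ?_⟩⟩
        · intro v hv
          have h5 := hU (Finset.mem_of_mem_erase hv)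
          have h6 := Finset.ne_of_mem_erase hv
          simp only [Finset.mem_range] at h5 ⊢
          omega
        · exact fun v hv => h3 v (Finset.mem_of_mem_erase hv)
        · intro v hv hvU
          exact h4 v (by omega) fun h => hvU (Finset.mem_erase.2 ⟨by omega, h⟩)
        · have := Finset.card_erase_add_one hn
          congr 1
          omega
      · refine ⟨d :: ρ, Or.inr ⟨rfl, h4 n (by omega) hn⟩,
          (ih d (by omega)).2 ⟨U, ?_, h3, fun v hv hvU => h4 v (by omega) hvU, rfl⟩⟩
        intro v hv
        have h5 := hU hv
        have h6 : v ≠ n := fun h => hn (h ▸ hv)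
        simp only [Finset.mem_range] at h5 ⊢
        omega

/-- Count a set of numbers such that membership in the set and in its complement can be
certified. -/
theorem Tst.count {φ ψ : List α → (ℕ → ℕ) → ℕ → Prop} (t : List α → (ℕ → ℕ) → ℕ) [Lin t]
    (hφ : Tst N fun w e => φ w (fun i => e (i + 1)) (e 0))
    (hψ : Tst N fun w e => ψ w (fun i => e (i + 1)) (e 0)) :
    Tst N fun w e => ∃ U ⊆ Finset.range (N w), (∀ v ∈ U, φ w e v) ∧
      (∀ v < N w, v ∉ U → ψ w e v) ∧ t w e = U.card := by
  have h1 : Programmable N fun (w : List α) (_ : ℕ → ℕ) σ τ =>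
      ∃ d < N w, ∃ ρ', σ = d :: ρ' ∧ τ = (d + 1) :: ρ' :=
    Programmable.ex (R := fun _ _ d σ τ => ∃ ρ', σ = d :: ρ' ∧ τ = (d + 1) :: ρ')
      ((pop fun _ e => e 0).seq (push fun _ e => e 0 + 1))
  have h2 := Programmable.loop (N := N) none (R := fun w e x σ τ =>
    (∃ ρ, (σ = ρ ∧ φ w e x) ∧ ∃ d < N w, ∃ ρ', ρ = d :: ρ' ∧ τ = (d + 1) :: ρ') ∨
      (σ = τ ∧ ψ w e x)) ((Programmable.seq hφ h1).or hψ)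
  refine ((push fun _ _ => 0).seq (h2.seq (pop t))).congr fun w e σ τ => ?_
  constructor
  · rintro ⟨_, rfl, _, h, rfl⟩
    obtain ⟨U, hU, h3, h4, h5⟩ := (compDown_count (N w) _ _ _ 0
      (by simp [Programmable.bound, EProg.bnd]) _ _).1 h
    obtain ⟨h6, rfl⟩ := List.cons.inj h5
    exact ⟨rfl, U, hU, h3, h4, by omega⟩
  · rintro ⟨rfl, U, hU, h3, h4, h5⟩
    refine ⟨_, rfl, _, (compDown_count (N w) _ _ _ 0
      (by simp [Programmable.bound, EProg.bnd]) _ _).2 ⟨U, hU, h3, h4, rfl⟩, by simp [h5]⟩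

variable {V : List α → ℕ → Prop} {E : List α → ℕ → ℕ → Prop}

/-- Only the current vertex is stored. Each pass replaces it by a guessed successor, and the last
one is compared with the prescribed end. -/
theorem Tst.endsWalk (hV : ∀ i, Tst N fun w e => V w (e i))
    (hE : ∀ i j, Tst N fun w e => E w (e i) (e j)) (k i : ℕ) :
    Tst N fun w e => EndsWalk (N w) (V w) (E w) (e k) (e i) := by
  have h1 : Programmable N fun w (_ : ℕ → ℕ) σ τ => ∃ x < N w, ∃ y < N w,
      ∃ ρ, σ = x :: ρ ∧ ∃ ρ', (ρ = ρ' ∧ E w x y) ∧ τ = y :: ρ' :=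
    Programmable.ex (R := fun w _ x σ τ => ∃ y < N w,
      ∃ ρ, σ = x :: ρ ∧ ∃ ρ', (ρ = ρ' ∧ E w x y) ∧ τ = y :: ρ')
      (Programmable.ex (R := fun w e y σ τ =>
        ∃ ρ, σ = e 0 :: ρ ∧ ∃ ρ', (ρ = ρ' ∧ E w (e 0) y) ∧ τ = y :: ρ')
        ((pop fun _ e => e 1).seq (Programmable.seq (hE 1 0) (push fun _ e => e 0))))
  have h2 : Programmable N fun w (_ : ℕ → ℕ) σ τ => ∃ x < N w, ∃ ρ, (σ = ρ ∧ V w x) ∧ τ = x :: ρ :=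
    Programmable.ex (R := fun w e x σ τ => ∃ ρ, (σ = ρ ∧ V w x) ∧ τ = x :: ρ)
      (Programmable.seq (hV 0) (push fun _ e => e 0))
  have h3 := h2.seq ((Programmable.loop (some k) (R := fun w e _ σ τ => ∃ x < N w, ∃ y < N w,
      ∃ ρ, σ = x :: ρ ∧ ∃ ρ', (ρ = ρ' ∧ E w x y) ∧ τ = y :: ρ') h1).seq (pop fun _ e => e i))
  refine h3.congr fun w e σ τ => ?_
  have key : ∀ n x σ', compDown (fun _ σ τ => ∃ x < N w, ∃ y < N w,
      ∃ ρ, σ = x :: ρ ∧ ∃ ρ', (ρ = ρ' ∧ E w x y) ∧ τ = y :: ρ') n (x :: σ) σ' →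
      x < N w → V w x → ∃ y, σ' = y :: σ ∧ EndsWalk (N w) (V w) (E w) n y := by
    intro n x σ' h hx hV
    induction n generalizing σ' with
    | zero =>
      cases h
      exact ⟨x, rfl, hx, hV⟩
    | succ n ih =>
      obtain ⟨ρ, h', u, hu, y, hy, ρ₁, rfl, _, ⟨rfl, h4⟩, rfl⟩ := (compDown_const_succ _ _ _ _).1 h
      obtain ⟨_, h5, h6⟩ := ih _ h'
      obtain ⟨rfl, rfl⟩ := List.cons.inj h5
      exact ⟨y, rfl, hy, u, hu, h6, h4⟩
  have key2 : ∀ n y, EndsWalk (N w) (V w) (E w) n y → ∃ x < N w, V w x ∧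
      compDown (fun _ σ τ => ∃ x < N w, ∃ y < N w,
      ∃ ρ, σ = x :: ρ ∧ ∃ ρ', (ρ = ρ' ∧ E w x y) ∧ τ = y :: ρ') n (x :: σ) (y :: σ) := by
    intro n y h
    induction n generalizing y with
    | zero => exact ⟨y, h.1, h.2, rfl⟩
    | succ n ih =>
      obtain ⟨hy, u, hu, h1, h2⟩ := h
      obtain ⟨x, hx, hV, h⟩ := ih u h1
      exact ⟨x, hx, hV, (compDown_const_succ _ _ _ _).2
        ⟨_, h, u, hu, y, hy, σ, rfl, σ, ⟨rfl, h2⟩, rfl⟩⟩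
  constructor
  · rintro ⟨_, ⟨x, hx, _, ⟨rfl, hV⟩, rfl⟩, _, h, rfl⟩
    obtain ⟨y, h5, h6⟩ := key _ _ _ h hx hV
    obtain ⟨rfl, rfl⟩ := List.cons.inj h5
    exact ⟨rfl, h6⟩
  · rintro ⟨rfl, h⟩
    obtain ⟨x, hx, hV, h⟩ := key2 _ _ h
    exact ⟨_, ⟨x, hx, _, ⟨rfl, hV⟩, rfl⟩, _, h, rfl⟩

theorem Tst.notNext (hV : ∀ i, Tst N fun w e => V w (e i))
    (hE : ∀ i j, Dec N fun w e => E w (e i) (e j)) (k c v : ℕ) :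
    Tst N fun w e => NotNext (N w) (V w) (E w) (e k) (e c) (e v) :=
  Tst.count (φ := fun w e u => EndsWalk (N w) (V w) (E w) (e k) u ∧ ¬ E w u (e v))
    (ψ := fun _ _ _ => True) (fun _ e => e c)
    ((Tst.endsWalk hV (fun i j => (hE i j).1) (k + 1) 0).and (hE 0 (v + 1)).2) Tst.true

theorem Tst.countStep (hV : ∀ i, Tst N fun w e => V w (e i))
    (hE : ∀ i j, Dec N fun w e => E w (e i) (e j)) (k c c' : ℕ) :
    Tst N fun w e => CountStep (N w) (V w) (E w) (e k) (e c) (e c') := by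
  -- Loop bounds are variables, so a walk of length `k + 1` is certified as a walk of length `k`
  -- followed by one more edge.
  have h1 : Tst N fun w e => ∃ u < N w, EndsWalk (N w) (V w) (E w) (e (k + 1)) u ∧ E w u (e 0) :=
    Tst.exB none (φ := fun w e u => EndsWalk (N w) (V w) (E w) (e (k + 1)) u ∧ E w u (e 0))
      ((Tst.endsWalk hV (fun i j => (hE i j).1) (k + 1 + 1) 0).and (hE 0 1).1)
  refine (Tst.count (φ := fun w e v => ∃ u < N w, EndsWalk (N w) (V w) (E w) (e k) u ∧ E w u v)
    (ψ := fun w e v => NotNext (N w) (V w) (E w) (e k) (e c) v) (fun _ e => e c') h1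
    (Tst.notNext hV hE (k + 1) (c + 1) 0)).congr fun w e => ?_
  refine exists_congr fun U => and_congr_right fun hU => and_congr_left fun _ => ?_
  refine forall₂_congr fun v hv => ?_
  have : v < N w := by simpa using hU hv
  simp [EndsWalk, this]

/-- The test for acyclicity of a graph whose edge relation is decidable. -/
theorem Tst.acyclic (hN : ∀ w, 0 < N w) (hV : ∀ i, Dec N fun w e => V w (e i))
    (hE : ∀ i j, Dec N fun w e => E w (e i) (e j)) (hV0 : ∀ w, ¬ V w 0)
    (hVN : ∀ w v, V w v → v < N w) (hEV : ∀ w u v, E w u v → V w u ∧ V w v) :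
    Tst N fun w _ => ∀ v, ¬ Relation.TransGen (E w) v v := by
  have hE0 : ∀ w u, ¬ E w u 0 := fun w u h => hV0 w (hEV w u 0 h).2
  -- Walks of length 0 end in all vertices, and these can be counted directly because being a vertex
  -- is decidable.
  have h0 : Tst N fun w e => e 0 = walkCount (N w) (V w) (E w) 0 := by
    refine (Tst.count (φ := fun w _ v => V w v) (ψ := fun w _ v => ¬ V w v) (fun _ e => e 0)
      (hV 0).1 (hV 0).2).congr fun w e => ?_
    classical
    constructor
    · rintro ⟨U, hU, h1, h2, h3⟩
      rw [h3, walkCount]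
      congr 1
      ext v
      rw [Finset.mem_filter, Finset.mem_range]
      constructor
      · exact fun hv => ⟨by simpa using hU hv, by simpa using hU hv, h1 v hv⟩
      · rintro ⟨h4, -, h5⟩
        by_contra hvU
        exact h2 v h4 hvU h5
    · intro h
      refine ⟨(Finset.range (N w)).filter (EndsWalk (N w) (V w) (E w) 0),
        Finset.filter_subset _ _, fun v hv => (Finset.mem_filter.1 hv).2.2, fun v hv hvU hV => hvU ?_, h⟩
      exact Finset.mem_filter.2 ⟨by simpa using hv, hv, hV⟩
  have h1 : Programmable N fun w (_ : ℕ → ℕ) σ τ => ∃ c < N w, ∃ ρ,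
      (σ = ρ ∧ c = walkCount (N w) (V w) (E w) 0) ∧ ∃ ρ', ρ' = 0 :: ρ ∧ τ = c :: ρ' :=
    Programmable.ex (R := fun w _ c σ τ => ∃ ρ,
      (σ = ρ ∧ c = walkCount (N w) (V w) (E w) 0) ∧ ∃ ρ', ρ' = 0 :: ρ ∧ τ = c :: ρ')
      (Programmable.seq h0 ((push fun _ _ => 0).seq (push fun _ e => e 0)))
  -- Loop variables decrease while the walk length has to grow. The length `k` is therefore kept on
  -- the stack, below the current count.
  have h2 : Programmable N fun w (_ : ℕ → ℕ) σ τ => ∃ k < N w, ∃ c < N w, ∃ c' < N w,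
      ∃ ρ, σ = c :: ρ ∧ ∃ ρ', ρ = k :: ρ' ∧ ∃ ρ'', (ρ' = ρ'' ∧
        CountStep (N w) (V w) (E w) k c c') ∧ ∃ ρ₃, ρ₃ = (k + 1) :: ρ'' ∧ τ = c' :: ρ₃ :=
    Programmable.ex (R := fun w _ k σ τ => ∃ c < N w, ∃ c' < N w,
      ∃ ρ, σ = c :: ρ ∧ ∃ ρ', ρ = k :: ρ' ∧ ∃ ρ'', (ρ' = ρ'' ∧
        CountStep (N w) (V w) (E w) k c c') ∧ ∃ ρ₃, ρ₃ = (k + 1) :: ρ'' ∧ τ = c' :: ρ₃)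
      (Programmable.ex (R := fun w e c σ τ => ∃ c' < N w,
      ∃ ρ, σ = c :: ρ ∧ ∃ ρ', ρ = e 0 :: ρ' ∧ ∃ ρ'', (ρ' = ρ'' ∧
        CountStep (N w) (V w) (E w) (e 0) c c') ∧ ∃ ρ₃, ρ₃ = (e 0 + 1) :: ρ'' ∧ τ = c' :: ρ₃)
      (Programmable.ex (R := fun w e c' σ τ =>
      ∃ ρ, σ = e 0 :: ρ ∧ ∃ ρ', ρ = e 1 :: ρ' ∧ ∃ ρ'', (ρ' = ρ'' ∧
        CountStep (N w) (V w) (E w) (e 1) (e 0) c') ∧ ∃ ρ₃, ρ₃ = (e 1 + 1) :: ρ'' ∧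
          τ = c' :: ρ₃)
      ((pop fun _ e => e 1).seq ((pop fun _ e => e 2).seq (Programmable.seq
        (Tst.countStep (fun i => (hV i).1) hE 2 1 0)
        ((push fun _ e => e 2 + 1).seq (push fun _ e => e 0)))))))
  -- The length left on the stack is `N w`, which is not below the bound and so is discarded in the
  -- form `k + 1`. Its value need not be checked.
  have h3 : Programmable N fun w (_ : ℕ → ℕ) σ τ => ∃ k < N w, σ = (k + 1) :: τ :=
    Programmable.ex (R := fun w _ k σ τ => σ = (k + 1) :: τ) (pop fun _ e => e 0 + 1)
  refine (h1.seq ((Programmable.loop none (R := fun w e _ => _) h2).seq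
    ((pop fun _ _ => 0).seq h3))).congr fun w e σ τ => ?_
  change _ ↔ σ = τ ∧ ∀ v, ¬ Relation.TransGen (E w) v v
  rw [← walkCount_eq_zero_iff (hEV w) (hVN w)]
  have hlt := walkCount_lt (hN w) (hV0 w) (hE0 w)
  -- All guesses are forced: after `n` passes the stack holds exactly the true count and the length
  -- `n`.
  have key : ∀ n ≤ N w, ∀ τ, compDown (fun _ σ τ => ∃ k < N w, ∃ c < N w, ∃ c' < N w,
      ∃ ρ, σ = c :: ρ ∧ ∃ ρ', ρ = k :: ρ' ∧ ∃ ρ'', (ρ' = ρ'' ∧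
        CountStep (N w) (V w) (E w) k c c') ∧ ∃ ρ₃, ρ₃ = (k + 1) :: ρ'' ∧ τ = c' :: ρ₃) n
        (walkCount (N w) (V w) (E w) 0 :: 0 :: σ) τ ↔
        τ = walkCount (N w) (V w) (E w) n :: n :: σ := by
    intro n hn
    induction n with
    | zero => exact fun τ => eq_comm
    | succ n ih =>
      intro τ
      rw [compDown_const_succ]
      constructor
      · rintro ⟨_, h, k, hk, c, hc, c', hc', _, rfl, _, rfl, _, ⟨rfl, h5⟩, _, rfl, rfl⟩
        have h6 := (ih (by omega) _).1 h
        simp only [List.cons.injEq] at h6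
        obtain ⟨rfl, rfl, rfl⟩ := h6
        rw [countStep_iff.1 h5]
      · rintro rfl
        exact ⟨_, (ih (by omega) _).2 rfl, n, hn, _, hlt n, _, hlt (n + 1), _, rfl, _, rfl, _,
          ⟨rfl, countStep_iff.2 rfl⟩, _, rfl, rfl⟩
  constructor
  · rintro ⟨_, ⟨c, hc, _, ⟨rfl, rfl⟩, _, rfl, rfl⟩, _, h, _, rfl, k, hk, rfl⟩
    have h6 := (key (N w) le_rfl _).1 h
    simp only [List.cons.injEq] at h6
    exact ⟨h6.2.2.symm, h6.1.symm⟩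
  · rintro ⟨rfl, h⟩
    obtain ⟨k, hk⟩ : ∃ k, N w = k + 1 := ⟨N w - 1, by have := hN w; omega⟩
    refine ⟨_, ⟨_, hlt 0, _, ⟨rfl, rfl⟩, _, rfl, rfl⟩, _, (key (N w) le_rfl _).2 rfl, N w :: σ,
      by rw [h], k, by omega, by rw [hk]⟩

end Programs

/-! ### Finite automata and names -/

section FiniteAutomata

open Programmable

variable {α : Type u} {N : List α → ℕ} {Q : Type}

/-- The state of a finite automaton after reading the positions `0, …, i - 1` of the input tape. -/
def runTo (δ : Q → InputSym α → Q) (q₀ : Q) (w : List α) : ℕ → Q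
  | 0 => q₀
  | i + 1 => δ (runTo δ q₀ w i) (inputAt w i)

/-- Loops count down, so the run is guessed backwards: from the final state `q` each pass guesses a
predecessor consistent with the symbol read, and the last state must be `q₀`. -/
theorem Tst.runTo_eq [Finite Q] (δ : Q → InputSym α → Q) (q₀ q : Q) (i : ℕ) :
    Tst N fun w e => runTo δ q₀ w (e i) = q := by
  obtain ⟨m, ⟨f⟩⟩ := Finite.exists_equiv_fin Q
  have hf : ∀ {a b : Q}, (f a : ℕ) = f b → a = b := fun h => f.injective (Fin.ext h)
  have h1 : Programmable N fun w e σ τ => ∃ p : Q × Q, ∃ ρ, σ = (f p.1 : ℕ) :: ρ ∧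
      ∃ ρ', (ρ = ρ' ∧ δ p.2 (inputAt w (e 0)) = p.1) ∧ τ = (f p.2 : ℕ) :: ρ' :=
    Programmable.exFinite fun p => (pop fun _ _ => (f p.1 : ℕ)).seq
      (Programmable.seq (Dec.sym (fun _ e => e 0) fun x => δ p.2 x = p.1).1
        (push fun _ _ => (f p.2 : ℕ)))
  refine ((push fun _ _ => (f q : ℕ)).seq ((Programmable.loop (some i) (R := fun w _ x σ τ =>
    ∃ p : Q × Q, ∃ ρ, σ = (f p.1 : ℕ) :: ρ ∧ ∃ ρ', (ρ = ρ' ∧ δ p.2 (inputAt w x) = p.1) ∧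
      τ = (f p.2 : ℕ) :: ρ') h1).seq (pop fun _ _ => (f q₀ : ℕ)))).congr fun w e σ τ => ?_
  have key : ∀ n q, compDown (fun x σ τ =>
      ∃ p : Q × Q, ∃ ρ, σ = (f p.1 : ℕ) :: ρ ∧ ∃ ρ', (ρ = ρ' ∧ δ p.2 (inputAt w x) = p.1) ∧
      τ = (f p.2 : ℕ) :: ρ') n ((f q : ℕ) :: σ) ((f q₀ : ℕ) :: τ) ↔
      σ = τ ∧ runTo δ q₀ w n = q := by
    intro n
    induction n with
    | zero =>
      intro q
      simp only [compDown, List.cons.injEq, runTo]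
      constructor
      · rintro ⟨h, rfl⟩
        exact ⟨rfl, (hf h).symm⟩
      · rintro ⟨rfl, rfl⟩
        exact ⟨rfl, rfl⟩
    | succ n ih =>
      intro q
      rw [compDown]
      constructor
      · rintro ⟨_, ⟨p, _, h1, _, ⟨rfl, h2⟩, rfl⟩, h⟩
        obtain ⟨h3, rfl⟩ := List.cons.inj h1
        obtain ⟨rfl, h4⟩ := (ih _).1 h
        exact ⟨rfl, by rw [hf h3, ← h2, ← h4]; rfl⟩
      · rintro ⟨rfl, rfl⟩
        exact ⟨_, ⟨(_, runTo δ q₀ w n), σ, rfl, σ, ⟨rfl, rfl⟩, rfl⟩, (ih _).2 ⟨rfl, rfl⟩⟩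
  constructor
  · rintro ⟨_, rfl, _, h, rfl⟩
    exact (key _ _).1 h
  · intro h
    exact ⟨_, rfl, _, (key _ _).2 h, rfl⟩

/-- A deterministic automaton is not in `q` precisely when it is in one of the finitely many other
states. -/
theorem Dec.runTo_eq [Finite Q] (δ : Q → InputSym α → Q) (q₀ q : Q) (i : ℕ) :
    Dec N fun w e => runTo δ q₀ w (e i) = q := by
  refine ⟨Tst.runTo_eq δ q₀ q i, (Tst.exFinite (ι := Q) (φ := fun q' w e =>
    runTo δ q₀ w (e i) = q' ∧ q' ≠ q) fun q' => (Tst.runTo_eq δ q₀ q' i).and ?_).congr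
      fun w e => by simp⟩
  by_cases h : q' = q
  · exact Tst.false.congr (by simp [h])
  · exact Tst.true.congr (by simp [h])

end FiniteAutomata

/-- The suffix `v` of `s` starts at position `i` of the input tape. -/
def SuffixAt {α : Type u} (s : List α) (i : ℕ) (v : List α) : Prop :=
  ∃ u, s = u ++ v ∧ i = u.length + 1

namespace SuffixAt

variable {α : Type u} {s v : List α} {i : ℕ}

theorem append {x : List α} (h : SuffixAt s i (x ++ v)) : SuffixAt s (i + x.length) v := by
  obtain ⟨u, rfl, rfl⟩ := h
  exact ⟨u ++ x, by simp, by simp; omega⟩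

theorem cons {c : α} (h : SuffixAt s i (c :: v)) : SuffixAt s (i + 1) v := append (x := [c]) h

theorem inputAt_eq {c : α} (h : SuffixAt s i (c :: v)) : inputAt s i = InputSym.letter c := by
  obtain ⟨u, rfl, rfl⟩ := h
  simp [inputAt]

theorem inputAt_nil (h : SuffixAt s i []) : inputAt s i = InputSym.rightEnd := by
  obtain ⟨u, rfl, rfl⟩ := h
  simp [inputAt]

theorem inputAt_add {x : List α} {o : ℕ} (h : SuffixAt s i (x ++ v)) (ho : o < x.length) :
    inputAt s (i + o) = InputSym.letter x[o] := by
  obtain ⟨u, rfl, rfl⟩ := h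
  rw [show u.length + 1 + o = (u.length + o) + 1 by omega]
  simp [inputAt, List.getElem?_append_right, List.getElem?_append_left, ho]

theorem le (h : SuffixAt s i v) : i + v.length = s.length + 1 := by
  obtain ⟨u, rfl, rfl⟩ := h
  simp
  omega

/-- The length of a maximal block of letters with the property `P`. -/
theorem span {P : InputSym α → Prop} {x : List α} {c : α} (h : SuffixAt s i (x ++ c :: v))
    (hx : ∀ a ∈ x, P (InputSym.letter a)) (hc : ¬ P (InputSym.letter c)) {n : ℕ} :
    ((∀ o < n, P (inputAt s (i + o))) ∧ ¬ P (inputAt s (i + n))) ↔ n = x.length := by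
  have hend : inputAt s (i + x.length) = InputSym.letter c := h.append.inputAt_eq
  constructor
  · rintro ⟨h1, h2⟩
    rcases lt_trichotomy n x.length with hn | hn | hn
    · rw [h.inputAt_add hn] at h2
      exact absurd (hx _ (List.getElem_mem hn)) h2
    · exact hn
    · have := h1 _ hn
      rw [hend] at this
      exact absurd this hc
  · rintro rfl
    refine ⟨fun o ho => ?_, by rwa [hend]⟩
    rw [h.inputAt_add ho]
    exact hx _ (List.getElem_mem ho)

end SuffixAt

/-! ### Comparing the names of states. -/

section Names

variable {A : Type u}

/-- A bit string as a word. -/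
def bits (p : List Bool) : List (NFASym A) := p.map NFASym.bit

/-- The symbol is a bit. -/
def IsBit (x : InputSym (NFASym A)) : Prop := ∃ b, x = InputSym.letter (NFASym.bit b)

/-- The symbol is a letter of the alphabet of the automaton. -/
def IsLetter (x : InputSym (NFASym A)) : Prop := ∃ a, x = InputSym.letter (NFASym.letter a)

/-- The symbol is a comma. -/
def IsComma (x : InputSym (NFASym A)) : Prop := x = InputSym.letter NFASym.comma

/-- The symbol is a bar. -/
def IsBar (x : InputSym (NFASym A)) : Prop := x = InputSym.letter NFASym.bar

/-- The symbols are equal bits. -/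
def SameBit (x y : InputSym (NFASym A)) : Prop :=
  (x = InputSym.letter (NFASym.bit true) ∧ y = InputSym.letter (NFASym.bit true)) ∨
    (x = InputSym.letter (NFASym.bit false) ∧ y = InputSym.letter (NFASym.bit false))

/-- The bit string that starts at position `i` is `p`, and it is followed by a comma or a bar. -/
def HasName (s : List (NFASym A)) (i : ℕ) (p : List Bool) : Prop :=
  ∃ c v, SuffixAt s i (bits p ++ c :: v) ∧ (c = NFASym.comma ∨ c = NFASym.bar)

/-- The bit strings that start at the positions `i` and `j` are equal. -/
def SameName (N : ℕ) (s : List (NFASym A)) (i j : ℕ) : Prop :=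
  ∃ n < N, (∀ o < n, SameBit (inputAt s (i + o)) (inputAt s (j + o))) ∧
    ¬ IsBit (inputAt s (i + n)) ∧ ¬ IsBit (inputAt s (j + n))

theorem sameBit_bit {a b : Bool} : SameBit (A := A) (InputSym.letter (NFASym.bit a))
    (InputSym.letter (NFASym.bit b)) ↔ a = b := by
  cases a <;> cases b <;> simp [SameBit]

theorem SameBit.isBit {x y : InputSym (NFASym A)} (h : SameBit x y) : IsBit x ∧ IsBit y := by
  rcases h with ⟨rfl, rfl⟩ | ⟨rfl, rfl⟩
  · exact ⟨⟨true, rfl⟩, true, rfl⟩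
  · exact ⟨⟨false, rfl⟩, false, rfl⟩

theorem isBit_of_mem_bits {p : List Bool} : ∀ a ∈ (bits p : List (NFASym A)),
    IsBit (InputSym.letter a) := by
  intro a ha
  obtain ⟨b, -, rfl⟩ := List.mem_map.1 ha
  exact ⟨b, rfl⟩

theorem not_isBit {c : NFASym A} (h : c = NFASym.comma ∨ c = NFASym.bar) :
    ¬ IsBit (InputSym.letter c) := by
  rintro ⟨b, hb⟩
  rcases h with rfl | rfl <;> simp at hb

theorem length_bits (p : List Bool) : (bits p : List (NFASym A)).length = p.length := by
  simp [bits]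

/-- A name is followed by a symbol that is not a bit, so it is a maximal block of bits. The common
length `n` must then be the length of both names. -/
theorem sameName_iff {N : ℕ} {s : List (NFASym A)} {i j : ℕ} {p q : List Bool}
    (hN : s.length < N) (hi : HasName s i p) (hj : HasName s j q) :
    SameName N s i j ↔ p = q := by
  obtain ⟨c, v, hi, hc⟩ := hi
  obtain ⟨d, v', hj, hd⟩ := hj
  constructor
  · rintro ⟨n, -, h1, h2, h3⟩
    have h4 := (hi.span isBit_of_mem_bits (not_isBit hc)).1 ⟨fun o ho => (h1 o ho).isBit.1, h2⟩
    have h5 := (hj.span isBit_of_mem_bits (not_isBit hd)).1 ⟨fun o ho => (h1 o ho).isBit.2, h3⟩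
    rw [length_bits] at h4 h5
    refine List.ext_getElem (h4.symm.trans h5) fun o ho ho' => ?_
    have h6 := h1 o (by omega)
    rw [hi.inputAt_add (by simpa [bits] using ho), hj.inputAt_add (by simpa [bits] using ho')] at h6
    simpa [bits, sameBit_bit] using h6
  · rintro rfl
    have h4 := (hi.span (n := p.length) isBit_of_mem_bits (not_isBit hc)).2 (length_bits p).symm
    have h5 := (hj.span (n := p.length) isBit_of_mem_bits (not_isBit hd)).2 (length_bits p).symm
    refine ⟨p.length, ?_, fun o ho => ?_, h4.2, h5.2⟩
    · have h6 := hi.le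
      obtain ⟨u, -, rfl⟩ := hi
      simp [bits] at h6
      omega
    · rw [hi.inputAt_add (by simpa [bits] using ho), hj.inputAt_add (by simpa [bits] using ho)]
      simp [bits, sameBit_bit]

theorem Dec.sameName {N : List (NFASym A) → ℕ} (t u : List (NFASym A) → (ℕ → ℕ) → ℕ)
    [Lin t] [Lin u] : Dec N fun w e => SameName (N w) w (t w e) (u w e) := by
  refine Dec.ex (φ := fun w e n =>
    (∀ o < n, SameBit (inputAt w (t w e + o)) (inputAt w (u w e + o))) ∧
    ¬ IsBit (inputAt w (t w e + n)) ∧ ¬ IsBit (inputAt w (u w e + n))) ?_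
  refine Dec.and (Dec.allVar (φ := fun w e o =>
    SameBit (inputAt w ((t w fun i => e (i + 1)) + o)) (inputAt w ((u w fun i => e (i + 1)) + o)))
    0 ?_) (Dec.and ?_ ?_)
  · refine Dec.or (Dec.and ?_ ?_) (Dec.and ?_ ?_)
    · exact Dec.sym (fun w e => (t w fun i => e (i + 1 + 1)) + e 0)
        fun x => x = InputSym.letter (NFASym.bit true)
    · exact Dec.sym (fun w e => (u w fun i => e (i + 1 + 1)) + e 0)
        fun x => x = InputSym.letter (NFASym.bit true)
    · exact Dec.sym (fun w e => (t w fun i => e (i + 1 + 1)) + e 0)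
        fun x => x = InputSym.letter (NFASym.bit false)
    · exact Dec.sym (fun w e => (u w fun i => e (i + 1 + 1)) + e 0)
        fun x => x = InputSym.letter (NFASym.bit false)
  · exact (Dec.sym (fun w e => (t w fun i => e (i + 1)) + e 0) IsBit).not
  · exact (Dec.sym (fun w e => (u w fun i => e (i + 1)) + e 0) IsBit).not

end Names

/-! ### The format of encodings -/

section Format

variable {A : Type u}

/-- A list of names, each followed by a comma. -/
def codeNames (l : List (List Bool)) : List (NFASym A) :=
  l.flatMap fun q => bits q ++ [NFASym.comma]

/-- The code of a transition between named states. -/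
def codeTransition (t : List Bool × List A × List Bool) : List (NFASym A) :=
  bits t.1 ++ NFASym.comma :: (t.2.1.map NFASym.letter ++ NFASym.comma ::
    (bits t.2.2 ++ [NFASym.comma]))

/-- The part of a code in front of the transitions. -/
def codeHeader (states : List (List Bool)) (start : List Bool) (final : List (List Bool)) :
    List (NFASym A) :=
  codeNames states ++ NFASym.bar :: (bits start ++ NFASym.bar :: (codeNames final ++ [NFASym.bar]))

/-- The code of an automaton whose states are their own names. -/
def codeOf (states : List (List Bool)) (start : List Bool) (final : List (List Bool))
    (trans : List (List Bool × List A × List Bool)) : List (NFASym A) :=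
  codeHeader states start final ++ trans.flatMap codeTransition

theorem codeNFA_eq {Q : Type} (name : Q → List Bool) (states : List Q) (start : Q)
    (final : List Q) (trans : List (Q × List A × Q)) :
    codeNFA name states start final trans = codeOf (states.map name) (name start)
      (final.map name) (trans.map fun t => (name t.1, t.2.1, name t.2.2)) := by
  simp [codeNFA, codeOf, codeHeader, codeNames, codeTransition, List.flatMap_map, codeState, bits]

/-- The roles of positions in a code. -/
inductive Role : Type
  | states (fresh : Bool)
  | start (fresh : Bool)
  | final (fresh : Bool)
  | source (fresh : Bool)
  | word
  | target
  | bad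

instance : Finite Role :=
  Finite.of_injective (β := Bool × (Bool × Bool × Bool))
    (fun r => match r with
      | Role.states b => (b, false, false, false)
      | Role.start b => (b, false, false, true)
      | Role.final b => (b, false, true, false)
      | Role.source b => (b, false, true, true)
      | Role.word => (false, true, false, false)
      | Role.target => (false, true, false, true)
      | Role.bad => (false, true, true, false))
    (by intro r s h; cases r <;> cases s <;> simp_all)

/-- The automaton that checks the format of a code. -/
def Role.step : Role → NFASym A → Role
  | Role.states _, NFASym.bit _ => Role.states false
  | Role.states _, NFASym.comma => Role.states true
  | Role.states true, NFASym.bar => Role.start true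
  | Role.start _, NFASym.bit _ => Role.start false
  | Role.start _, NFASym.bar => Role.final true
  | Role.final _, NFASym.bit _ => Role.final false
  | Role.final _, NFASym.comma => Role.final true
  | Role.final true, NFASym.bar => Role.source true
  | Role.source _, NFASym.bit _ => Role.source false
  | Role.source _, NFASym.comma => Role.word
  | Role.word, NFASym.letter _ => Role.word
  | Role.word, NFASym.comma => Role.target
  | Role.target, NFASym.bit _ => Role.target
  | Role.target, NFASym.comma => Role.source true
  | _, _ => Role.bad

/-- The step of the automaton on the symbols of the input tape. -/
def Role.stepSym (r : Role) : InputSym (NFASym A) → Role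
  | InputSym.letter c => r.step c
  | _ => r

/-- The role of a position of the input tape. -/
def roleAt (s : List (NFASym A)) (i : ℕ) : Role :=
  runTo Role.stepSym (Role.states true) s i

/-- The role at a position depends on the letters strictly before it; the left end marker at
position 0 leaves the automaton where it is. -/
theorem roleAt_of_suffixAt {s v : List (NFASym A)} {i : ℕ} (u : List (NFASym A))
    (h : s = u ++ v) (hi : i = u.length + 1) :
    roleAt s i = u.foldl Role.step (Role.states true) := by
  subst hi
  induction u using List.reverseRecOn generalizing v with
  | nil => rfl
  | append_singleton u c ih =>
    have h1 := ih (v := c :: v) (by simpa using h)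
    have h2 : SuffixAt s (u.length + 1) (c :: v) := ⟨u, by simpa using h, rfl⟩
    rw [List.foldl_append, List.length_append, List.length_singleton]
    change Role.stepSym (roleAt s (u.length + 1)) (inputAt s (u.length + 1)) = _
    rw [h1, h2.inputAt_eq]
    rfl

/-- The prefixes of codes that lead to a role. -/
def Role.Prefix : Role → List (NFASym A) → Prop
  | states true, u => ∃ l, u = codeNames l
  | states false, u => ∃ l p, u = codeNames l ++ bits p
  | start true, u => ∃ l, u = codeNames l ++ [NFASym.bar]
  | start false, u => ∃ l p, u = codeNames l ++ NFASym.bar :: bits p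
  | final true, u => ∃ l p f, u = codeNames l ++ NFASym.bar :: (bits p ++ NFASym.bar ::
      codeNames f)
  | final false, u => ∃ l p f q, u = codeNames l ++ NFASym.bar :: (bits p ++ NFASym.bar ::
      (codeNames f ++ bits q))
  | source true, u => ∃ l p f t, u = codeOf l p f t
  | source false, u => ∃ l p f t q, u = codeOf l p f t ++ bits q
  | word, u => ∃ l p f t q, ∃ x : List A, u = codeOf l p f t ++ (bits q ++ NFASym.comma ::
      x.map NFASym.letter)
  | target, u => ∃ l p f t q, ∃ x : List A, ∃ r, u = codeOf l p f t ++ (bits q ++ NFASym.comma ::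
      (x.map NFASym.letter ++ NFASym.comma :: bits r))
  | bad, _ => True

theorem codeNames_append (l l' : List (List Bool)) :
    (codeNames (l ++ l') : List (NFASym A)) = codeNames l ++ codeNames l' := by
  simp [codeNames]

theorem codeNames_singleton (p : List Bool) :
    (codeNames [p] : List (NFASym A)) = bits p ++ [NFASym.comma] := by
  simp [codeNames]

/-- `Role.Prefix` is the invariant of the format automaton. A position where a name is about to
begin is treated as one with an empty name read so far; freshness matters only where a bar must not
interrupt a name. -/
theorem Role.Prefix.step {r : Role} {u : List (NFASym A)} (h : r.Prefix u) (c : NFASym A) :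
    (r.step c).Prefix (u ++ [c]) := by
  cases r with
  | states fresh =>
    have h' : ∃ l p, u = codeNames l ++ bits p := by
      cases fresh with
      | true => obtain ⟨l, rfl⟩ := h; exact ⟨l, [], by simp [bits]⟩
      | false => exact h
    obtain ⟨l, p, rfl⟩ := h'
    cases c with
    | bit b => cases fresh <;> exact ⟨l, p ++ [b], by simp [bits]⟩
    | letter a => cases fresh <;> trivial
    | comma => cases fresh <;> exact ⟨l ++ [p], by simp [codeNames]⟩
    | bar =>
      cases fresh with
      | false => trivial
      | true =>
        obtain ⟨l', h⟩ := h
        exact ⟨l', by rw [h]⟩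
  | start fresh =>
    have h' : ∃ l p, u = codeNames l ++ NFASym.bar :: bits p := by
      cases fresh with
      | true => obtain ⟨l, rfl⟩ := h; exact ⟨l, [], by simp [bits]⟩
      | false => exact h
    obtain ⟨l, p, rfl⟩ := h'
    cases c with
    | bit b => cases fresh <;> exact ⟨l, p ++ [b], by simp [bits]⟩
    | letter a => cases fresh <;> trivial
    | comma => cases fresh <;> trivial
    | bar => cases fresh <;> exact ⟨l, p, [], by simp [codeNames]⟩
  | final fresh =>
    have h' : ∃ l p f q, u = codeNames l ++ NFASym.bar :: (bits p ++ NFASym.bar ::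
        (codeNames f ++ bits q)) := by
      cases fresh with
      | true => obtain ⟨l, p, f, rfl⟩ := h; exact ⟨l, p, f, [], by simp [bits]⟩
      | false => exact h
    obtain ⟨l, p, f, q, rfl⟩ := h'
    cases c with
    | bit b => cases fresh <;> exact ⟨l, p, f, q ++ [b], by simp [bits]⟩
    | letter a => cases fresh <;> trivial
    | comma => cases fresh <;> exact ⟨l, p, f ++ [q], by simp [codeNames]⟩
    | bar =>
      cases fresh with
      | false => trivial
      | true =>
        obtain ⟨l', p', f', h⟩ := h
        exact ⟨l', p', f', [], by rw [h]; simp [codeOf, codeHeader]⟩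
  | source fresh =>
    have h' : ∃ l p f t q, u = codeOf l p f t ++ bits q := by
      cases fresh with
      | true => obtain ⟨l, p, f, t, rfl⟩ := h; exact ⟨l, p, f, t, [], by simp [bits]⟩
      | false => exact h
    obtain ⟨l, p, f, t, q, rfl⟩ := h'
    cases c with
    | bit b => cases fresh <;> exact ⟨l, p, f, t, q ++ [b], by simp [bits]⟩
    | letter a => cases fresh <;> trivial
    | comma => cases fresh <;> exact ⟨l, p, f, t, q, [], by simp⟩
    | bar => cases fresh <;> trivial
  | word =>
    obtain ⟨l, p, f, t, q, x, rfl⟩ := h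
    cases c with
    | bit b => trivial
    | letter a => exact ⟨l, p, f, t, q, x ++ [a], by simp⟩
    | comma => exact ⟨l, p, f, t, q, x, [], by simp [bits]⟩
    | bar => trivial
  | target =>
    obtain ⟨l, p, f, t, q, x, r, rfl⟩ := h
    cases c with
    | bit b => exact ⟨l, p, f, t, q, x, r ++ [b], by simp [bits]⟩
    | letter a => trivial
    | comma => exact ⟨l, p, f, t ++ [(q, x, r)], by simp [codeOf, codeTransition]⟩
    | bar => trivial
  | bad => cases c <;> trivial

theorem prefix_foldl (u : List (NFASym A)) :
    (u.foldl Role.step (Role.states true)).Prefix u := by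
  induction u using List.reverseRecOn with
  | nil => exact ⟨[], rfl⟩
  | append_singleton u c ih =>
    rw [List.foldl_append]
    exact ih.step c

/-- Stated for an arbitrary family of roles indexed by freshness, so that one proof serves all
sections of a code. Freshness survives only the empty name. -/
theorem foldl_bits (p : List Bool) (r : Bool → Role)
    (hr : ∀ b c, (r b).step (A := A) (NFASym.bit c) = r false)
    (b : Bool) : (bits p : List (NFASym A)).foldl Role.step (r b) = r (b && p.isEmpty) := by
  induction p generalizing b with
  | nil => simp [bits]
  | cons c p ih =>
    have : (bits (c :: p) : List (NFASym A)) = NFASym.bit c :: bits p := rfl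
    rw [this, List.foldl_cons, hr, ih]
    simp

theorem foldl_codeNames (l : List (List Bool)) (r : Bool → Role)
    (hr : ∀ b c, (r b).step (A := A) (NFASym.bit c) = r false)
    (hr' : ∀ b, (r b).step (A := A) NFASym.comma = r true) :
    (codeNames l : List (NFASym A)).foldl Role.step (r true) = r true := by
  induction l with
  | nil => rfl
  | cons p l ih =>
    rw [show p :: l = [p] ++ l from rfl, codeNames_append, codeNames_singleton, List.foldl_append,
      List.foldl_append, foldl_bits p r hr, List.foldl_cons, hr', List.foldl_nil, ih]

theorem foldl_codeHeader (l : List (List Bool)) (p : List Bool) (f : List (List Bool)) :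
    (codeHeader l p f : List (NFASym A)).foldl Role.step (Role.states true) = Role.source true := by
  rw [codeHeader, List.foldl_append, foldl_codeNames l Role.states (fun b c => by cases b <;> rfl)
    (fun b => by cases b <;> rfl), List.foldl_cons, List.foldl_append]
  change List.foldl _ (List.foldl _ (Role.start true) _) _ = _
  rw [foldl_bits p Role.start (fun b c => by cases b <;> rfl), List.foldl_cons]
  have h : ∀ b, (Role.start b).step (A := A) NFASym.bar = Role.final true := fun b => by
    cases b <;> rfl
  rw [h, List.foldl_append, foldl_codeNames f Role.final (fun b c => by cases b <;> rfl)
    (fun b => by cases b <;> rfl)]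
  rfl

theorem foldl_letters (x : List A) :
    (x.map NFASym.letter).foldl Role.step Role.word = Role.word := by
  induction x with
  | nil => rfl
  | cons a x ih => exact ih

theorem foldl_codeTransition (t : List Bool × List A × List Bool) :
    (codeTransition t).foldl Role.step (Role.source true) = Role.source true := by
  have h : ∀ b, (Role.source b).step (A := A) NFASym.comma = Role.word := fun b => by
    cases b <;> rfl
  rw [codeTransition, List.foldl_append, foldl_bits _ Role.source (fun b c => by cases b <;> rfl),
    List.foldl_cons, h, List.foldl_append, foldl_letters, List.foldl_cons, List.foldl_append]
  change List.foldl _ (List.foldl _ Role.target _) _ = _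
  rw [foldl_bits _ (fun _ => Role.target) (fun b c => rfl) true]
  rfl

theorem foldl_transitions (l : List (List Bool × List A × List Bool)) :
    (l.flatMap codeTransition).foldl Role.step (Role.source true) = Role.source true := by
  induction l with
  | nil => rfl
  | cons t l ih => rw [List.flatMap_cons, List.foldl_append, foldl_codeTransition, ih]

theorem foldl_codeOf (l : List (List Bool)) (p : List Bool) (f : List (List Bool))
    (t : List (List Bool × List A × List Bool)) :
    (codeOf l p f t).foldl Role.step (Role.states true) = Role.source true := by
  rw [codeOf, List.foldl_append, foldl_codeHeader, foldl_transitions]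

theorem foldl_eq_source_iff (s : List (NFASym A)) :
    s.foldl Role.step (Role.states true) = Role.source true ↔
      ∃ l p f t, s = codeOf l p f t := by
  constructor
  · intro h
    have := prefix_foldl s
    rwa [h] at this
  · rintro ⟨l, p, f, t, rfl⟩
    exact foldl_codeOf l p f t

/-! Unique decoding -/

/-- The first symbol that is not a bit marks the end of the name. -/
theorem bits_cons_inj {p p' : List Bool} {c c' : NFASym A} {u u' : List (NFASym A)}
    (hc : ∀ b, c ≠ NFASym.bit b) (hc' : ∀ b, c' ≠ NFASym.bit b)
    (h : bits p ++ c :: u = bits p' ++ c' :: u') : p = p' ∧ c = c' ∧ u = u' := by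
  induction p generalizing p' with
  | nil =>
    cases p' with
    | nil => simpa [bits] using h
    | cons b p' =>
      simp [bits] at h
      exact absurd h.1 (hc b)
  | cons b p ih =>
    cases p' with
    | nil =>
      simp [bits] at h
      exact absurd h.1.symm (hc' b)
    | cons b' p' =>
      simp only [bits, List.map_cons, List.cons_append, List.cons.injEq, NFASym.bit.injEq] at h
      obtain ⟨rfl, h1, h2⟩ := ih h.2
      exact ⟨by rw [h.1], h1, h2⟩

theorem letters_cons_inj {x x' : List A} {c c' : NFASym A} {u u' : List (NFASym A)}
    (hc : ∀ a, c ≠ NFASym.letter a) (hc' : ∀ a, c' ≠ NFASym.letter a)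
    (h : x.map NFASym.letter ++ c :: u = x'.map NFASym.letter ++ c' :: u') :
    x = x' ∧ c = c' ∧ u = u' := by
  induction x generalizing x' with
  | nil =>
    cases x' with
    | nil => simpa using h
    | cons b x' =>
      simp at h
      exact absurd h.1 (hc b)
  | cons b x ih =>
    cases x' with
    | nil =>
      simp at h
      exact absurd h.1.symm (hc' b)
    | cons b' x' =>
      simp only [List.map_cons, List.cons_append, List.cons.injEq, NFASym.letter.injEq] at h
      obtain ⟨rfl, h1, h2⟩ := ih h.2
      exact ⟨by rw [h.1], h1, h2⟩

/-- Names contain no bar, so a list of names at the front of the text cannot extend past the first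
bar and is an initial segment of the listed names. -/
theorem codeNames_prefix {l st : List (List Bool)} {v rest : List (NFASym A)}
    (h : codeNames l ++ v = codeNames st ++ NFASym.bar :: rest) :
    ∃ l', st = l ++ l' ∧ v = codeNames l' ++ NFASym.bar :: rest := by
  induction l generalizing st with
  | nil => exact ⟨st, rfl, h⟩
  | cons p l ih =>
    cases st with
    | nil =>
      simp only [codeNames, List.flatMap_cons, List.flatMap_nil, List.nil_append,
        List.append_assoc, List.singleton_append] at h
      have := (bits_cons_inj (p' := []) (by simp) (by simp) h).2.1
      simp at this
    | cons q st =>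
      simp only [codeNames, List.flatMap_cons, List.append_assoc, List.singleton_append] at h
      obtain ⟨rfl, -, h⟩ := bits_cons_inj (by simp) (by simp) h
      obtain ⟨l', rfl, h'⟩ := ih h
      exact ⟨l', rfl, h'⟩

theorem codeNames_inj {l st : List (List Bool)} {v rest : List (NFASym A)}
    (h : codeNames l ++ NFASym.bar :: v = codeNames st ++ NFASym.bar :: rest) :
    l = st ∧ v = rest := by
  obtain ⟨l', rfl, h'⟩ := codeNames_prefix h
  cases l' with
  | nil =>
    simp [codeNames] at h'
    simp [h']
  | cons p l' =>
    simp only [codeNames, List.flatMap_cons, List.append_assoc, List.singleton_append] at h'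
    have := (bits_cons_inj (p := []) (by simp) (by simp) h').2.1
    simp at this

theorem transitions_prefix {l tr : List (List Bool × List A × List Bool)} {v : List (NFASym A)}
    (h : l.flatMap codeTransition ++ v = tr.flatMap codeTransition) :
    ∃ l', tr = l ++ l' ∧ v = l'.flatMap codeTransition := by
  induction l generalizing tr with
  | nil => exact ⟨tr, rfl, h⟩
  | cons t l ih =>
    cases tr with
    | nil => simp [codeTransition] at h
    | cons t' tr =>
      obtain ⟨p, x, q⟩ := t
      obtain ⟨p', x', q'⟩ := t'
      simp only [List.flatMap_cons, codeTransition, List.append_assoc, List.cons_append,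
        List.nil_append] at h
      obtain ⟨rfl, -, h⟩ := bits_cons_inj (by simp) (by simp) h
      obtain ⟨rfl, -, h⟩ := letters_cons_inj (by simp) (by simp) h
      obtain ⟨rfl, -, h⟩ := bits_cons_inj (by simp) (by simp) h
      obtain ⟨l', rfl, h'⟩ := ih h
      exact ⟨l', rfl, h'⟩

theorem codeHeader_inj {l l' : List (List Bool)} {p p' : List Bool} {f f' : List (List Bool)}
    {v v' : List (NFASym A)} (h : codeHeader l p f ++ v = codeHeader l' p' f' ++ v') :
    l = l' ∧ p = p' ∧ f = f' ∧ v = v' := by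
  simp only [codeHeader, List.append_assoc, List.cons_append, List.nil_append] at h
  obtain ⟨rfl, h1⟩ := codeNames_inj h
  obtain ⟨rfl, -, h2⟩ := bits_cons_inj (by simp) (by simp) h1
  obtain ⟨rfl, rfl⟩ := codeNames_inj h2
  exact ⟨rfl, rfl, rfl, rfl⟩

end Format

/-! ### Positions of names and transitions in a code -/

section Positions

variable {A : Type u} {s : List (NFASym A)}

theorem SuffixAt.inj {α : Type u} {s v v' : List α} {i : ℕ} (h : SuffixAt s i v)
    (h' : SuffixAt s i v') : v = v' := by
  obtain ⟨u, rfl, rfl⟩ := h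
  obtain ⟨u', h1, h2⟩ := h'
  exact (List.append_inj h1 (by omega)).2

theorem exists_suffixAt {α : Type u} {s : List α} {i : ℕ} {c : α}
    (h : inputAt s i = InputSym.letter c) : ∃ u v, s = u ++ c :: v ∧ i = u.length + 1 := by
  cases i with
  | zero => simp [inputAt] at h
  | succ i =>
    have h1 : s[i]? = some c := by
      simp only [inputAt] at h
      split at h
      · cases h; assumption
      · cases h
    obtain ⟨h2, h3⟩ := List.getElem?_eq_some_iff.1 h1
    refine ⟨s.take i, s.drop (i + 1), ?_, by simp; omega⟩
    rw [← h3, ← List.drop_eq_getElem_cons, List.take_append_drop]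

theorem le_length_of_inputAt {α : Type u} {s : List α} {i : ℕ} {c : α}
    (h : inputAt s i = InputSym.letter c) : i ≤ s.length := by
  obtain ⟨u, v, rfl, rfl⟩ := exists_suffixAt h
  simp

theorem inputAt_eq_rightEnd_iff {α : Type u} {s : List α} {i : ℕ} :
    inputAt s i = InputSym.rightEnd ↔ s.length < i := by
  cases i with
  | zero => simp [inputAt]
  | succ i =>
    simp only [inputAt]
    split
    · next h =>
      have := (List.getElem?_eq_some_iff.1 h).1
      simp; omega
    · next h =>
      have := List.getElem?_eq_none_iff.1 h
      simp; omega

/-- The right end marker does not change the role, so the verdict of the automaton on the whole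
string can be read off at any position beyond it. -/
theorem roleAt_of_length_lt {i : ℕ} (h : s.length < i) :
    roleAt s i = s.foldl Role.step (Role.states true) := by
  obtain ⟨k, rfl⟩ := Nat.exists_eq_add_of_lt h
  induction k with
  | zero => exact roleAt_of_suffixAt s (v := []) (by simp) rfl
  | succ k ih =>
    have h1 := inputAt_eq_rightEnd_iff.2 (show s.length < s.length + k + 1 by omega)
    rw [← ih (by omega)]
    change Role.stepSym (roleAt s (s.length + k + 1)) (inputAt s (s.length + k + 1)) = _
    rw [h1]
    rfl

/-- A name starts at the position `i`, which has the role `r`. -/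
def NameAt (r : Role) (s : List (NFASym A)) (i : ℕ) : Prop :=
  roleAt s i = r ∧ (IsBit (inputAt s i) ∨ IsComma (inputAt s i))

/-- The string is the code of some automaton. -/
def WellFormed (s : List (NFASym A)) : Prop :=
  s.foldl Role.step (Role.states true) = Role.source true

/-- The transition `t` starts at the position `i`. -/
def TransAt (s : List (NFASym A)) (i : ℕ) (t : List Bool × List A × List Bool) : Prop :=
  NameAt (Role.source true) s i ∧ ∃ v, SuffixAt s i (codeTransition t ++ v)

theorem NameAt.exists_eq {r : Role} {i : ℕ} (h : NameAt r s i) :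
    ∃ u c v, s = u ++ c :: v ∧ i = u.length + 1 ∧ c ≠ NFASym.bar ∧ r.Prefix u := by
  obtain ⟨h1, h2⟩ := h
  obtain ⟨c, hc, hc'⟩ : ∃ c, inputAt s i = InputSym.letter c ∧ c ≠ NFASym.bar := by
    rcases h2 with ⟨b, hb⟩ | hb
    · exact ⟨_, hb, by simp⟩
    · exact ⟨_, hb, by simp⟩
  obtain ⟨u, v, h3, h4⟩ := exists_suffixAt hc
  refine ⟨u, c, v, h3, h4, hc', ?_⟩
  rw [← h1, roleAt_of_suffixAt u h3 h4]
  exact prefix_foldl u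

theorem NameAt.le {r : Role} {i : ℕ} (h : NameAt r s i) : 0 < i ∧ i ≤ s.length := by
  obtain ⟨u, c, v, rfl, rfl, -⟩ := h.exists_eq
  simp

theorem codeNames_cons (p : List Bool) (l : List (List Bool)) :
    (codeNames (p :: l) : List (NFASym A)) = bits p ++ NFASym.comma :: codeNames l := by
  simp [codeNames]

theorem hasName_of_suffixAt {i : ℕ} {p : List Bool} {v : List (NFASym A)}
    (h : SuffixAt s i (bits p ++ NFASym.comma :: v)) : HasName s i p := ⟨_, v, h, Or.inl rfl⟩

theorem nameAt_of_suffixAt {i : ℕ} {p : List Bool} {v u : List (NFASym A)} {r : Role}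
    (h : s = u ++ (bits p ++ NFASym.comma :: v)) (hi : i = u.length + 1)
    (hr : u.foldl Role.step (Role.states true) = r) : NameAt r s i := by
  refine ⟨by rw [roleAt_of_suffixAt u h hi, hr], ?_⟩
  have h1 : SuffixAt s i (bits p ++ NFASym.comma :: v) := ⟨u, h, hi⟩
  cases p with
  | nil => exact Or.inr h1.inputAt_eq
  | cons b p => exact Or.inl ⟨b, SuffixAt.inputAt_eq h1⟩

theorem codeOf_eq (st : List (List Bool)) (p : List Bool) (f : List (List Bool))
    (tr : List (List Bool × List A × List Bool)) : codeOf st p f tr = codeNames st ++ NFASym.bar ::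
      (bits p ++ NFASym.bar :: (codeNames f ++ NFASym.bar :: tr.flatMap codeTransition)) := by
  simp [codeOf, codeHeader]

variable {st : List (List Bool)} {p : List Bool} {f : List (List Bool)}
  {tr : List (List Bool × List A × List Bool)}

/-- The role at `i` says that the text before it is a complete list of names. By unique decoding
this is an initial segment of the state list, and as the next symbol is not a bar, another name
starts there. -/
theorem exists_hasName_states (hs : s = codeOf st p f tr) {i : ℕ}
    (h : NameAt (Role.states true) s i) : ∃ q ∈ st, HasName s i q := by
  obtain ⟨u, c, v, h1, h2, hc, l, rfl⟩ := h.exists_eq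
  rw [hs, codeOf_eq] at h1
  obtain ⟨l', rfl, h3⟩ := codeNames_prefix h1.symm
  cases l' with
  | nil =>
    simp only [codeNames, List.flatMap_nil, List.nil_append, List.cons.injEq] at h3
    exact absurd h3.1 hc
  | cons q l' =>
    refine ⟨q, by simp, hasName_of_suffixAt (v := ?_) ⟨codeNames l, ?_, h2⟩⟩
    · exact codeNames l' ++ NFASym.bar :: (bits p ++ NFASym.bar ::
        (codeNames f ++ NFASym.bar :: tr.flatMap codeTransition))
    · rw [hs, codeOf_eq, codeNames_append, codeNames_cons]
      simp

theorem exists_nameAt_states (hs : s = codeOf st p f tr) {q : List Bool} (hq : q ∈ st) :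
    ∃ i, NameAt (Role.states true) s i ∧ HasName s i q := by
  obtain ⟨l, l', rfl⟩ := List.append_of_mem hq
  have h : s = codeNames l ++ (bits q ++ NFASym.comma :: (codeNames l' ++ NFASym.bar ::
      (bits p ++ NFASym.bar :: (codeNames f ++ NFASym.bar :: tr.flatMap codeTransition)))) := by
    rw [hs, codeOf_eq, codeNames_append, codeNames_cons]
    simp
  exact ⟨_, nameAt_of_suffixAt h rfl (foldl_codeNames l Role.states
    (fun b c => by cases b <;> rfl) (fun b => by cases b <;> rfl)),
    hasName_of_suffixAt ⟨_, h, rfl⟩⟩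

theorem foldl_final (st : List (List Bool)) (p : List Bool) (l : List (List Bool)) :
    (codeNames st ++ NFASym.bar :: (bits p ++ NFASym.bar :: codeNames l) :
      List (NFASym A)).foldl Role.step (Role.states true) = Role.final true := by
  rw [List.foldl_append, foldl_codeNames st Role.states (fun b c => by cases b <;> rfl)
    (fun b => by cases b <;> rfl), List.foldl_cons, List.foldl_append]
  change List.foldl _ (List.foldl _ (Role.start true) _) _ = _
  rw [foldl_bits p Role.start (fun b c => by cases b <;> rfl), List.foldl_cons]
  have h : ∀ b, (Role.start b).step (A := A) NFASym.bar = Role.final true := fun b => by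
    cases b <;> rfl
  rw [h, foldl_codeNames l Role.final (fun b c => by cases b <;> rfl)
    (fun b => by cases b <;> rfl)]

theorem exists_hasName_final (hs : s = codeOf st p f tr) {i : ℕ}
    (h : NameAt (Role.final true) s i) : ∃ q ∈ f, HasName s i q := by
  obtain ⟨u, c, v, h1, h2, hc, st', p', l, rfl⟩ := h.exists_eq
  have h4 := h1
  rw [hs, codeOf_eq, List.append_assoc, List.cons_append, List.append_assoc,
    List.cons_append] at h1
  obtain ⟨rfl, h5⟩ := codeNames_inj h1
  obtain ⟨rfl, -, h6⟩ := bits_cons_inj (by simp) (by simp) h5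
  obtain ⟨l', rfl, h3⟩ := codeNames_prefix h6.symm
  cases l' with
  | nil =>
    simp only [codeNames, List.flatMap_nil, List.nil_append, List.cons.injEq] at h3
    exact absurd h3.1 hc
  | cons q l' =>
    refine ⟨q, by simp, hasName_of_suffixAt (v := ?_) ⟨_, ?_, h2⟩⟩
    · exact codeNames l' ++ NFASym.bar :: tr.flatMap codeTransition
    · rw [h4, h3, codeNames_cons]
      simp

theorem exists_nameAt_final (hs : s = codeOf st p f tr) {q : List Bool} (hq : q ∈ f) :
    ∃ i, NameAt (Role.final true) s i ∧ HasName s i q := by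
  obtain ⟨l, l', rfl⟩ := List.append_of_mem hq
  have h : s = (codeNames st ++ NFASym.bar :: (bits p ++ NFASym.bar :: codeNames l)) ++
      (bits q ++ NFASym.comma :: (codeNames l' ++ NFASym.bar :: tr.flatMap codeTransition)) := by
    rw [hs, codeOf_eq, codeNames_append, codeNames_cons]
    simp
  exact ⟨_, nameAt_of_suffixAt h rfl (foldl_final st p l), hasName_of_suffixAt ⟨_, h, rfl⟩⟩

theorem exists_transAt (hs : s = codeOf st p f tr) {i : ℕ}
    (h : NameAt (Role.source true) s i) : ∃ t ∈ tr, TransAt s i t := by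
  obtain ⟨u, c, v, h1, h2, hc, st', p', f', l, rfl⟩ := h.exists_eq
  have h4 := h1
  rw [hs, codeOf, codeOf, List.append_assoc] at h1
  obtain ⟨rfl, rfl, rfl, h5⟩ := codeHeader_inj h1
  obtain ⟨l', rfl, h3⟩ := transitions_prefix h5.symm
  cases l' with
  | nil => simp at h3
  | cons t l' =>
    refine ⟨t, by simp, h, l'.flatMap codeTransition, _, ?_, h2⟩
    rw [h4, h3, List.flatMap_cons]

theorem exists_transAt_of_mem (hs : s = codeOf st p f tr) {t : List Bool × List A × List Bool}
    (ht : t ∈ tr) : ∃ i, TransAt s i t := by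
  obtain ⟨l, l', rfl⟩ := List.append_of_mem ht
  have h : s = codeOf st p f l ++ (codeTransition t ++ l'.flatMap codeTransition) := by
    rw [hs, codeOf, codeOf]
    simp
  refine ⟨(codeOf st p f l).length + 1, nameAt_of_suffixAt (p := t.1) (v := t.2.1.map NFASym.letter
    ++ NFASym.comma :: (bits t.2.2 ++ NFASym.comma :: l'.flatMap codeTransition)) ?_ rfl
    (foldl_codeOf st p f l), _, _, h, rfl⟩
  rw [h, codeTransition]
  simp

theorem TransAt.suffixAt {i : ℕ} {t : List Bool × List A × List Bool} (h : TransAt s i t) :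
    ∃ v, SuffixAt s i (bits t.1 ++ NFASym.comma :: (t.2.1.map NFASym.letter ++ NFASym.comma ::
      (bits t.2.2 ++ NFASym.comma :: v))) := by
  obtain ⟨-, v, h⟩ := h
  exact ⟨v, by simpa [codeTransition] using h⟩

theorem TransAt.hasName {i : ℕ} {t : List Bool × List A × List Bool} (h : TransAt s i t) :
    HasName s i t.1 := by
  obtain ⟨v, h⟩ := h.suffixAt
  exact hasName_of_suffixAt h

theorem TransAt.hasName_target {i : ℕ} {t : List Bool × List A × List Bool} (h : TransAt s i t) :
    HasName s (i + t.1.length + 1 + t.2.1.length + 1) t.2.2 := by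
  obtain ⟨v, h⟩ := h.suffixAt
  have := (h.append.cons.append).cons
  simp only [length_bits, List.length_map] at this
  exact hasName_of_suffixAt this

theorem TransAt.inj {i : ℕ} {t t' : List Bool × List A × List Bool} (h : TransAt s i t)
    (h' : TransAt s i t') : t = t' := by
  obtain ⟨v, h⟩ := h.suffixAt
  obtain ⟨v', h'⟩ := h'.suffixAt
  have h0 := h.inj h'
  obtain ⟨p, x, q⟩ := t
  obtain ⟨p', x', q'⟩ := t'
  obtain ⟨rfl, -, h1⟩ := bits_cons_inj (by simp) (by simp) h0
  obtain ⟨rfl, -, h2⟩ := letters_cons_inj (by simp) (by simp) h1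
  obtain ⟨rfl, -, h3⟩ := bits_cons_inj (by simp) (by simp) h2
  rfl

theorem TransAt.mem (hs : s = codeOf st p f tr) {i : ℕ} {t : List Bool × List A × List Bool}
    (h : TransAt s i t) : t ∈ tr := by
  obtain ⟨t', ht', h'⟩ := exists_transAt hs h.1
  rwa [h.inj h']

/-- The positions of the initial state. -/
theorem roleAt_start_iff (hs : s = codeOf st p f tr) {i : ℕ} :
    roleAt s i = Role.start true ↔
      i = (codeNames st ++ [NFASym.bar] : List (NFASym A)).length + 1 := by
  constructor
  · intro h
    rcases Nat.eq_zero_or_pos i with rfl | hi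
    · cases h
    -- Beyond the end of a code the role is `Role.source true`, so the position lies inside the
    -- string.
    · rcases Nat.lt_or_ge s.length i with h1 | h1
      · rw [roleAt_of_length_lt h1, hs, foldl_codeOf] at h
        cases h
      · have h2 : s = s.take (i - 1) ++ s.drop (i - 1) := (List.take_append_drop _ _).symm
        have h3 : i = (s.take (i - 1)).length + 1 := by simp; omega
        have h4 := roleAt_of_suffixAt _ h2 h3
        have h5 := prefix_foldl (s.take (i - 1))
        rw [← h4, h] at h5
        obtain ⟨l, hl⟩ := h5
        rw [hl] at h2 h3
        rw [h3]
        have h6 := h2.symm.trans (hs.trans (codeOf_eq _ _ _ _))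
        rw [List.append_assoc, List.singleton_append] at h6
        obtain ⟨rfl, -⟩ := codeNames_inj h6
        rfl
  · intro h
    have h1 : s = (codeNames st ++ [NFASym.bar]) ++ (bits p ++ NFASym.bar :: (codeNames f ++
        NFASym.bar :: tr.flatMap codeTransition)) := by
      rw [hs, codeOf_eq]
      simp
    rw [roleAt_of_suffixAt _ h1 h, List.foldl_append, foldl_codeNames st Role.states (fun b c => by cases b <;> rfl)
      (fun b => by cases b <;> rfl)]
    rfl

/-- The bar in front of the initial state is treated like the comma in front of the target of a
transition: reading starts there, as at the end of an empty word that leads to the initial state. -/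
theorem suffixAt_start (hs : s = codeOf st p f tr) {i : ℕ}
    (hi : roleAt s (i + 1) = Role.start true) :
    ∃ v, SuffixAt s i (NFASym.bar :: (bits p ++ NFASym.bar :: v)) := by
  rw [roleAt_start_iff hs] at hi
  refine ⟨_, codeNames st, hs.trans (codeOf_eq _ _ _ _), ?_⟩
  simp at hi
  omega

/-- At position `i` there is a block of `a` bits and a block of `b` letters, each followed by a
comma. -/
def HasBlock (s : List (NFASym A)) (i a b : ℕ) : Prop :=
  (∀ o < a, IsBit (inputAt s (i + o))) ∧ IsComma (inputAt s (i + a)) ∧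
    (∀ o < b, IsLetter (inputAt s (i + a + 1 + o))) ∧ IsComma (inputAt s (i + a + 1 + b))

theorem not_isBit_of_isComma {x : InputSym (NFASym A)} (h : IsComma x) : ¬ IsBit x := by
  rw [IsComma] at h
  subst h
  exact not_isBit (Or.inl rfl)

theorem not_isLetter_of_isComma {x : InputSym (NFASym A)} (h : IsComma x) : ¬ IsLetter x := by
  rw [IsComma] at h
  subst h
  rintro ⟨b, hb⟩
  simp at hb

theorem TransAt.block_bits {i : ℕ} {t : List Bool × List A × List Bool} (h : TransAt s i t)
    {a : ℕ} : ((∀ o < a, IsBit (inputAt s (i + o))) ∧ IsComma (inputAt s (i + a))) ↔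
      a = t.1.length := by
  obtain ⟨v, h⟩ := h.suffixAt
  have h1 := h.span (n := a) isBit_of_mem_bits (not_isBit (Or.inl rfl))
  rw [length_bits] at h1
  rw [← h1]
  refine and_congr_right fun h2 => ⟨not_isBit_of_isComma, fun h3 => ?_⟩
  have h4 := h1.1 ⟨h2, h3⟩
  subst h4
  have := h.append.inputAt_eq
  rwa [length_bits] at this

theorem TransAt.hasBlock_iff {i : ℕ} {t : List Bool × List A × List Bool} (h : TransAt s i t)
    {a b : ℕ} : HasBlock s i a b ↔ a = t.1.length ∧ b = t.2.1.length := by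
  rw [HasBlock, ← and_assoc, h.block_bits]
  refine and_congr_right ?_
  rintro rfl
  obtain ⟨v, h⟩ := h.suffixAt
  have h0 := h.append.cons
  rw [length_bits] at h0
  have h1 := h0.span (n := b) (P := IsLetter) (by simp [IsLetter])
    (not_isLetter_of_isComma rfl)
  rw [List.length_map] at h1
  rw [← h1]
  refine and_congr_right fun h2 => ⟨not_isLetter_of_isComma, fun h3 => ?_⟩
  have h4 := h1.1 ⟨h2, h3⟩
  subst h4
  have := h0.append.inputAt_eq
  rwa [List.length_map] at this

theorem TransAt.le {i : ℕ} {t : List Bool × List A × List Bool} (h : TransAt s i t) :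
    i + t.1.length + 1 + t.2.1.length + 1 ≤ s.length := by
  obtain ⟨v, h⟩ := h.suffixAt
  have := h.le
  simp [bits] at this
  omega

/-- The transition at `i` ends in the state where the transition at `j` starts. -/
def Follows (N : ℕ) (s : List (NFASym A)) (i j : ℕ) : Prop :=
  NameAt (Role.source true) s i ∧ NameAt (Role.source true) s j ∧
    ∃ a < N, ∃ b < N, HasBlock s i a b ∧ SameName N s (i + a + 1 + b + 1) j

theorem follows_iff {N : ℕ} (hN : s.length < N) {i j : ℕ} {t t' : List Bool × List A × List Bool}
    (h : TransAt s i t) (h' : TransAt s j t') : Follows N s i j ↔ t.2.2 = t'.1 := by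
  rw [← sameName_iff hN h.hasName_target h'.hasName]
  constructor
  · rintro ⟨-, -, a, -, b, -, h1, h2⟩
    obtain ⟨rfl, rfl⟩ := h.hasBlock_iff.1 h1
    exact h2
  · intro h1
    have := h.le
    exact ⟨h.1, h'.1, _, by omega, _, by omega, h.hasBlock_iff.2 ⟨rfl, rfl⟩, h1⟩

/-- There is a transition from `q` to `r`. -/
def Step (tr : List (List Bool × List A × List Bool)) (q r : List Bool) : Prop :=
  ∃ x, (q, x, r) ∈ tr

/-- States are named by bit strings of any length, so the graph is built on positions instead: its
vertices are the occurrences of transitions. A closed walk of states lifts to consecutive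
transitions, which one further edge closes up, and a closed walk of transitions projects to the
states where they start. -/
theorem acyclic_follows_iff (hs : s = codeOf st p f tr) {N : ℕ} (hN : s.length < N) :
    (∀ i, ¬ Relation.TransGen (Follows N s) i i) ↔ ∀ q, ¬ Relation.TransGen (Step tr) q q := by
  constructor
  · intro h q hq
    have key : ∀ r, Relation.TransGen (Step tr) q r → ∃ i j t t', TransAt s i t ∧ TransAt s j t' ∧
        t.1 = q ∧ t'.2.2 = r ∧ Relation.ReflTransGen (Follows N s) i j := by
      intro r hr
      induction hr with
      | single h =>
        obtain ⟨x, hx⟩ := h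
        obtain ⟨i, hi⟩ := exists_transAt_of_mem hs hx
        exact ⟨i, i, _, _, hi, hi, rfl, rfl, Relation.ReflTransGen.refl⟩
      | tail _ h ih =>
        obtain ⟨i, j, t, t', hi, hj, h1, h2, h3⟩ := ih
        obtain ⟨x, hx⟩ := h
        obtain ⟨k, hk⟩ := exists_transAt_of_mem hs hx
        exact ⟨i, k, t, _, hi, hk, h1, rfl, h3.tail ((follows_iff hN hj hk).2 h2)⟩
    obtain ⟨i, j, t, t', hi, hj, h1, h2, h3⟩ := key q hq
    exact h i (Relation.TransGen.tail' h3 ((follows_iff hN hj hi).2 (h2.trans h1.symm)))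
  · intro h i hi
    have key : ∀ j, Relation.TransGen (Follows N s) i j → ∃ t t', TransAt s i t ∧ TransAt s j t' ∧
        Relation.TransGen (Step tr) t.1 t'.1 := by
      intro j hj
      induction hj with
      | single h =>
        obtain ⟨t, ht, h1⟩ := exists_transAt hs h.1
        obtain ⟨t', ht', h2⟩ := exists_transAt hs h.2.1
        refine ⟨t, t', h1, h2, Relation.TransGen.single ⟨t.2.1, ?_⟩⟩
        rwa [← (follows_iff hN h1 h2).1 h]
      | tail _ h ih =>
        obtain ⟨t, t', h1, h2, h3⟩ := ih
        obtain ⟨t'', ht', h4⟩ := exists_transAt hs h.2.1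
        refine ⟨t, t'', h1, h4, h3.tail ⟨t'.2.1, ?_⟩⟩
        rw [← (follows_iff hN h2 h4).1 h]
        exact h2.mem hs
    obtain ⟨t, t', h1, h2, h3⟩ := key i hi
    rw [h1.inj h2] at h3
    exact h _ h3

/-! ### Tests for codes -/

/-- The name at position `i` is the name of a state. -/
def Listed (N : ℕ) (s : List (NFASym A)) (i : ℕ) : Prop :=
  ∃ j < N, NameAt (Role.states true) s j ∧ SameName N s i j

theorem listed_iff (hs : s = codeOf st p f tr) {N : ℕ} (hN : s.length < N) {i : ℕ} {q : List Bool}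
    (hq : HasName s i q) : Listed N s i ↔ q ∈ st := by
  constructor
  · rintro ⟨j, -, h1, h2⟩
    obtain ⟨r, hr, h3⟩ := exists_hasName_states hs h1
    rwa [(sameName_iff hN hq h3).1 h2]
  · intro h
    obtain ⟨j, h1, h2⟩ := exists_nameAt_states hs h
    exact ⟨j, by have := h1.le; omega, h1, (sameName_iff hN hq h2).2 rfl⟩

/-- All states that occur in a code are listed. -/
def AllListed (N : ℕ) (s : List (NFASym A)) : Prop :=
  (∀ i < N, roleAt s i = Role.start true → Listed N s i) ∧
    (∀ i < N, NameAt (Role.final true) s i → Listed N s i) ∧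
    ∀ i < N, NameAt (Role.source true) s i → Listed N s i ∧ ∀ a < N, ∀ b < N, HasBlock s i a b →
      Listed N s (i + a + 1 + b + 1)

theorem allListed_iff (hs : s = codeOf st p f tr) {N : ℕ} (hN : s.length < N) :
    AllListed N s ↔ p ∈ st ∧ (∀ q ∈ f, q ∈ st) ∧ ∀ t ∈ tr, t.1 ∈ st ∧ t.2.2 ∈ st := by
  refine and_congr ?_ (and_congr ?_ ?_)
  · have h1 : roleAt s ((codeNames st : List (NFASym A)).length + 1 + 1) = Role.start true := by
      rw [roleAt_start_iff hs]
      simp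
    obtain ⟨v, h2⟩ := suffixAt_start hs h1
    have h3 : HasName s ((codeNames st : List (NFASym A)).length + 1 + 1) p :=
      ⟨_, v, h2.cons, Or.inr rfl⟩
    have h4 := h2.le
    simp only [List.length_cons, List.length_append] at h4
    rw [← listed_iff hs hN h3]
    constructor
    · intro h
      exact h _ (by omega) h1
    · intro h i _ hi
      rw [roleAt_start_iff hs] at h1 hi
      rwa [hi, ← h1]
  · constructor
    · intro h q hq
      obtain ⟨i, h1, h2⟩ := exists_nameAt_final hs hq
      exact (listed_iff hs hN h2).1 (h i (by have := h1.le; omega) h1)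
    · intro h i _ hi
      obtain ⟨q, hq, h1⟩ := exists_hasName_final hs hi
      exact (listed_iff hs hN h1).2 (h q hq)
  · constructor
    · intro h t ht
      obtain ⟨i, hi⟩ := exists_transAt_of_mem hs ht
      have := hi.le
      obtain ⟨h1, h2⟩ := h i (by omega) hi.1
      exact ⟨(listed_iff hs hN hi.hasName).1 h1, (listed_iff hs hN hi.hasName_target).1
        (h2 _ (by omega) _ (by omega) (hi.hasBlock_iff.2 ⟨rfl, rfl⟩))⟩
    · intro h i _ hi
      obtain ⟨t, ht, hi⟩ := exists_transAt hs hi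
      refine ⟨(listed_iff hs hN hi.hasName).2 (h t ht).1, fun a _ b _ hab => ?_⟩
      obtain ⟨rfl, rfl⟩ := hi.hasBlock_iff.1 hab
      exact (listed_iff hs hN hi.hasName_target).2 (h t ht).2

variable {N : List (NFASym A) → ℕ}

theorem Dec.roleAt_eq (r : Role) (i : ℕ) : Dec N fun w e => roleAt w (e i) = r :=
  Dec.runTo_eq _ _ r i

theorem Dec.nameAt (r : Role) (i : ℕ) : Dec N fun w e => NameAt r w (e i) :=
  (Dec.roleAt_eq r i).and ((Dec.sym (fun _ e => e i) IsBit).or (Dec.sym (fun _ e => e i) IsComma))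

theorem Dec.hasBlock (i a b : ℕ) : Dec N fun w e => HasBlock w (e i) (e a) (e b) := by
  refine Dec.and ?_ (Dec.and ?_ (Dec.and ?_ ?_))
  · exact Dec.allVar (φ := fun w e o => IsBit (inputAt w (e i + o))) a
      (Dec.sym (fun _ e => e (i + 1) + e 0) IsBit)
  · exact Dec.sym (fun _ e => e i + e a) IsComma
  · exact Dec.allVar (φ := fun w e o => IsLetter (inputAt w (e i + e a + 1 + o))) b
      (Dec.sym (fun _ e => e (i + 1) + e (a + 1) + 1 + e 0) IsLetter)
  · exact Dec.sym (fun _ e => e i + e a + 1 + e b) IsComma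

theorem Dec.follows (i j : ℕ) : Dec N fun w e => Follows (N w) w (e i) (e j) := by
  refine (Dec.nameAt _ i).and ((Dec.nameAt _ j).and ?_)
  refine Dec.ex (φ := fun w e a => ∃ b < N w, HasBlock w (e i) a b ∧
    SameName (N w) w (e i + a + 1 + b + 1) (e j)) ?_
  refine Dec.ex (φ := fun w e b => HasBlock w (e (i + 1)) (e 0) b ∧
    SameName (N w) w (e (i + 1) + e 0 + 1 + b + 1) (e (j + 1))) ?_
  exact (Dec.hasBlock (i + 1 + 1) 1 0).and
    (Dec.sameName (fun _ e => e (i + 1 + 1) + e 1 + 1 + e 0 + 1) fun _ e => e (j + 1 + 1))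

theorem Dec.listed (t : List (NFASym A) → (ℕ → ℕ) → ℕ) [Lin t] :
    Dec N fun w e => Listed (N w) w (t w e) := by
  refine Dec.ex (φ := fun w e j => NameAt (Role.states true) w j ∧ SameName (N w) w (t w e) j) ?_
  exact (Dec.nameAt _ 0).and (Dec.sameName (fun w e => t w fun i => e (i + 1)) fun _ e => e 0)

theorem Dec.imp {α : Type u} {N : List α → ℕ} {φ ψ : List α → (ℕ → ℕ) → Prop} (h : Dec N φ)
    (h' : Dec N ψ) : Dec N fun w e => φ w e → ψ w e :=
  (h.not.or h').congr fun _ _ => by tauto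

theorem Dec.allListed : Dec N fun w _ => AllListed (N w) w := by
  refine Dec.and ?_ (Dec.and ?_ ?_)
  · exact Dec.all (φ := fun w _ i => roleAt w i = Role.start true → Listed (N w) w i)
      ((Dec.roleAt_eq _ 0).imp (Dec.listed fun _ e => e 0))
  · exact Dec.all (φ := fun w _ i => NameAt (Role.final true) w i → Listed (N w) w i)
      ((Dec.nameAt _ 0).imp (Dec.listed fun _ e => e 0))
  · refine Dec.all (φ := fun w _ i => NameAt (Role.source true) w i → Listed (N w) w i ∧
      ∀ a < N w, ∀ b < N w, HasBlock w i a b → Listed (N w) w (i + a + 1 + b + 1))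
      ((Dec.nameAt _ 0).imp ((Dec.listed fun _ e => e 0).and ?_))
    refine Dec.all (φ := fun w e a => ∀ b < N w, HasBlock w (e 0) a b →
      Listed (N w) w (e 0 + a + 1 + b + 1)) ?_
    exact Dec.all (φ := fun w e b => HasBlock w (e 1) (e 0) b →
      Listed (N w) w (e 1 + e 0 + 1 + b + 1))
      ((Dec.hasBlock 2 1 0).imp (Dec.listed fun _ e => e 2 + e 1 + 1 + e 0 + 1))

theorem Tst.acyclic_follows (hN : ∀ w : List (NFASym A), w.length < N w) :
    Tst N fun w _ => ∀ i, ¬ Relation.TransGen (Follows (N w) w) i i :=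
  Tst.acyclic (V := fun w => NameAt (Role.source Bool.true) w) (fun w => by have := hN w; omega)
    -- Position 0 is the left end marker, so 0 is not a vertex, as the counting argument demands.
    (fun i => Dec.nameAt _ i) (fun i j => Dec.follows i j) (fun w h => absurd h.le.1 (by simp))
    (fun w v h => by have := hN w; have := h.le; omega) (fun w u v h => ⟨h.1, h.2.1⟩)

/-- Guessing any position that shows the right end marker gives access to the final role. The first
such position is `w.length + 1`, which has to lie below the bound. -/
theorem Dec.wellFormed (hN : ∀ w : List (NFASym A), w.length + 1 < N w) :
    Dec N fun w _ => WellFormed w := by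
  refine (Dec.ex (φ := fun w _ i => inputAt w i = InputSym.rightEnd ∧
    roleAt w i = Role.source true) ((Dec.sym (fun _ e => e 0) fun x => x = InputSym.rightEnd).and
    (Dec.roleAt_eq _ 0))).congr fun w e => ?_
  constructor
  · rintro ⟨i, -, h1, h2⟩
    rwa [roleAt_of_length_lt (inputAt_eq_rightEnd_iff.1 h1)] at h2
  · intro h
    exact ⟨w.length + 1, hN w, inputAt_eq_rightEnd_iff.2 (by omega),
      (roleAt_of_length_lt (by omega)).trans h⟩

end Positions

/-! ### Automata whose states are their own names -/

section Names

variable {A : Type u}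

/-- There is an accepting path of `k` transitions which spells the word. -/
inductive Accepts (tr : List (List Bool × List A × List Bool)) (f : List (List Bool)) :
    ℕ → List Bool → List A → Prop
  | final {r : List Bool} : r ∈ f → Accepts tr f 0 r []
  | step {k : ℕ} {r r' : List Bool} {x y : List A} :
      (r, x, r') ∈ tr → Accepts tr f k r' y → Accepts tr f (k + 1) r (x ++ y)

/-- The list `l` consists of the states in which the transitions of the path start. -/
theorem Accepts.exists_chain {tr : List (List Bool × List A × List Bool)} {f st : List (List Bool)}
    (htr : ∀ t ∈ tr, t.1 ∈ st ∧ t.2.2 ∈ st) {k : ℕ} {r : List Bool} {y : List A}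
    (h : Accepts tr f k r y) : ∃ l : List (List Bool), l.length = k ∧ (∀ q ∈ l, q ∈ st) ∧
      List.IsChain (Step tr) l ∧ ∀ q ∈ l.head?, q = r := by
  induction h with
  | final _ => exact ⟨[], by simp⟩
  | step h _ ih =>
    rename_i k r r' x y _
    obtain ⟨l, h1, h2, h3, h4⟩ := ih
    refine ⟨r :: l, by simp [h1], by simpa using ⟨(htr _ h).1, h2⟩, ?_, by simp⟩
    cases l with
    | nil => simp
    | cons q l =>
      obtain rfl : q = r' := by simpa using h4
      exact List.IsChain.cons_cons ⟨x, h⟩ h3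

/-- The sources of the transitions on a path form a chain for the transition relation. In the
absence of cycles they are pairwise different, so there are at most as many as listed states. This
keeps the words to be read polynomially long. -/
theorem Accepts.le {tr : List (List Bool × List A × List Bool)} {f st : List (List Bool)}
    (htr : ∀ t ∈ tr, t.1 ∈ st ∧ t.2.2 ∈ st) (hac : ∀ q, ¬ Relation.TransGen (Step tr) q q)
    {k : ℕ} {r : List Bool} {y : List A} (h : Accepts tr f k r y) : k ≤ st.length := by
  classical
  obtain ⟨l, rfl, h2, h3, -⟩ := h.exists_chain htr
  have h4 : l.Pairwise (Relation.TransGen (Step tr)) :=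
    List.isChain_iff_pairwise.1 (h3.imp fun _ _ => Relation.TransGen.single)
  have h5 : l.Nodup := h4.imp fun {a b} hab => by
    rintro rfl
    exact hac _ hab
  rw [← List.toFinset_card_of_nodup h5]
  exact (Finset.card_le_card fun q hq => by simpa using h2 q (by simpa using hq)).trans
    st.toFinset_card_le

/-- The string is the code of an acyclic automaton that accepts a word with the property `P`. -/
theorem exists_isEncoding_iff {s : List (NFASym A)} {P : List A → Prop} :
    (∃ (Q : Type) (_ : Finite Q) (M : WordNFA A Q), M.Acyclic ∧ M.IsEncoding s ∧
      ∃ w ∈ M.language, P w) ↔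
    ∃ st p f tr, s = codeOf st p f tr ∧
      (p ∈ st ∧ (∀ q ∈ f, q ∈ st) ∧ ∀ t ∈ tr, t.1 ∈ st ∧ t.2.2 ∈ st) ∧
      (∀ q, ¬ Relation.TransGen (Step tr) q q) ∧ ∃ k y, Accepts tr f k p y ∧ P y := by
  classical
  constructor
  · rintro ⟨Q, _, M, hac, ⟨name, states, final, trans, hinj, h1, h2, h3, rfl⟩, w, ⟨q, hq, hw⟩, hP⟩
    refine ⟨_, _, _, _, codeNFA_eq name states M.start final trans, ⟨?_, ?_, ?_⟩, ?_, ?_⟩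
    · exact List.mem_map_of_mem (h1 _)
    · intro q hq
      obtain ⟨q, -, rfl⟩ := List.mem_map.1 hq
      exact List.mem_map_of_mem (h1 _)
    · intro t ht
      obtain ⟨t, -, rfl⟩ := List.mem_map.1 ht
      exact ⟨List.mem_map_of_mem (h1 _), List.mem_map_of_mem (h1 _)⟩
    -- Steps between names come from transitions between states. Injectivity of the naming glues
    -- consecutive ones together, so that a cycle of names yields a cycle of states.
    · have hstep : ∀ {p r}, Step (trans.map fun t => (name t.1, t.2.1, name t.2.2)) p r →
          ∃ q q', name q = p ∧ name q' = r ∧ ∃ x, (q, x, q') ∈ M.trans := by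
        rintro p r ⟨x, hx⟩
        obtain ⟨t, ht, h⟩ := List.mem_map.1 hx
        simp only [Prod.mk.injEq] at h
        obtain ⟨h4, rfl, h5⟩ := h
        exact ⟨_, _, h4, h5, _, (h3 t).1 ht⟩
      intro p hp
      have key : ∀ r, Relation.TransGen (Step (trans.map fun t => (name t.1, t.2.1, name t.2.2)))
          p r → ∃ q q', name q = p ∧ name q' = r ∧
          Relation.TransGen (fun p p' => ∃ x, (p, x, p') ∈ M.trans) q q' := by
        intro r hr
        induction hr with
        | single h =>
          obtain ⟨q, q', h4, h5, h6⟩ := hstep h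
          exact ⟨q, q', h4, h5, Relation.TransGen.single h6⟩
        | tail _ h ih =>
          obtain ⟨q, q', h4, h5, h6⟩ := ih
          obtain ⟨q₂, q₂', h7, h8, h9⟩ := hstep h
          obtain rfl := hinj (h7.trans h5.symm)
          exact ⟨q, q₂', h4, h8, h6.tail h9⟩
      obtain ⟨q, q', h4, h5, h6⟩ := key p hp
      obtain rfl := hinj (h4.trans h5.symm)
      exact hac _ h6
    · have key : ∀ p w q, M.Path p w q → q ∈ M.final → ∃ k,
          Accepts (trans.map fun t => (name t.1, t.2.1, name t.2.2)) (final.map name) k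
            (name p) w := by
        intro p w q h hq
        induction h with
        | nil q => exact ⟨0, Accepts.final (List.mem_map_of_mem ((h2 _).2 hq))⟩
        | cons h _ ih =>
          obtain ⟨k, hk⟩ := ih hq
          exact ⟨k + 1, Accepts.step (List.mem_map.2 ⟨_, (h3 _).2 h, rfl⟩) hk⟩
      obtain ⟨k, hk⟩ := key _ _ _ hw hq
      exact ⟨k, w, hk, hP⟩
  · rintro ⟨st, p, f, tr, rfl, ⟨hp, hf, htr⟩, hac, k, y, hy, hP⟩
    -- The listed names themselves serve as states, with the inclusion as the naming. Transitions
    -- and final states restrict to this type because all states that occur are listed.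
    let tr' : List ({q // q ∈ st} × List A × {q // q ∈ st}) :=
      tr.pmap (fun t h => (⟨t.1, h.1⟩, t.2.1, ⟨t.2.2, h.2⟩)) htr
    let f' : List {q // q ∈ st} := f.pmap Subtype.mk hf
    have htr' : tr'.map (fun t => (t.1.1, t.2.1, t.2.2.1)) = tr := by
      simp [tr', List.map_pmap]
    have hf' : f'.map Subtype.val = f := by simp [f', List.map_pmap]
    refine ⟨{q // q ∈ st}, (List.finite_toSet st).to_subtype, ⟨tr'.toFinset, ⟨p, hp⟩, f'.toFinset⟩,
      ?_, ⟨Subtype.val, st.attach, f', tr', Subtype.val_injective, by simp, by simp, by simp, ?_⟩,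
      y, ?_, hP⟩
    · intro q hq
      refine hac q.1 (Relation.TransGen.lift (p := Step tr) Subtype.val ?_ _ _ hq)
      rintro a b ⟨x, hx⟩
      refine ⟨x, ?_⟩
      rw [← htr']
      exact List.mem_map.2 ⟨_, List.mem_toFinset.1 hx, rfl⟩
    · rw [codeNFA_eq, htr', hf', List.attach_map_subtype_val]
    · have key : ∀ r (hr : r ∈ st) k y, Accepts tr f k r y → ∃ q ∈ f'.toFinset,
          WordNFA.Path ⟨tr'.toFinset, ⟨p, hp⟩, f'.toFinset⟩ ⟨r, hr⟩ y q := by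
        intro r hr k y h
        induction h with
        | final h =>
          rw [← hf'] at h
          obtain ⟨q, hq, rfl⟩ := List.mem_map.1 h
          exact ⟨q, List.mem_toFinset.2 hq, WordNFA.Path.nil _⟩
        | step h _ ih =>
          obtain ⟨q, hq, h1⟩ := ih (htr _ h).2
          refine ⟨q, hq, WordNFA.Path.cons (List.mem_toFinset.2 ?_) h1⟩
          rw [← htr'] at h
          obtain ⟨⟨a, x, b⟩, ht, h2⟩ := List.mem_map.1 h
          simp only [Prod.mk.injEq] at h2
          obtain ⟨rfl, rfl, rfl⟩ := h2
          exact ht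
      exact key p hp k y hy

end Names

/-! ### Runs of one-way machines -/

section Machine

variable {B : Type u} (M : AuxPDA B)

/-- The part of a configuration without the input, with the tape split at the head. -/
structure Zip : Type where
  state : M.State
  scanned : M.Work
  left : List M.Work
  right : List M.Work
  stack : List M.Stack

/-- The split tape after writing a symbol and moving the head. -/
def moveTape {W : Type} (blank : W) (c : W) (l r : List W) : HeadMove → W × List W × List W
  | HeadMove.stay => (c, l, r)
  | HeadMove.left =>
    match l with
    | [] => (c, [], r)
    | d :: l => (d, l, c :: r)
  | HeadMove.right =>
    match r with
    | [] => (blank, c :: l, [])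
    | d :: r => (d, c :: l, r)

variable {M}

/-- The effect of an action on a split configuration. -/
def Zip.act (z : Zip M) (a : AuxPDAAction M.State M.Work M.Stack) : Zip M where
  state := a.next
  scanned := (moveTape M.blank a.write z.left z.right a.workMove).1
  left := (moveTape M.blank a.write z.left z.right a.workMove).2.1
  right := (moveTape M.blank a.write z.left z.right a.workMove).2.2
  stack := a.stackOp.apply z.stack

/-- The number of cells that are stored besides the scanned cell. -/
def Zip.size (z : Zip M) : ℕ := z.left.length + z.right.length

variable (M) in
/-- The initial split configuration. -/
def Zip.init : Zip M := ⟨M.start, M.blank, [], [], []⟩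

/-- A split configuration represents a configuration. -/
def Zip.Represents (z : Zip M) (c : M.Cfg) : Prop :=
  c.state = z.state ∧ c.stack = z.stack ∧ c.workPos = z.left.length ∧
    c.tape = fun i => (z.left.reverse ++ z.scanned :: z.right).getD i M.blank

theorem Zip.represents_init : (Zip.init M).Represents M.init := by
  refine ⟨rfl, rfl, rfl, ?_⟩
  funext i
  cases i <;> rfl

theorem update_getD {W : Type} (l r : List W) (c d b : W) :
    Function.update (fun i => (l.reverse ++ c :: r).getD i b) l.length d =
      fun i => (l.reverse ++ d :: r).getD i b := by
  funext i
  rcases lt_trichotomy i l.length with h | rfl | h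
  · rw [Function.update_of_ne h.ne, List.getD_append _ _ _ _ (by simpa using h),
      List.getD_append _ _ _ _ (by simpa using h)]
  · simp [List.getD_eq_getElem?_getD]
  · obtain ⟨k, rfl⟩ := Nat.exists_eq_add_of_lt h
    rw [Function.update_of_ne h.ne', List.getD_append_right _ _ _ _ (by simp; omega),
      List.getD_append_right _ _ _ _ (by simp; omega)]
    rw [show l.length + k + 1 - l.reverse.length = k + 1 by simp; omega]
    rfl

theorem Zip.Represents.act {z : Zip M} {c : M.Cfg} (h : z.Represents c) (n : ℕ)
    (a : AuxPDAAction M.State M.Work M.Stack) : (z.act a).Represents (M.doAction n a c) := by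
  obtain ⟨h1, h2, h3, h4⟩ := h
  have h5 : Function.update c.tape c.workPos a.write =
      fun i => (z.left.reverse ++ a.write :: z.right).getD i M.blank := by
    rw [h3, h4, update_getD]
  refine ⟨rfl, by simp [Zip.act, AuxPDA.doAction, h2], ?_, ?_⟩
  · simp only [AuxPDA.doAction, Zip.act, h3]
    cases a.workMove with
    | stay => rfl
    | left => cases z.left <;> simp [moveTape, HeadMove.moveWork]
    | right => cases z.right <;> simp [moveTape, HeadMove.moveWork]
  · simp only [AuxPDA.doAction, Zip.act, h5]
    cases a.workMove with
    | stay => rfl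
    | left => cases z.left <;> simp [moveTape]
    | right =>
      cases z.right with
      | cons d r => simp [moveTape]
      -- The cell that joins the stored part is blank, which agrees with the default value outside
      -- the stored part.
      | nil =>
        funext i
        simp only [moveTape, List.reverse_cons]
        rcases Nat.lt_or_ge i (z.left.reverse ++ [a.write]).length with h | h
        · rw [List.getD_append _ _ _ _ h]
        · rw [List.getD_append_right _ _ _ _ h, List.getD_eq_default _ _ h]
          cases i - (z.left.reverse ++ [a.write]).length <;> rfl

/-- The stored part grows only when the head moves right beyond it, and then nothing is stored to
the right of the head. So a bound on head positions also bounds the stored tape. -/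
theorem Zip.size_act (z : Zip M) (a : AuxPDAAction M.State M.Work M.Stack) :
    (z.act a).size ≤ max z.size (z.act a).left.length := by
  simp only [Zip.size, Zip.act]
  cases a.workMove with
  | stay => simp [moveTape]
  | left => cases z.left <;> simp [moveTape]; omega
  | right => cases z.right <;> simp [moveTape]; omega

/-- The symbol that a one-way head sees in front of the rest of the input. -/
def headSym : List B → InputSym B
  | [] => InputSym.rightEnd
  | c :: _ => InputSym.letter c

/-- The rest of the input after a movement of a one-way head. -/
def advance : HeadMove → List B → List B
  | HeadMove.right, y => y.tail
  | _, y => y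

/-- An accepting run of length `t` on the rest of the input, all of whose configurations have the
property `P`. -/
inductive AcceptingRun (P : Zip M → Prop) : ℕ → Zip M → List B → Prop
  | done {z : Zip M} {y : List B} : z.state ∈ M.accept → AcceptingRun P 0 z y
  | step {t : ℕ} {z : Zip M} {y : List B} {a : AuxPDAAction M.State M.Work M.Stack} :
      a ∈ M.step z.state (headSym y) z.scanned z.stack.head? → P (z.act a) →
      AcceptingRun P t (z.act a) (advance a.inputMove y) → AcceptingRun P (t + 1) z y

theorem SuffixAt.inputAt_headSym {w y : List B} {i : ℕ} (h : SuffixAt w i y) :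
    inputAt w i = headSym y := by
  cases y with
  | nil => exact h.inputAt_nil
  | cons c y => exact h.inputAt_eq

theorem SuffixAt.advance {w y : List B} {i : ℕ} (h : SuffixAt w i y) {m : HeadMove}
    (hm : m ≠ HeadMove.left) : SuffixAt w (m.moveInput w.length i) (advance m y) := by
  cases m with
  | left => exact absurd rfl hm
  | stay => exact h
  | right =>
    have h1 := h.le
    cases y with
    | nil =>
      rw [HeadMove.moveInput, min_eq_right (by simp at h1; omega)]
      simp only [List.length_nil, Nat.add_zero] at h1
      rw [h1] at h
      exact h
    | cons c y =>
      rw [HeadMove.moveInput, min_eq_left (by simp at h1; omega)]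
      exact h.cons

theorem Zip.Represents.scanned_eq {z : Zip M} {c : M.Cfg} (h : z.Represents c) :
    c.tape c.workPos = z.scanned := by
  obtain ⟨-, -, h1, h2⟩ := h
  rw [h2, h1]
  simp [List.getD_eq_getElem?_getD]

/-- A head that never moves left sees nothing but the suffix of the input in front of it, so the
suffix together with the split configuration determines the possible continuations. -/
theorem AcceptingRun.mem_language (hM : M.OneWay) {P : Zip M → Prop} {w : List B} {t : ℕ}
    {z : Zip M} {y : List B} (h : AcceptingRun P t z y) {t₀ : ℕ} {c : M.Cfg}
    (hc : M.ReachesIn w t₀ c) (hz : z.Represents c) (hy : SuffixAt w c.inputPos y) :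
    w ∈ M.language := by
  induction h generalizing t₀ c with
  | done h => exact ⟨t₀, c, hc, by rwa [hz.1]⟩
  | @step t z y a ha _ _ ih =>
    refine ih (AuxPDA.ReachesIn.succ hc ⟨a, ?_, rfl⟩) (hz.act w.length a)
      (hy.advance (hM _ _ _ _ _ ha))
    rwa [hz.1, hy.inputAt_headSym, hz.scanned_eq, hz.2.1]

/-- Computations grow at their end, accepting runs at their beginning. The last clause bridges this
by prepending the computation so far to any run that continues it. A step raises the store by at
most one, so its height is bounded by the time. -/
theorem exists_acceptingRun (hM : M.OneWay) {w : List B} {C T : ℕ}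
    (hC : ∀ t c, M.ReachesIn w t c → c.workPos < C) (hT : ∀ t c, M.ReachesIn w t c → t ≤ T)
    {t : ℕ} {c : M.Cfg} (h : M.ReachesIn w t c) :
    ∃ z y, z.Represents c ∧ SuffixAt w c.inputPos y ∧ z.size < C ∧ z.stack.length ≤ t ∧
      ∀ t', AcceptingRun (fun z => z.size < C ∧ z.stack.length ≤ T) t' z y →
        AcceptingRun (fun z => z.size < C ∧ z.stack.length ≤ T) (t + t') (Zip.init M) w := by
  induction h with
  | zero => exact ⟨Zip.init M, w, Zip.represents_init, ⟨[], rfl, rfl⟩,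
      hC _ _ AuxPDA.ReachesIn.zero, le_rfl, fun t' h => by rwa [Nat.zero_add]⟩
  | @succ t c c' hc hcc' ih =>
    obtain ⟨z, y, h1, h2, h3, h3', h4⟩ := ih
    have h5 := hC _ _ (hc.succ hcc')
    have h5' := hT _ _ (hc.succ hcc')
    obtain ⟨a, ha, rfl⟩ := hcc'
    have h6 := h1.act w.length a
    have h7 : (z.act a).size < C := (z.size_act a).trans_lt (max_lt h3 (by rwa [← h6.2.2.1]))
    have h7' : (z.act a).stack.length ≤ t + 1 := by
      simp only [Zip.act]
      cases a.stackOp <;> simp [StackOp.apply] <;> omega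
    rw [h1.1, h2.inputAt_headSym, h1.scanned_eq, h1.2.1] at ha
    refine ⟨z.act a, _, h6, h2.advance (hM _ _ _ _ _ ha), h7, h7', fun t' h => ?_⟩
    have h8 := h4 _ (AcceptingRun.step ha ⟨h7, h7'.trans h5'⟩ h)
    rwa [show t + 1 + t' = t + (t' + 1) by omega]

/-- Acceptance in terms of runs on split configurations. -/
theorem exists_acceptingRun_of_mem_language (hM : M.OneWay) {w : List B} {C T : ℕ}
    (hC : ∀ t c, M.ReachesIn w t c → c.workPos < C) (hT : ∀ t c, M.ReachesIn w t c → t ≤ T)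
    (h : w ∈ M.language) : ∃ t ≤ T,
      AcceptingRun (fun z => z.size < C ∧ z.stack.length ≤ T) t (Zip.init M) w := by
  obtain ⟨t, c, h1, h2⟩ := h
  obtain ⟨z, y, h3, -, -, -, h4⟩ := exists_acceptingRun hM hC hT h1
  exact ⟨t, hT _ _ h1, h4 0 (AcceptingRun.done (by rwa [← h3.1]))⟩

end Machine

/-! ### Reading the words accepted by an automaton -/

section Pointer

variable {A B : Type*} (h : A → List B) (N : ℕ) (s : List (NFASym A))

/-- The pointer `(i, j)` shows the symbol `x`: it points to the `j`-th letter of the image of the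
letter at position `i`, or to the end of the word if `i = 0`. -/
def Shows (i j : ℕ) (x : InputSym B) : Prop :=
  (i = 0 ∧ x = InputSym.rightEnd) ∨
    ∃ a c, inputAt s i = InputSym.letter (NFASym.letter a) ∧ (h a)[j]? = some c ∧
      x = InputSym.letter c

/-- A symbol behind which the name of a state starts at which a transition ended. -/
def IsSep (x : InputSym (NFASym A)) : Prop := IsComma x ∨ IsBar x

/-- A pointer at the end of the word of a transition can move to the word of a following
transition, or to the end. -/
def Jump (i i' : ℕ) : Prop :=
  (i' = 0 ∧ ∃ m < N, NameAt (Role.final true) s m ∧ SameName N s (i + 1) m) ∨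
    ∃ m < N, (NameAt (Role.source true) s m ∧ SameName N s (i + 1) m) ∧
      ∃ a < N, ((∀ o < a, IsBit (inputAt s (m + o))) ∧ IsComma (inputAt s (m + a))) ∧
        i' = m + a + 1

/-- Movements of the pointer which do not read a letter. -/
def Silent (i j i' j' : ℕ) : Prop :=
  ((∃ a, inputAt s i = InputSym.letter (NFASym.letter a) ∧ j = (h a).length) ∧ i' = i + 1 ∧
    j' = 0) ∨ (IsSep (inputAt s i) ∧ j = 0 ∧ j' = 0) ∧ Jump N s i i'

/-- The word `y` can be read in `n` steps from the pointer `(i, j)`. -/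
inductive CanRead : ℕ → ℕ → ℕ → List B → Prop
  | done : CanRead 0 0 0 []
  | read {n i j : ℕ} {c : B} {y : List B} : Shows h s i j (InputSym.letter c) →
      CanRead n i (j + 1) y → CanRead (n + 1) i j (c :: y)
  | silent {n i j i' j' : ℕ} {y : List B} : Silent h N s i j i' j' → CanRead n i' j' y →
      CanRead (n + 1) i j y

variable {h N s}

theorem Shows.inj {i j : ℕ} {x x' : InputSym B} (hx : Shows h s i j x) (hx' : Shows h s i j x') :
    x = x' := by
  rcases hx with ⟨rfl, rfl⟩ | ⟨a, c, h1, h2, rfl⟩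
  · rcases hx' with ⟨-, rfl⟩ | ⟨a, c, h1, -⟩
    · rfl
    · simp [inputAt] at h1
  · rcases hx' with ⟨rfl, -⟩ | ⟨a', c', h1', h2', rfl⟩
    · simp [inputAt] at h1
    · rw [h1] at h1'
      simp only [InputSym.letter.injEq, NFASym.letter.injEq] at h1'
      subst h1'
      rw [h2] at h2'
      simpa using h2'

theorem Shows.not_silent {i j : ℕ} {x : InputSym B} (hx : Shows h s i j x) {i' j' : ℕ} :
    ¬ Silent h N s i j i' j' := by
  rintro (⟨⟨a, h1, rfl⟩, -⟩ | ⟨⟨h1 | h1, -⟩, -⟩) <;>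
    rcases hx with ⟨rfl, rfl⟩ | ⟨a', c', h2, h3, -⟩ <;>
    simp_all [inputAt, IsComma, IsBar]

/-- A pointer that shows a symbol has no silent move, and the symbol shown is unique. Every word
readable from there begins with it, or is empty if the symbol is the end marker. -/
theorem CanRead.headSym_eq {n i j : ℕ} {y : List B} (hy : CanRead h N s n i j y) {x : InputSym B}
    (hx : Shows h s i j x) : headSym y = x := by
  cases hy with
  | done => exact Shows.inj (Or.inl ⟨rfl, rfl⟩) hx
  | read h1 _ => exact h1.inj hx
  | silent h1 _ => exact absurd h1 hx.not_silent

theorem CanRead.eq_nil {n j : ℕ} {y : List B} (hy : CanRead h N s n 0 j y) : y = [] := by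
  have := hy.headSym_eq (Or.inl ⟨rfl, rfl⟩)
  cases y with
  | nil => rfl
  | cons c y => simp [headSym] at this

theorem CanRead.length_le {n i j : ℕ} {y : List B} (hy : CanRead h N s n i j y) :
    y.length ≤ n := by
  induction hy with
  | done => simp
  | read _ _ ih => simpa using ih
  | silent _ _ ih => omega

/-- The word `x` is written at position `i`, followed by the name of the state `r`. -/
def WordAt (s : List (NFASym A)) (i : ℕ) (x : List A) (r : List Bool) : Prop :=
  ∃ c v, SuffixAt s i (x.map NFASym.letter ++ c :: v) ∧ (c = NFASym.comma ∨ c = NFASym.bar) ∧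
    HasName s (i + x.length + 1) r

theorem WordAt.cons {i : ℕ} {a : A} {x : List A} {r : List Bool} (hx : WordAt s i (a :: x) r) :
    inputAt s i = InputSym.letter (NFASym.letter a) ∧ WordAt s (i + 1) x r := by
  obtain ⟨c, v, h1, h2, h3⟩ := hx
  refine ⟨SuffixAt.inputAt_eq h1, c, v, SuffixAt.cons h1, h2, ?_⟩
  rwa [show i + 1 + x.length + 1 = i + (a :: x).length + 1 by simp; omega]

theorem WordAt.nil {i : ℕ} {r : List Bool} (hx : WordAt s i [] r) :
    IsSep (inputAt s i) ∧ HasName s (i + 1) r := by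
  obtain ⟨c, v, h1, rfl | rfl, h3⟩ := hx
  · exact ⟨Or.inl h1.inputAt_eq, h3⟩
  · exact ⟨Or.inr h1.inputAt_eq, h3⟩

theorem TransAt.wordAt {i : ℕ} {t : List Bool × List A × List Bool} (ht : TransAt s i t) :
    WordAt s (i + t.1.length + 1) t.2.1 t.2.2 := by
  obtain ⟨v, h1⟩ := ht.suffixAt
  have h2 := h1.append.cons
  rw [length_bits] at h2
  exact ⟨_, _, h2, Or.inl rfl, ht.hasName_target⟩

variable {st : List (List Bool)} {p : List Bool} {f : List (List Bool)}
  {tr : List (List Bool × List A × List Bool)}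

/-- Soundness of the pointer. From inside the word of a transition it spells what is left of the
image of that word, and each jump selects a transition from the current state or stops in a final
state. -/
theorem CanRead.exists_accepts (hs : s = codeOf st p f tr) (hN : s.length < N) {n i j : ℕ}
    {y : List B} (hy : CanRead h N s n i j y) {x : List A} {r : List Bool}
    (hx : WordAt s i x r) : ∃ k z, Accepts tr f k r z ∧
      y = (x.flatMap h).drop j ++ z.flatMap h := by
  induction hy generalizing x r with
  | done =>
    -- No word starts at position 0; the pointer value 0 is reserved for the end of reading.
    obtain ⟨c, v, ⟨u, -, h1⟩, -⟩ := hx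
    omega
  | @read n i j c y h1 _ ih =>
    cases x with
    | nil =>
      exfalso
      have h2 := hx.nil.1
      rcases h1 with ⟨rfl, h1⟩ | ⟨a, c', h1, -⟩
      · simp at h1
      · rcases h2 with h2 | h2 <;> simp [IsComma, IsBar, h1] at h2
    | cons a x =>
      obtain ⟨k, z, h2, rfl⟩ := ih hx
      refine ⟨k, z, h2, ?_⟩
      rcases h1 with ⟨rfl, h1⟩ | ⟨a', c', h1, h3, h4⟩
      · simp at h1
      · rw [hx.cons.1] at h1
        simp only [InputSym.letter.injEq, NFASym.letter.injEq] at h1 h4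
        subst h1 h4
        obtain ⟨h5, h6⟩ := List.getElem?_eq_some_iff.1 h3
        have h7 : j < ((a :: x).flatMap h).length := by simp; omega
        rw [List.drop_eq_getElem_cons h7, List.cons_append]
        congr 1
        simp only [List.flatMap_cons]
        rw [List.getElem_append_left h5, h6]
  | @silent n i j i' j' y h1 _ ih =>
    rcases h1 with ⟨⟨a, h1, rfl⟩, rfl, rfl⟩ | ⟨⟨h1, rfl, rfl⟩, h2⟩
    · cases x with
      | nil =>
        have h2 := hx.nil.1
        rcases h2 with h2 | h2 <;> simp [IsComma, IsBar, h1] at h2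
      | cons a' x =>
        obtain ⟨h3, h4⟩ := hx.cons
        rw [h1] at h3
        simp only [InputSym.letter.injEq, NFASym.letter.injEq] at h3
        subst h3
        obtain ⟨k, z, h2, rfl⟩ := ih h4
        exact ⟨k, z, h2, by simp⟩
    · cases x with
      | cons a' x =>
        have h3 := hx.cons.1
        rcases h1 with h1 | h1 <;> rw [h3] at h1 <;> simp [IsComma, IsBar] at h1
      | nil =>
        have hname := hx.nil.2
        rcases h2 with ⟨rfl, m, -, h3, h4⟩ | ⟨m, -, ⟨h3, h4⟩, a, -, h5, rfl⟩
        · obtain ⟨q, hq, h5⟩ := exists_hasName_final hs h3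
          obtain rfl := (sameName_iff hN hname h5).1 h4
          refine ⟨0, [], Accepts.final hq, ?_⟩
          have := CanRead.eq_nil ‹CanRead h N s n 0 0 y›
          simp [this]
        · obtain ⟨t, ht, h6⟩ := exists_transAt hs h3
          obtain rfl := (sameName_iff hN hname h6.hasName).1 h4
          obtain rfl := h6.block_bits.1 h5
          obtain ⟨k, z, h7, rfl⟩ := ih h6.wordAt
          exact ⟨k + 1, t.2.1 ++ z, Accepts.step ht h7, by simp⟩

theorem exists_canRead_letter {H : ℕ} {i : ℕ} {a : A}
    (hH : ∀ a, (h a).length ≤ H) (ha : inputAt s i = InputSym.letter (NFASym.letter a)) {n : ℕ}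
    {y : List B} (hy : CanRead h N s n (i + 1) 0 y) :
    ∃ m ≤ n + (H + 1), CanRead h N s m i 0 (h a ++ y) := by
  -- The reading is built from the end of the image, where a silent move passes to the next
  -- position; `d` is the number of letters still to be read.
  have key : ∀ d ≤ (h a).length,
      CanRead h N s (n + 1 + d) i ((h a).length - d) ((h a).drop ((h a).length - d) ++ y) := by
    intro d
    induction d with
    | zero =>
      intro _
      simpa using CanRead.silent (Or.inl ⟨⟨a, ha, rfl⟩, rfl, rfl⟩) hy
    | succ d ih =>
      intro hd
      have h1 := ih (by omega)
      have h2 : (h a).length - d = (h a).length - (d + 1) + 1 := by omega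
      have h3 : (h a).length - (d + 1) < (h a).length := by omega
      rw [List.drop_eq_getElem_cons h3, ← h2]
      refine CanRead.read (Or.inr ⟨a, _, ha, List.getElem?_eq_getElem h3, rfl⟩) ?_
      rw [← h2]
      exact h1
  refine ⟨n + 1 + (h a).length, by have := hH a; omega, ?_⟩
  simpa using key _ le_rfl

theorem exists_canRead_word {H : ℕ} (hH : ∀ a, (h a).length ≤ H) {i : ℕ} {x : List A}
    {r : List Bool} (hx : WordAt s i x r) {n : ℕ} {y : List B}
    (hy : CanRead h N s n (i + x.length) 0 y) :
    ∃ m ≤ n + x.length * (H + 1), CanRead h N s m i 0 (x.flatMap h ++ y) := by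
  induction x generalizing i with
  | nil => exact ⟨n, by simp, by simpa using hy⟩
  | cons a x ih =>
    obtain ⟨h1, h2⟩ := hx.cons
    obtain ⟨m, hm, h3⟩ := ih h2 (by
      rwa [show i + 1 + x.length = i + (a :: x).length by simp; omega])
    obtain ⟨m', hm', h4⟩ := exists_canRead_letter hH h1 h3
    refine ⟨m', ?_, by simpa using h4⟩
    rw [List.length_cons, Nat.succ_mul]
    omega

theorem WordAt.end {i : ℕ} {x : List A} {r : List Bool} (hx : WordAt s i x r) :
    WordAt s (i + x.length) [] r := by
  induction x generalizing i with
  | nil => simpa using hx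
  | cons a x ih =>
    have := ih hx.cons.2
    rwa [show i + 1 + x.length = i + (a :: x).length by simp; omega] at this

/-- Completeness of the pointer. A letter costs at most `H + 1` moves and a transition one further
jump; the word of a transition is shorter than the code, which gives the summand `s.length + 1` per
transition. -/
theorem Accepts.exists_canRead (hs : s = codeOf st p f tr) (hN : s.length < N) {H : ℕ}
    (hH : ∀ a, (h a).length ≤ H) {k : ℕ} {r : List Bool} {z : List A} (hz : Accepts tr f k r z)
    {i : ℕ} {x : List A} (hx : WordAt s i x r) :
    ∃ n ≤ (x.length + 1 + k * (s.length + 1)) * (H + 1),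
      CanRead h N s n i 0 (x.flatMap h ++ z.flatMap h) := by
  induction hz generalizing i x with
  | @final r hr =>
    obtain ⟨m, h1, h2⟩ := exists_nameAt_final hs hr
    have h3 : CanRead h N s 1 (i + x.length) 0 [] := by
      refine CanRead.silent (Or.inr ⟨⟨hx.end.nil.1, rfl, rfl⟩, Or.inl ⟨rfl, m, ?_, h1, ?_⟩⟩)
        CanRead.done
      · have := h1.le
        omega
      · exact (sameName_iff hN hx.end.nil.2 h2).2 rfl
    obtain ⟨n, hn, h4⟩ := exists_canRead_word hH hx h3
    exact ⟨n, hn.trans (by nlinarith), by simpa using h4⟩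
  | @step k r r' x' z ht _ ih =>
    obtain ⟨m, h1⟩ := exists_transAt_of_mem hs ht
    have h2 := h1.le
    simp only at h2
    obtain ⟨n, hn, h3⟩ := ih h1.wordAt
    simp only at hn h3
    have h4 : CanRead h N s (n + 1) (i + x.length) 0 (x'.flatMap h ++ z.flatMap h) := by
      refine CanRead.silent (Or.inr ⟨⟨hx.end.nil.1, rfl, rfl⟩, Or.inr ⟨m, by omega,
        ⟨h1.1, ?_⟩, r.length, by omega, h1.block_bits.2 rfl, rfl⟩⟩) h3
      exact (sameName_iff hN hx.end.nil.2 h1.hasName).2 rfl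
    obtain ⟨n', hn', h5⟩ := exists_canRead_word hH hx h4
    refine ⟨n', hn'.trans ?_, by simpa using h5⟩
    have h6 : (x'.length + 1 + k * (s.length + 1)) * (H + 1) ≤
        ((s.length + 1) + k * (s.length + 1)) * (H + 1) := by
      gcongr
      omega
    nlinarith

end Pointer

/-! ### Joint runs of a machine and an automaton -/

section Simulation

variable {A B : Type*} {M : AuxPDA B} (h : A → List B) (N : ℕ) (s : List (NFASym A))

/-- The number of letters that are read by a movement of the head. -/
def readCount : HeadMove → InputSym B → ℕ
  | HeadMove.right, InputSym.letter _ => 1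
  | _, _ => 0

/-- The steps of the joint simulation. -/
inductive SimStep : ℕ × ℕ × Zip M → ℕ × ℕ × Zip M → Prop
  | silent {i j i' j' : ℕ} {z : Zip M} : Silent h N s i j i' j' → SimStep (i, j, z) (i', j', z)
  | skip {i j : ℕ} {z : Zip M} {c : B} : z.state ∈ M.accept → Shows h s i j (InputSym.letter c) →
      SimStep (i, j, z) (i, j + 1, z)
  | act {i j : ℕ} {z : Zip M} {x : InputSym B} {a : AuxPDAAction M.State M.Work M.Stack} :
      Shows h s i j x → a ∈ M.step z.state x z.scanned z.stack.head? →
      SimStep (i, j, z) (i, j + readCount a.inputMove x, z.act a)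

/-- The runs of the joint simulation to the end of the word and an accepting state. -/
inductive SimRun (P : ℕ × ℕ × Zip M → Prop) : ℕ → ℕ × ℕ × Zip M → Prop
  | done {z : Zip M} : z.state ∈ M.accept → SimRun P 0 (0, 0, z)
  | step {n : ℕ} {c c' : ℕ × ℕ × Zip M} : SimStep h N s c c' → P c' → SimRun P n c' →
      SimRun P (n + 1) c

variable {h N s}

theorem SimRun.mono {P P' : ℕ × ℕ × Zip M → Prop} (hP : ∀ c, P c → P' c) {n : ℕ}
    {c : ℕ × ℕ × Zip M} (hc : SimRun h N s P n c) : SimRun h N s P' n c := by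
  induction hc with
  | done hz => exact SimRun.done hz
  | step h1 h2 _ ih => exact SimRun.step h1 (hP _ h2) ih

/-- The word is reconstructed from the end of the joint run, together with a path that spells it and
a run of the machine on it. Letters passed after acceptance impose no condition on the machine,
which accepts without having to reach the end of its input. -/
theorem SimRun.exists_canRead {P : ℕ × ℕ × Zip M → Prop} {n : ℕ} {c : ℕ × ℕ × Zip M}
    (hc : SimRun h N s P n c) : ∃ m y t, CanRead h N s m c.1 c.2.1 y ∧
      AcceptingRun (fun _ => True) t c.2.2 y := by
  induction hc with
  | done hz => exact ⟨0, [], 0, CanRead.done, AcceptingRun.done hz⟩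
  | step h1 _ _ ih =>
    obtain ⟨m, y, t, h2, h3⟩ := ih
    cases h1 with
    | silent h1 => exact ⟨m + 1, y, t, CanRead.silent h1 h2, h3⟩
    | skip hz h1 => exact ⟨m + 1, _, 0, CanRead.read h1 h2, AcceptingRun.done hz⟩
    | @act i j z x a h1 ha =>
      have hstay : readCount a.inputMove x = 0 → advance a.inputMove y = y →
          ∃ m y t, CanRead h N s m i j y ∧ AcceptingRun (fun _ => True) t z y := by
        intro h4 h5
        simp only [h4, Nat.add_zero] at h2
        refine ⟨m, y, t + 1, h2, AcceptingRun.step (a := a) ?_ trivial (by rwa [h5])⟩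
        rwa [h2.headSym_eq h1]
      cases hm : a.inputMove with
      | stay => exact hstay (by simp [hm, readCount]) (by simp [hm, advance])
      | left => exact hstay (by simp [hm, readCount]) (by simp [hm, advance])
      | right =>
        cases x with
        | letter c =>
          simp only [hm, readCount] at h2
          refine ⟨m + 1, c :: y, t + 1, CanRead.read h1 h2, AcceptingRun.step (a := a) ha trivial ?_⟩
          rwa [hm]
        | leftEnd => rcases h1 with ⟨-, h1⟩ | ⟨_, _, _, _, h1⟩ <;> cases h1
        -- Only the pointer 0 shows the end marker. The remaining word is then empty, and moving
        -- right changes nothing.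
        | rightEnd =>
          refine hstay (by simp [hm, readCount]) ?_
          rcases h1 with ⟨rfl, -⟩ | ⟨_, _, _, _, h1⟩
          · rw [h2.eq_nil]
            simp [hm, advance]
          · cases h1

/-- Two sequences of moves are interleaved, those of the machine and those of the pointer. Silent
moves come first, a machine step to the right over a letter is merged with the reading of that
letter, and after acceptance the rest of the word is skipped. Hence at most `n + t` joint steps are
needed. -/
theorem exists_simRun {P : Zip M → Prop} {H : ℕ} (hH : ∀ a, (h a).length ≤ H) {t : ℕ} {z : Zip M}
    {y : List B} (hz : AcceptingRun P t z y) {n i j : ℕ} (hy : CanRead h N s n i j y) (hP : P z) :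
    ∃ m ≤ n + t, SimRun h N s (fun c => c.1 ≤ s.length + 1 ∧ c.2.1 ≤ H ∧ P c.2.2) m (i, j, z) := by
  have hsilent : ∀ {i j i' j'}, Silent h N s i j i' j' → i' ≤ s.length + 1 ∧ j' ≤ H := by
    rintro i j i' j' (⟨⟨a, h1, -⟩, rfl, rfl⟩ | ⟨⟨-, -, rfl⟩, ⟨rfl, -⟩ | ⟨m, -, -, a, -, h1, rfl⟩⟩)
    · exact ⟨by have := le_length_of_inputAt h1; omega, by omega⟩
    · exact ⟨by omega, by omega⟩
    · exact ⟨by have := le_length_of_inputAt h1.2; omega, by omega⟩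
  have hread : ∀ {i j c}, Shows h s i j (InputSym.letter c) → i ≤ s.length + 1 ∧ j + 1 ≤ H := by
    rintro i j c (⟨-, h1⟩ | ⟨a, c', h1, h2, -⟩)
    · cases h1
    · have h3 := le_length_of_inputAt h1
      have h4 := (List.getElem?_eq_some_iff.1 h2).1
      have h5 := hH a
      exact ⟨by omega, by omega⟩
  induction hz generalizing n i j with
  | done hz =>
    induction hy with
    | done => exact ⟨0, by omega, SimRun.done hz⟩
    | read h1 _ ih =>
      obtain ⟨m, hm, h2⟩ := ih
      exact ⟨m + 1, by omega, SimRun.step (SimStep.skip hz h1) ⟨(hread h1).1, (hread h1).2, hP⟩ h2⟩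
    | silent h1 _ ih =>
      obtain ⟨m, hm, h2⟩ := ih
      exact ⟨m + 1, by omega, SimRun.step (SimStep.silent h1)
        ⟨(hsilent h1).1, (hsilent h1).2, hP⟩ h2⟩
  | @step t z y a ha hPa hrun ih =>
    -- The steps of the machine that read nothing: the pointer keeps its place while the machine run
    -- becomes shorter.
    have hstay : ∀ {n i j x}, CanRead h N s n i j y → Shows h s i j x → headSym y = x →
        readCount a.inputMove x = 0 → advance a.inputMove y = y → i ≤ s.length + 1 → j ≤ H →
        ∃ m ≤ n + (t + 1), SimRun h N s (fun c => c.1 ≤ s.length + 1 ∧ c.2.1 ≤ H ∧ P c.2.2) m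
          (i, j, z) := by
      intro n i j x h1 h2 h3 h4 h5 h6 h7
      rw [h5] at ih
      obtain ⟨m, hm, h8⟩ := ih h1 hPa
      rw [h3] at ha
      have h9 : SimStep h N s (i, j, z) (i, j + readCount a.inputMove x, z.act a) :=
        SimStep.act h2 ha
      rw [h4] at h9
      exact ⟨m + 1, by omega, SimRun.step h9 ⟨h6, h7, hPa⟩ h8⟩
    induction hy with
    | done =>
      refine hstay CanRead.done (Or.inl ⟨rfl, rfl⟩) rfl ?_ ?_ (by omega) (by omega)
      · cases a.inputMove <;> rfl
      · cases a.inputMove <;> rfl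
    | silent h1 _ ih' =>
      obtain ⟨m, hm, h2⟩ := ih' ha hrun ih hstay
      exact ⟨m + 1, by omega, SimRun.step (SimStep.silent h1)
        ⟨(hsilent h1).1, (hsilent h1).2, hP⟩ h2⟩
    | @read n i j c y h1 h2 _ =>
      have h3 := hread h1
      cases hm : a.inputMove with
      | stay =>
        exact hstay (CanRead.read h1 h2) h1 rfl (by simp [hm, readCount])
          (by simp [hm, advance]) h3.1 (by omega)
      | left =>
        exact hstay (CanRead.read h1 h2) h1 rfl (by simp [hm, readCount])
          (by simp [hm, advance]) h3.1 (by omega)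
      | right =>
        rw [hm] at ih
        obtain ⟨m, hm', h4⟩ := ih h2 hPa
        have h5 : SimStep h N s (i, j, z) (i, j + readCount a.inputMove (InputSym.letter c),
          z.act a) := SimStep.act h1 ha
        rw [hm] at h5
        exact ⟨m + 1, by omega, SimRun.step h5 ⟨h3.1, h3.2, hPa⟩ h4⟩

end Simulation

/-! ### Stack programs for joint runs -/

section Combinators

variable {α : Type u} {N : List α → ℕ}

namespace Programmable

variable {R : List α → (ℕ → ℕ) → List ℕ → List ℕ → Prop}

theorem exMany (k : ℕ) (hR : Programmable N R) : Programmable N fun w e σ τ =>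
    ∃ f : ℕ → ℕ, (∀ i < k, f i < N w) ∧ (∀ i, f (i + k) = e i) ∧ R w f σ τ := by
  induction k generalizing R with
  | zero =>
    refine hR.congr fun w e σ τ => ⟨fun h => ⟨e, by simp, by simp, h⟩, ?_⟩
    rintro ⟨f, -, h1, h2⟩
    obtain rfl : f = e := funext h1
    exact h2
  | succ k ih =>
    have h1 : Programmable N fun w e σ τ => ∃ x < N w, R w (consEnv x e) σ τ := by
      refine Programmable.ex (R := fun w e x => R w (consEnv x e)) (hR.congr fun w e σ τ => ?_)
      rw [show consEnv (e 0) (fun i => e (i + 1)) = e by funext i; cases i <;> rfl]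
    refine (ih h1).congr fun w e σ τ => ?_
    constructor
    · rintro ⟨f, h2, h3, x, hx, h4⟩
      refine ⟨consEnv x f, ?_, h3, h4⟩
      rintro (_ | i) hi
      · exact hx
      · exact h2 i (by omega)
    · rintro ⟨f, h2, h3, h4⟩
      refine ⟨fun i => f (i + 1), fun i hi => h2 _ (by omega), fun i => h3 i, f 0, h2 0 (by omega),
        ?_⟩
      rwa [show consEnv (f 0) (fun i => f (i + 1)) = f by funext i; cases i <;> rfl]

/-- Replacing the five topmost numbers. -/
theorem frame {φ : List α → (ℕ → ℕ) → Prop} (hφ : Tst N φ) {Q : List ℕ → List ℕ → Prop}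
    (hQ : Programmable N fun _ _ => Q) : Programmable N fun w e σ τ =>
    ∃ f : ℕ → ℕ, (∀ i < 10, f i < N w) ∧ (∀ i, f (i + 10) = e i) ∧ φ w f ∧ ∃ ρ ρ', Q ρ ρ' ∧
      σ = f 0 :: f 1 :: f 2 :: f 3 :: f 4 :: ρ ∧ τ = f 5 :: f 6 :: f 7 :: f 8 :: f 9 :: ρ' := by
  refine exMany 10 (((pop (N := N) fun _ e => e 0).seq <| (pop fun _ e => e 1).seq <|
    (pop fun _ e => e 2).seq <| (pop fun _ e => e 3).seq <| (pop fun _ e => e 4).seq <|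
    Programmable.seq hφ <| hQ.seq <| (push fun _ e => e 9).seq <| (push fun _ e => e 8).seq <|
    (push fun _ e => e 7).seq <| (push fun _ e => e 6).seq <| push fun _ e => e 5).congr
    fun w f σ τ => ?_)
  constructor
  · rintro ⟨_, rfl, _, rfl, _, rfl, _, rfl, ρ, rfl, _, ⟨rfl, h⟩, ρ', h', _, rfl, _, rfl, _, rfl, _,
      rfl, rfl⟩
    exact ⟨h, ρ, ρ', h', rfl, rfl⟩
  · rintro ⟨h, ρ, ρ', h', rfl, rfl⟩
    exact ⟨_, rfl, _, rfl, _, rfl, _, rfl, _, rfl, _, ⟨rfl, h⟩, _, h', _, rfl, _, rfl, _, rfl, _,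
      rfl, rfl⟩

/-- Replacing the topmost number by several numbers. -/
theorem replaceTop (c : ℕ) (l : List ℕ) : Programmable N fun _ _ σ τ =>
    ∃ ρ, σ = c :: ρ ∧ τ = l ++ ρ := by
  have h1 : Programmable N fun _ _ σ τ => τ = l ++ σ := by
    induction l with
    | nil => exact nil.congr fun _ _ _ _ => eq_comm
    | cons x l ih => exact (ih.seq (push fun _ _ => x)).congr fun _ _ _ _ => by simp
  exact ((pop fun _ _ => c).seq h1).congr fun _ _ _ _ => by simp

end Programmable

theorem Tst.of (P : Prop) : Tst N fun _ _ => P := by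
  by_cases h : P
  · exact Tst.true.congr fun _ _ => by simp [h]
  · exact Tst.false.congr fun _ _ => by simp [h]

theorem Tst.sym (t : List α → (ℕ → ℕ) → ℕ) [Lin t] (P : InputSym α → Prop) :
    Tst N fun w e => P (inputAt w (t w e)) := (Dec.sym t P).1

theorem Tst.ex {φ : List α → (ℕ → ℕ) → ℕ → Prop}
    (h : Tst N fun w e => φ w (fun i => e (i + 1)) (e 0)) : Tst N fun w e => ∃ x < N w, φ w e x :=
  Tst.exB none h

end Combinators

/-! ### Numerical codes of half tapes and of pushdown stores. -/

section Codes

/-- The number that codes the part of a tape on one side of the head. -/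
def tapeCode {W : Type} (b : ℕ) (cW : W → ℕ) : List W → ℕ
  | [] => 0
  | c :: l => b * tapeCode b cW l + (cW c + 1)

theorem tapeCode_lt {W : Type} {b : ℕ} {cW : W → ℕ} (hb : ∀ c, cW c + 1 < b)
    (l : List W) : tapeCode b cW l < b ^ l.length := by
  induction l with
  | nil => simp [tapeCode]
  | cons c l ih =>
    have := hb c
    rw [tapeCode, List.length_cons, pow_succ']
    calc _ < b * tapeCode b cW l + b := by omega
      _ = b * (tapeCode b cW l + 1) := by ring
      _ ≤ _ := Nat.mul_le_mul_left b ih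

variable {W : Type} {b : ℕ} {cW : W → ℕ}

/-- The digits are smaller than the base, so remainder and quotient recover the cell next to the
head and the rest. -/
theorem tapeCode_cons_inj (hb : ∀ c, cW c + 1 < b) (hc : Function.Injective cW) {x y : ℕ} {c d : W}
    (h : b * x + (cW c + 1) = b * y + (cW d + 1)) : x = y ∧ c = d := by
  have h1 : cW c + 1 = cW d + 1 := by
    have := congrArg (· % b) h
    simpa [Nat.mul_add_mod, Nat.mod_eq_of_lt (hb c), Nat.mod_eq_of_lt (hb d)] using this
  have h2 : b * x = b * y := by omega
  exact ⟨Nat.eq_of_mul_eq_mul_left (by have := hb c; omega) h2, hc (by omega)⟩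

/-- The movement of the head in terms of codes. -/
def TapeStep (b : ℕ) (cW : W → ℕ) (blank c d : W) (L R L' R' : ℕ) : HeadMove → Prop
  | HeadMove.stay => d = c ∧ L' = L ∧ R' = R
  | HeadMove.left => ((L = 0 ∧ L' = 0) ∧ d = c ∧ R' = R) ∨
      (L = b * L' + (cW d + 1) ∧ R' = b * R + (cW c + 1))
  | HeadMove.right => ((R = 0 ∧ R' = 0) ∧ d = blank ∧ L' = b * L + (cW c + 1)) ∨
      (R = b * R' + (cW d + 1) ∧ L' = b * L + (cW c + 1))

/-- Taking a cell off a half tape is a division, certified by guessing quotient and digit and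
testing a linear equation. Digits are at least 1, so the code 0 belongs to the empty half tape only.
-/
theorem tapeStep_iff (hb : ∀ c, cW c + 1 < b) (hc : Function.Injective cW) {blank c d : W}
    {l r : List W} {L' R' : ℕ} {m : HeadMove} :
    TapeStep b cW blank c d (tapeCode b cW l) (tapeCode b cW r) L' R' m ↔
      d = (moveTape blank c l r m).1 ∧ L' = tapeCode b cW (moveTape blank c l r m).2.1 ∧
        R' = tapeCode b cW (moveTape blank c l r m).2.2 := by
  cases m with
  | stay => rfl
  | left =>
    cases l with
    | nil => simp [TapeStep, moveTape, tapeCode]; tauto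
    | cons e l =>
      simp only [TapeStep, moveTape, tapeCode]
      constructor
      · rintro (⟨⟨h, -⟩, -⟩ | ⟨h, rfl⟩)
        · omega
        · obtain ⟨rfl, rfl⟩ := tapeCode_cons_inj hb hc h
          exact ⟨rfl, rfl, rfl⟩
      · rintro ⟨rfl, rfl, rfl⟩
        exact Or.inr ⟨rfl, rfl⟩
  | right =>
    cases r with
    | nil => simp [TapeStep, moveTape, tapeCode]; tauto
    | cons e r =>
      simp only [TapeStep, moveTape, tapeCode]
      constructor
      · rintro (⟨⟨h, -⟩, -⟩ | ⟨h, rfl⟩)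
        · omega
        · obtain ⟨rfl, rfl⟩ := tapeCode_cons_inj hb hc h
          exact ⟨rfl, rfl, rfl⟩
      · rintro ⟨rfl, rfl, rfl⟩
        exact Or.inr ⟨rfl, rfl⟩

theorem Tst.tapeStep {α : Type u} {N : List α → ℕ} (blank c d : W) (L R L' R' : ℕ)
    (m : HeadMove) : Tst N fun _ e => TapeStep b cW blank c d (e L) (e R) (e L') (e R') m := by
  cases m with
  | stay => exact (Tst.of _).and ((Tst.eq (fun _ e => e L') fun _ e => e L).and
      (Tst.eq (fun _ e => e R') fun _ e => e R))
  | left =>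
    refine (((Tst.eq (fun _ e => e L) fun _ _ => 0).and (Tst.eq (fun _ e => e L') fun _ _ => 0)).and
      ((Tst.of _).and (Tst.eq (fun _ e => e R') fun _ e => e R))).or (Tst.and ?_ ?_)
    · exact Tst.eq (fun _ e => e L) fun _ e => b * e L' + (cW d + 1)
    · exact Tst.eq (fun _ e => e R') fun _ e => b * e R + (cW c + 1)
  | right =>
    refine (((Tst.eq (fun _ e => e R) fun _ _ => 0).and (Tst.eq (fun _ e => e R') fun _ _ => 0)).and
      ((Tst.of _).and (Tst.eq (fun _ e => e L') fun _ e => b * e L + (cW c + 1)))).or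
      (Tst.and ?_ ?_)
    · exact Tst.eq (fun _ e => e R) fun _ e => b * e R' + (cW d + 1)
    · exact Tst.eq (fun _ e => e L') fun _ e => b * e L + (cW c + 1)

variable {Γ : Type}

/-- The code of a stack. -/
def storeCode (cG : Γ → ℕ) (S : List Γ) : List ℕ := S.map (fun g => cG g + 1) ++ [0]

/-- The topmost number of the code of a stack. -/
def topCode (cG : Γ → ℕ) : Option Γ → ℕ
  | none => 0
  | some g => cG g + 1

/-- The numbers by which a stack operation replaces the topmost number. -/
def newTop (cG : Γ → ℕ) (x : Option Γ) : StackOp Γ → List ℕ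
  | StackOp.keep => [topCode cG x]
  | StackOp.push g => [cG g + 1, topCode cG x]
  | StackOp.pop => match x with
    | none => [0]
    | some _ => []

/-- The bottom mark 0 differs from the codes of all store symbols, so an empty store can be
recognized, and popping it leaves the mark in place. -/
theorem storeCode_step {cG : Γ → ℕ} (hG : Function.Injective cG) {S : List Γ} {x : Option Γ}
    {op : StackOp Γ} {τ : List ℕ} : (∃ ρ, storeCode cG S = topCode cG x :: ρ ∧
      τ = newTop cG x op ++ ρ) ↔ x = S.head? ∧ τ = storeCode cG (op.apply S) := by
  cases S with
  | nil =>
    cases x with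
    | some g => simp [storeCode, topCode]
    | none => cases op <;> simp [storeCode, topCode, newTop, StackOp.apply]
  | cons d S =>
    cases x with
    | none => simp [storeCode, topCode]
    | some g =>
      cases op <;> simp [storeCode, topCode, newTop, StackOp.apply, hG.eq_iff] <;>
        (constructor <;> (rintro ⟨rfl, rfl⟩; simp))

end Codes

/-! ### Steps of the joint simulation as relations on stacks of numbers. -/

section Simulation

variable {A B : Type u} {M : AuxPDA B} {h : A → List B} {N : List (NFASym A) → ℕ}

open Programmable

instance [Finite B] : Finite (InputSym B) :=
  Finite.of_injective (β := Option (Option B))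
    (fun x => match x with
      | InputSym.leftEnd => none
      | InputSym.rightEnd => some none
      | InputSym.letter c => some (some c))
    (by intro x y h; cases x <;> cases y <;> simp_all)

instance : Finite HeadMove :=
  Finite.of_injective (β := Fin 3)
    (fun x => match x with
      | HeadMove.left => 0
      | HeadMove.stay => 1
      | HeadMove.right => 2)
    (by intro x y h; cases x <;> cases y <;> simp_all)

instance {Γ : Type} [Finite Γ] : Finite (StackOp Γ) :=
  Finite.of_injective (β := Option (Option Γ))
    (fun x => match x with
      | StackOp.keep => none
      | StackOp.pop => some none
      | StackOp.push c => some (some c))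
    (by intro x y h; cases x <;> cases y <;> simp_all)

instance {Q W Γ : Type} [Finite Q] [Finite W] [Finite Γ] : Finite (AuxPDAAction Q W Γ) :=
  Finite.of_injective (β := Q × HeadMove × W × HeadMove × StackOp Γ)
    (fun a => (a.next, a.inputMove, a.write, a.workMove, a.stackOp))
    (by
      rintro ⟨⟩ ⟨⟩ h
      simpa using h)

theorem Tst.shows [Finite A] (h : A → List B) (x : InputSym B) (i j : ℕ) :
    Tst N fun w e => Shows h w (e i) (e j) x := by
  have h1 : Tst N fun w e => ∃ p : Σ a, Fin (h a).length,
      inputAt w (e i) = InputSym.letter (NFASym.letter p.1) ∧ e j = (p.2 : ℕ) ∧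
        x = InputSym.letter (h p.1)[p.2] :=
    Tst.exFinite fun p => (Tst.sym (fun _ e => e i) fun y => y = InputSym.letter
      (NFASym.letter p.1)).and ((Tst.eq (fun _ e => e j) fun _ _ => (p.2 : ℕ)).and (Tst.of _))
  refine (((Tst.eq (fun _ e => e i) fun _ _ => 0).and (Tst.of (x = InputSym.rightEnd))).or
    h1).congr fun w e => or_congr_right ?_
  constructor
  · rintro ⟨⟨a, k⟩, h2, h3, h4⟩
    exact ⟨a, _, h2, by rw [h3]; exact List.getElem?_eq_getElem k.2, h4⟩
  · rintro ⟨a, c, h2, h3, rfl⟩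
    obtain ⟨h4, rfl⟩ := List.getElem?_eq_some_iff.1 h3
    exact ⟨⟨a, ⟨_, h4⟩⟩, h2, rfl, rfl⟩

theorem Tst.jump (i i' : ℕ) : Tst N fun w e => Jump (N w) w (e i) (e i') := by
  refine Tst.or (Tst.and (Tst.eq (fun _ e => e i') fun _ _ => 0) ?_) ?_
  · exact Tst.ex (φ := fun w e m => NameAt (Role.final Bool.true) w m ∧
      SameName (N w) w (e i + 1) m)
      ((Dec.nameAt _ 0).1.and (Dec.sameName (fun _ e => e (i + 1) + 1) fun _ e => e 0).1)
  · refine Tst.ex (φ := fun w e m => (NameAt (Role.source Bool.true) w m ∧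
      SameName (N w) w (e i + 1) m) ∧ ∃ a < N w, ((∀ o < a, IsBit (inputAt w (m + o))) ∧
      IsComma (inputAt w (m + a))) ∧ e i' = m + a + 1)
      (((Dec.nameAt _ 0).1.and (Dec.sameName (fun _ e => e (i + 1) + 1) fun _ e => e 0).1).and ?_)
    refine Tst.ex (φ := fun w e a => ((∀ o < a, IsBit (inputAt w (e 0 + o))) ∧
      IsComma (inputAt w (e 0 + a))) ∧ e (i' + 1) = e 0 + a + 1) (Tst.and (Tst.and ?_ ?_) ?_)
    · exact (Dec.allVar (φ := fun w e o => IsBit (inputAt w (e 1 + o))) 0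
        (Dec.sym (fun _ e => e 2 + e 0) IsBit)).1
    · exact Tst.sym (fun _ e => e 1 + e 0) IsComma
    · exact Tst.eq (fun _ e => e (i' + 1 + 1)) fun _ e => e 1 + e 0 + 1

theorem Tst.silent [Finite A] (h : A → List B) (i j i' j' : ℕ) :
    Tst N fun w e => Silent h (N w) w (e i) (e j) (e i') (e j') := by
  have h1 : Tst N fun w e => ∃ a, inputAt w (e i) = InputSym.letter (NFASym.letter a) ∧
      e j = (h a).length :=
    Tst.exFinite fun a => (Tst.sym (fun _ e => e i) fun y => y = InputSym.letter
      (NFASym.letter a)).and (Tst.eq (fun _ e => e j) fun _ _ => (h a).length)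
  refine (h1.and ((Tst.eq (fun _ e => e i') fun _ e => e i + 1).and
    (Tst.eq (fun _ e => e j') fun _ _ => 0))).or (Tst.and (Tst.and ?_ ?_) (Tst.jump i i'))
  · exact Tst.sym (fun _ e => e i) IsSep
  · exact (Tst.eq (fun _ e => e j) fun _ _ => 0).and (Tst.eq (fun _ e => e j') fun _ _ => 0)

variable (M) in
/-- Numbers for the symbols of a machine. -/
structure Coding where
  base : ℕ
  work : M.Work → ℕ
  work_lt : ∀ c, work c + 1 < base
  work_inj : Function.Injective work
  ctrl : M.State × M.Work → ℕ
  ctrl_inj : Function.Injective ctrl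
  store : M.Stack → ℕ
  store_inj : Function.Injective store

theorem exists_coding (M : AuxPDA B) : Nonempty (Coding M) := by
  have := M.finiteState
  have := M.finiteWork
  have := M.finiteStack
  obtain ⟨n, ⟨f⟩⟩ := Finite.exists_equiv_fin M.Work
  obtain ⟨n', ⟨f'⟩⟩ := Finite.exists_equiv_fin (M.State × M.Work)
  obtain ⟨n'', ⟨f''⟩⟩ := Finite.exists_equiv_fin M.Stack
  exact ⟨⟨n + 1, fun c => f c, fun c => by simp, fun c d hcd => f.injective (Fin.ext hcd),
    fun c => f' c, fun c d hcd => f'.injective (Fin.ext hcd),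
    fun c => f'' c, fun c d hcd => f''.injective (Fin.ext hcd)⟩⟩

namespace Coding

variable (K : Coding M)

/-- The stack of numbers which codes a configuration of the joint simulation. -/
def encode (c : ℕ × ℕ × Zip M) : List ℕ :=
  c.1 :: c.2.1 :: K.ctrl (c.2.2.state, c.2.2.scanned) :: tapeCode K.base K.work c.2.2.left ::
    tapeCode K.base K.work c.2.2.right :: storeCode K.store c.2.2.stack

/-- The topmost five numbers of the code are small. -/
def Bounded (n : ℕ) (c : ℕ × ℕ × Zip M) : Prop :=
  c.1 < n ∧ c.2.1 < n ∧ K.ctrl (c.2.2.state, c.2.2.scanned) < n ∧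
    tapeCode K.base K.work c.2.2.left < n ∧ tapeCode K.base K.work c.2.2.right < n

/-- Some programmable relation acts on codes of configurations as the given relation. -/
def Simulated (N : List (NFASym A) → ℕ)
    (T : List (NFASym A) → ℕ × ℕ × Zip M → ℕ × ℕ × Zip M → Prop) : Prop :=
  ∃ R, Programmable N R ∧
    (∀ w e c τ, R w e (K.encode c) τ → ∃ c', τ = K.encode c' ∧ T w c c') ∧
    ∀ w e c c', K.Bounded (N w) c → K.Bounded (N w) c' → T w c c' →
      R w e (K.encode c) (K.encode c')

variable {K} {T T' : List (NFASym A) → ℕ × ℕ × Zip M → ℕ × ℕ × Zip M → Prop}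

theorem Simulated.congr (hT : K.Simulated N T) (hTT' : ∀ w c c', T w c c' ↔ T' w c c') :
    K.Simulated N T' := by
  obtain rfl : T = T' := by
    funext w c c'
    exact propext (hTT' w c c')
  exact hT

theorem Simulated.or (hT : K.Simulated N T) (hT' : K.Simulated N T') :
    K.Simulated N fun w c c' => T w c c' ∨ T' w c c' := by
  obtain ⟨R, h1, h2, h3⟩ := hT
  obtain ⟨R', h1', h2', h3'⟩ := hT'
  refine ⟨_, h1.or h1', ?_, ?_⟩
  · rintro w e c τ (hR | hR)
    · obtain ⟨c', h4, h5⟩ := h2 w e c τ hR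
      exact ⟨c', h4, Or.inl h5⟩
    · obtain ⟨c', h4, h5⟩ := h2' w e c τ hR
      exact ⟨c', h4, Or.inr h5⟩
  · rintro w e c c' hc hc' (hT | hT)
    · exact Or.inl (h3 w e c c' hc hc' hT)
    · exact Or.inr (h3' w e c c' hc hc' hT)

theorem Simulated.exFinite {ι : Type*} [Finite ι]
    {T : ι → List (NFASym A) → ℕ × ℕ × Zip M → ℕ × ℕ × Zip M → Prop}
    (hT : ∀ i, K.Simulated N (T i)) : K.Simulated N fun w c c' => ∃ i, T i w c c' := by
  choose R h1 h2 h3 using hT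
  refine ⟨_, Programmable.exFinite h1, ?_, ?_⟩
  · rintro w e c τ ⟨i, hR⟩
    obtain ⟨c', h4, h5⟩ := h2 i w e c τ hR
    exact ⟨c', h4, i, h5⟩
  · rintro w e c c' hc hc' ⟨i, hT⟩
    exact ⟨i, h3 i w e c c' hc hc' hT⟩

/-- An environment whose first ten values come from the codes of two configurations. -/
def env (K : Coding M) (c c' : ℕ × ℕ × Zip M) (e : ℕ → ℕ) : ℕ → ℕ :=
  consEnv c.1 <| consEnv c.2.1 <| consEnv (K.ctrl (c.2.2.state, c.2.2.scanned)) <|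
  consEnv (tapeCode K.base K.work c.2.2.left) <| consEnv (tapeCode K.base K.work c.2.2.right) <|
  consEnv c'.1 <| consEnv c'.2.1 <| consEnv (K.ctrl (c'.2.2.state, c'.2.2.scanned)) <|
  consEnv (tapeCode K.base K.work c'.2.2.left) <|
  consEnv (tapeCode K.base K.work c'.2.2.right) e

theorem env_lt {n : ℕ} {c c' : ℕ × ℕ × Zip M} {e : ℕ → ℕ} (hc : K.Bounded n c)
    (hc' : K.Bounded n c') : ∀ i < 10, K.env c c' e i < n := by
  obtain ⟨h0, h1, h2, h3, h4⟩ := hc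
  obtain ⟨h5, h6, h7, h8, h9⟩ := hc'
  intro i hi
  interval_cases i <;> assumption

/-- Steps in which only the pointer moves. -/
theorem simulated_pointer {κ : M.State → Prop} {ψ : List (NFASym A) → ℕ → ℕ → ℕ → ℕ → Prop}
    (hψ : Tst N fun w e => ψ w (e 0) (e 1) (e 5) (e 6)) :
    K.Simulated N fun w c c' => κ c.2.2.state ∧ ψ w c.1 c.2.1 c'.1 c'.2.1 ∧ c'.2.2 = c.2.2 := by
  have := M.finiteState
  have := M.finiteWork
  have h1 : Tst N fun w e => ∃ q : M.State × M.Work, e 2 = K.ctrl q ∧ κ q.1 :=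
    Tst.exFinite fun q => (Tst.eq (fun _ e => e 2) fun _ _ => K.ctrl q).and (Tst.of _)
  have h2 := (Tst.eq (N := N) (fun _ e => e 7) fun _ e => e 2).and
    ((Tst.eq (fun _ e => e 8) fun _ e => e 3).and (Tst.eq (fun _ e => e 9) fun _ e => e 4))
  refine ⟨_, frame (h1.and (hψ.and h2)) nil, ?_, ?_⟩
  · rintro w e ⟨i, j, z⟩ τ ⟨f, -, -, ⟨⟨q, h3, h4⟩, h5, h6, h7, h8⟩, ρ, _, rfl, h9, rfl⟩
    simp only [encode, List.cons.injEq] at h9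
    obtain ⟨rfl, rfl, h10, h11, h12, rfl⟩ := h9
    rw [← h10] at h3
    have h13 := K.ctrl_inj h3
    subst h13
    exact ⟨(f 5, f 6, z), by simp [encode, h6, h7, h8, h10, h11, h12], h4, h5, rfl⟩
  · rintro w e ⟨i, j, z⟩ ⟨i', j', z'⟩ hc hc' ⟨h3, h4, rfl⟩
    exact ⟨K.env (i, j, z') (i', j', z') e, env_lt hc hc', fun _ => rfl,
      ⟨⟨_, rfl, h3⟩, h4, rfl, rfl, rfl⟩, _, _, rfl, rfl, rfl⟩

/-- Steps in which the machine performs a given action. -/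
theorem simulated_act [Finite A] (x : InputSym B) (q : M.State × M.Work) (g : Option M.Stack)
    (a : AuxPDAAction M.State M.Work M.Stack) :
    K.Simulated N fun w c c' => ((q = (c.2.2.state, c.2.2.scanned) ∧ g = c.2.2.stack.head?) ∧
      Shows h w c.1 c.2.1 x ∧ a ∈ M.step q.1 x q.2 g) ∧
      c' = (c.1, c.2.1 + readCount a.inputMove x, c.2.2.act a) := by
  have := M.finiteWork
  have h1 : Tst N fun w e => ∃ d : M.Work, e 7 = K.ctrl (a.next, d) ∧
      TapeStep K.base K.work M.blank a.write d (e 3) (e 4) (e 8) (e 9) a.workMove :=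
    Tst.exFinite fun d => (Tst.eq (fun _ e => e 7) fun _ _ => K.ctrl (a.next, d)).and
      (Tst.tapeStep M.blank a.write d 3 4 8 9 a.workMove)
  have h2 := ((Tst.of (N := N) (a ∈ M.step q.1 x q.2 g)).and
    (Tst.eq (fun _ e => e 2) fun _ _ => K.ctrl q)).and
    ((Tst.shows h x 0 1).and ((Tst.eq (fun _ e => e 5) fun _ e => e 0).and
    ((Tst.eq (fun _ e => e 6) fun _ e => e 1 + readCount a.inputMove x).and h1)))
  refine ⟨_, frame h2 (replaceTop (topCode K.store g) (newTop K.store g a.stackOp)), ?_, ?_⟩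
  · rintro w e ⟨i, j, z⟩ τ ⟨f, -, -, ⟨⟨h3, h4⟩, h5, h6, h7, d, h8, h9⟩, ρ, ρ', h10, h11, rfl⟩
    simp only [encode, List.cons.injEq] at h11
    obtain ⟨rfl, rfl, h12, h13, h14, rfl⟩ := h11
    obtain ⟨rfl, rfl⟩ := (storeCode_step K.store_inj).1 h10
    rw [← h12] at h4
    have h15 := K.ctrl_inj h4
    subst h15
    rw [← h13, ← h14] at h9
    obtain ⟨rfl, h16, h17⟩ := (tapeStep_iff K.work_lt K.work_inj).1 h9
    refine ⟨_, ?_, ⟨⟨rfl, rfl⟩, h5, h3⟩, rfl⟩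
    simp only [encode, h6, h7, h8, h16, h17]
    rfl
  · rintro w e ⟨i, j, z⟩ c' hc hc' ⟨⟨⟨rfl, rfl⟩, h3, h4⟩, rfl⟩
    refine ⟨K.env _ _ e, env_lt hc hc', fun _ => rfl, ⟨⟨h4, rfl⟩, h3, rfl, rfl, _, rfl,
      (tapeStep_iff K.work_lt K.work_inj).2 ⟨rfl, rfl, rfl⟩⟩, _, _,
      (storeCode_step K.store_inj).2 ⟨rfl, rfl⟩, rfl, rfl⟩

/-- For fixed symbol, control state, top of the store and action, a step is a test on ten numbers
together with a change of the topmost store code. Finitely many such combinations are joined by a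
choice. -/
theorem simulated_simStep [Finite A] [Finite B] :
    K.Simulated N fun w c c' => SimStep h (N w) w c c' := by
  have := M.finiteState
  have := M.finiteWork
  have := M.finiteStack
  have h1 := simulated_pointer (K := K) (κ := fun _ => True) (Tst.silent (N := N) h 0 1 5 6)
  have h2 : Tst N fun w e => (∃ c, Shows h w (e 0) (e 1) (InputSym.letter c)) ∧ e 5 = e 0 ∧
      e 6 = e 1 + 1 :=
    (Tst.exFinite fun c => Tst.shows h _ 0 1).and ((Tst.eq (fun _ e => e 5) fun _ e => e 0).and
      (Tst.eq (fun _ e => e 6) fun _ e => e 1 + 1))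
  have h3 := simulated_pointer (K := K) (κ := fun q => q ∈ M.accept)
    (ψ := fun w i j i' j' => (∃ c, Shows h w i j (InputSym.letter c)) ∧ i' = i ∧ j' = j + 1) h2
  have h4 := Simulated.exFinite fun p : InputSym B × (M.State × M.Work) × Option M.Stack ×
    AuxPDAAction M.State M.Work M.Stack =>
      simulated_act (K := K) (N := N) (h := h) p.1 p.2.1 p.2.2.1 p.2.2.2
  refine (h1.or (h3.or h4)).congr ?_
  rintro w ⟨i, j, z⟩ ⟨i', j', z'⟩
  constructor
  · rintro (⟨-, h5, h6⟩ | ⟨h5, ⟨⟨c, h6⟩, h7, h8⟩, h9⟩ | ⟨⟨x, q, g, a⟩, ⟨⟨h5, h6⟩, h7, h8⟩, h9⟩)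
    · simp only at h6
      subst h6
      exact SimStep.silent h5
    · simp only at h7 h8 h9
      subst h7 h8 h9
      exact SimStep.skip h5 h6
    · simp only at h5 h6 h7 h8
      subst h5 h6
      rw [h9]
      exact SimStep.act h7 h8
  · intro hstep
    cases hstep with
    | silent h5 => exact Or.inl ⟨trivial, h5, rfl⟩
    | skip h5 h6 => exact Or.inr (Or.inl ⟨h5, ⟨⟨_, h6⟩, rfl, rfl⟩, rfl⟩)
    | @act i j z x a h5 h6 =>
      exact Or.inr (Or.inr ⟨⟨x, _, _, a⟩, ⟨⟨rfl, rfl⟩, h5, h6⟩, rfl⟩)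

end Coding

end Simulation

/-! ### Complete joint runs, from the initial to an accepting configuration. -/

section Acceptance

variable {A B : Type u} {M : AuxPDA B} {h : A → List B} {N : List (NFASym A) → ℕ}

open Programmable

/-- A loop of optional pops can remove any store whose height is at most the number of passes; the
passes left over are skipped. -/
theorem compDown_clear (cG : ℕ → Prop) (n : ℕ) (σ : List ℕ) (hσ : ∀ x ∈ σ, cG x)
    (hn : σ.length ≤ n) (τ : List ℕ) :
    compDown (fun _ σ τ => σ = τ ∨ ∃ x, cG x ∧ σ = x :: τ) n (σ ++ τ) τ := by
  induction n generalizing σ with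
  | zero =>
    obtain rfl : σ = [] := List.length_eq_zero_iff.1 (by omega)
    rfl
  | succ n ih =>
    cases σ with
    | nil => exact ⟨_, Or.inl rfl, ih [] (by simp) (by simp)⟩
    | cons x σ => exact ⟨_, Or.inr ⟨x, hσ x (by simp), rfl⟩, ih σ (fun y hy => hσ y (by simp [hy]))
        (by simpa using hn)⟩

namespace Coding

variable (K : Coding M)

/-- Acceptance concerns only the pointer and the state. Half tapes and store are discarded because
the stack program has to end with the empty stack. -/
theorem exists_finish (N : List (NFASym A) → ℕ) : ∃ R, Programmable N R ∧
    (∀ w e c, R w e (K.encode c) [] → ∃ z, c = (0, 0, z) ∧ z.state ∈ M.accept) ∧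
    ∀ w e z, K.Bounded (N w) (0, 0, z) → z.stack.length ≤ N w → z.state ∈ M.accept →
      R w e (K.encode (0, 0, z)) [] := by
  have := M.finiteState
  have := M.finiteWork
  have := M.finiteStack
  have h1 : Programmable N fun _ _ σ τ => ∃ x, (∃ g, x = K.store g + 1) ∧ σ = x :: τ :=
    (Programmable.exFinite fun g : M.Stack => pop (N := N) fun _ _ => K.store g + 1).congr
      fun _ _ _ _ => by simp
  have h2 := Programmable.loop none (R := fun _ _ _ σ τ => σ = τ ∨
    ∃ x, (∃ g, x = K.store g + 1) ∧ σ = x :: τ) h1.opt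
  have h3 := Programmable.exFinite fun q : M.State × M.Work =>
    (Programmable.exMany 2 <| (show Tst N fun _ _ => q.1 ∈ M.accept from Tst.of _).seq <|
      (pop fun _ _ => 0).seq <| (pop fun _ _ => 0).seq <| (pop fun _ _ => K.ctrl q).seq <|
      (pop fun _ e => e 0).seq <| (pop fun _ e => e 1).seq <| h2.seq (pop fun _ _ => 0))
  refine ⟨_, h3, ?_, ?_⟩
  · rintro w e ⟨i, j, z⟩ ⟨q, f, -, -, _, ⟨rfl, h4⟩, _, h5, _, rfl, _, rfl, -⟩
    simp only [encode, List.cons.injEq] at h5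
    obtain ⟨rfl, rfl, h6, -⟩ := h5
    have h7 := K.ctrl_inj h6
    subst h7
    exact ⟨z, rfl, h4⟩
  · rintro w e z ⟨-, -, -, h4, h5⟩ h6 h7
    refine ⟨(z.state, z.scanned), consEnv (tapeCode K.base K.work z.left) <|
      consEnv (tapeCode K.base K.work z.right) e, ?_, fun _ => rfl, _, ⟨rfl, h7⟩, _, rfl, _, rfl, _,
      rfl, _, rfl, _, rfl, [0], ?_, rfl⟩
    · intro i hi
      interval_cases i <;> assumption
    · exact compDown_clear _ _ _ (by simp) (by simpa [bound, EProg.bnd] using h6) _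

/-- The simulation consists of `N w` optional steps followed by the final test, so every run of at
most `N w` steps is covered. Soundness holds without size bounds; they are needed only so that the
numbers of an actual run can be guessed. -/
theorem exists_run [Finite A] [Finite B] (h : A → List B) (N : List (NFASym A) → ℕ) :
    ∃ R, Programmable N R ∧
    (∀ w e c, R w e (K.encode c) [] → ∃ m, SimRun h (N w) w (fun _ => True) m c) ∧
    ∀ w e c m, m ≤ N w → K.Bounded (N w) c ∧ c.2.2.stack.length ≤ N w →
      SimRun h (N w) w (fun c => K.Bounded (N w) c ∧ c.2.2.stack.length ≤ N w) m c →
      R w e (K.encode c) [] := by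
  obtain ⟨R, h1, h2, h3⟩ := simulated_simStep (K := K) (h := h) (N := N)
  obtain ⟨R', h1', h2', h3'⟩ := K.exists_finish N
  have h4 := Programmable.loop none (R := fun w e x σ τ => σ = τ ∨ R w (consEnv x e) σ τ)
    (h1.opt.congr fun w e σ τ => by
      rw [show consEnv (e 0) (fun i => e (i + 1)) = e by funext i; cases i <;> rfl])
  refine ⟨_, h4.seq h1', ?_, ?_⟩
  · rintro w e c ⟨ρ, h5, h6⟩
    have key : ∀ n c, compDown (fun x σ τ => σ = τ ∨ R w (consEnv x e) σ τ) n (K.encode c) ρ →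
        ∃ m, SimRun h (N w) w (fun _ => True) m c := by
      intro n
      induction n with
      | zero =>
        rintro c rfl
        obtain ⟨z, rfl, hz⟩ := h2' w e c h6
        exact ⟨0, SimRun.done hz⟩
      | succ n ih =>
        rintro c ⟨_, rfl | h7, h8⟩
        · exact ih c h8
        · obtain ⟨c', rfl, h9⟩ := h2 _ _ _ _ h7
          obtain ⟨m, hm⟩ := ih c' h8
          exact ⟨m + 1, SimRun.step h9 trivial hm⟩
    exact key _ _ h5
  · intro w e c m hm hc hrun
    have key : ∀ n, m ≤ n → ∃ z, compDown (fun x σ τ => σ = τ ∨ R w (consEnv x e) σ τ) n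
        (K.encode c) (K.encode (0, 0, z)) ∧ (K.Bounded (N w) (0, 0, z) ∧
        z.stack.length ≤ N w) ∧ z.state ∈ M.accept := by
      clear hm
      intro n hn
      induction hrun generalizing n with
      | @done z hz =>
        refine ⟨z, ?_, hc, hz⟩
        clear hn
        induction n with
        | zero => rfl
        | succ n ih => exact ⟨_, Or.inl rfl, ih⟩
      | @step m c c' h5 h6 _ ih =>
        obtain ⟨n, rfl⟩ : ∃ k, n = k + 1 := ⟨n - 1, by omega⟩
        obtain ⟨z, h7, h8⟩ := ih h6 n (by omega)
        exact ⟨z, ⟨_, Or.inr (h3 _ _ _ _ hc.1 h6.1 h5), h7⟩, h8⟩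
    obtain ⟨z, h5, h6, h7⟩ := key _ hm
    exact ⟨_, h5, h3' w e z h6.1 h6.2 h7⟩

/-- Reading starts at the bar in front of the initial state. Its position `i` and the next one are
guessed separately, because the test for a role refers to a variable. -/
theorem exists_acceptance [Finite A] [Finite B] (h : A → List B) (N : List (NFASym A) → ℕ) :
    ∃ R, Programmable N R ∧
    (∀ w e, R w e [] [] → ∃ i m, roleAt w (i + 1) = Role.start true ∧
      SimRun h (N w) w (fun _ => True) m (i, 0, Zip.init M)) ∧
    ∀ w e i m, roleAt w (i + 1) = Role.start true → i + 1 < N w → m ≤ N w →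
      K.Bounded (N w) (i, 0, Zip.init M) →
      SimRun h (N w) w (fun c => K.Bounded (N w) c ∧ c.2.2.stack.length ≤ N w) m
        (i, 0, Zip.init M) → R w e [] [] := by
  obtain ⟨R, h1, h2, h3⟩ := K.exists_run h N
  refine ⟨_, Programmable.exMany 2 <| (((Dec.roleAt_eq (Role.start true) 1).1.and
    (Tst.eq (fun _ e => e 1) fun _ e => e 0 + 1)).seq <| (push fun _ _ => 0).seq <|
    (push fun _ _ => 0).seq <| (push fun _ _ => 0).seq <|
    (push fun _ _ => K.ctrl (M.start, M.blank)).seq <|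
    (push fun _ _ => 0).seq <| (push fun _ e => e 0).seq h1), ?_, ?_⟩
  · rintro w e ⟨f, -, -, _, ⟨rfl, h4, h5⟩, _, rfl, _, rfl, _, rfl, _, rfl, _, rfl, _, rfl, h6⟩
    obtain ⟨m, hm⟩ := h2 w f (f 0, 0, Zip.init M) h6
    rw [h5] at h4
    exact ⟨_, m, h4, hm⟩
  · intro w e i m h4 h5 h6 h7 h8
    refine ⟨consEnv i (consEnv (i + 1) e), ?_, fun _ => rfl, _, ⟨rfl, h4, rfl⟩, _, rfl, _, rfl, _,
      rfl, _, rfl, _, rfl, _, rfl, h3 w _ (i, 0, Zip.init M) m h6 ⟨h7, by simp [Zip.init]⟩ h8⟩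
    intro k hk
    interval_cases k
    · exact h7.1
    · exact h5

end Coding

end Acceptance

/-! ### Bounds -/

section Bounds

variable {α : Type u}

theorem length_lt_two_pow_binLength (w : List α) : w.length + 1 < 2 ^ binLength w :=
  Nat.lt_base_pow_length_digits (by norm_num)

theorem binLength_pos (w : List α) : binLength w ≠ 0 := by
  intro h
  have := length_lt_two_pow_binLength w
  rw [h] at this
  omega

/-- The function is bounded by a power with the number of binary digits of the length as its
exponent. -/
def PolyBounded (g : List α → ℕ) : Prop := ∃ a, ∀ w, g w ≤ a ^ binLength w

namespace PolyBounded

variable {g g' : List α → ℕ}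

theorem length : PolyBounded fun w : List α => w.length :=
  ⟨2, fun w => (Nat.le_succ _).trans (length_lt_two_pow_binLength w).le⟩

theorem const (c : ℕ) : PolyBounded fun _ : List α => c :=
  ⟨c, fun w => Nat.le_self_pow (binLength_pos w) c⟩

theorem add (h : PolyBounded g) (h' : PolyBounded g') : PolyBounded fun w => g w + g' w := by
  obtain ⟨a, ha⟩ := h
  obtain ⟨b, hb⟩ := h'
  exact ⟨a + b, fun w => (Nat.add_le_add (ha w) (hb w)).trans
    (pow_add_pow_le (Nat.zero_le a) (Nat.zero_le b) (binLength_pos w))⟩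

theorem mul (h : PolyBounded g) (h' : PolyBounded g') : PolyBounded fun w => g w * g' w := by
  obtain ⟨a, ha⟩ := h
  obtain ⟨b, hb⟩ := h'
  exact ⟨a * b, fun w => by rw [mul_pow]; exact Nat.mul_le_mul (ha w) (hb w)⟩

theorem pow (h : PolyBounded g) (n : ℕ) : PolyBounded fun w => g w ^ n := by
  obtain ⟨a, ha⟩ := h
  refine ⟨a ^ n, fun w => ?_⟩
  rw [← pow_mul, mul_comm, pow_mul]
  exact Nat.pow_le_pow_left (ha w) n

theorem eval (h : PolyBounded g) (p : Polynomial ℕ) : PolyBounded fun w => p.eval (g w) := by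
  induction p using Polynomial.induction_on' with
  | add p q hp hq => simpa using hp.add hq
  | monomial n c => simpa using (const c).mul (h.pow n)

/-- The logarithm of a polynomially bounded function is linear in `binLength`, so exponentiating it
gives another power with exponent `binLength`. This bounds the codes of work tapes of logarithmic
length. -/
theorem pow_log (h : PolyBounded g) (b C : ℕ) :
    PolyBounded fun w => b ^ (C * (Nat.log 2 (g w) + 1)) := by
  obtain ⟨a, ha⟩ := h
  refine ⟨(b + 1) ^ (C * (a + 1)), fun w => ?_⟩
  have h1 : Nat.log 2 (g w) ≤ a * binLength w := by
    have h2 : g w ≤ 2 ^ (a * binLength w) := by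
      rw [pow_mul]
      exact (ha w).trans (Nat.pow_le_pow_left Nat.lt_two_pow_self.le _)
    calc _ ≤ Nat.log 2 (2 ^ (a * binLength w)) := Nat.log_mono_right h2
      _ = _ := Nat.log_pow (by norm_num) _
  have h3 := Nat.pos_of_ne_zero (binLength_pos w)
  rw [← pow_mul]
  calc b ^ (C * (Nat.log 2 (g w) + 1)) ≤ (b + 1) ^ (C * (Nat.log 2 (g w) + 1)) :=
        Nat.pow_le_pow_left (by omega) _
    _ ≤ _ := by
      refine Nat.pow_le_pow_right (by omega) ?_
      rw [mul_assoc]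
      refine Nat.mul_le_mul_left C ?_
      rw [Nat.succ_mul]
      omega

/-- With `D = a`, the inequality `a ^ n + 2 ^ n ≤ (a + 2) ^ n` leaves enough room for the 1
subtracted in `EProg.loopBound`. -/
theorem exists_lt_loopBound (h : PolyBounded g) :
    ∃ D, ∀ w, g w < EProg.loopBound D w := by
  obtain ⟨a, ha⟩ := h
  refine ⟨a, fun w => ?_⟩
  have h1 : a ^ binLength w + 2 ^ binLength w ≤ (a + 2) ^ binLength w :=
    pow_add_pow_le (Nat.zero_le a) (Nat.zero_le 2) (binLength_pos w)
  have h2 := length_lt_two_pow_binLength w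
  have h3 : 2 ≤ 2 ^ binLength w := Nat.le_self_pow (binLength_pos w) 2
  have h4 := ha w
  rw [EProg.loopBound]
  omega

end PolyBounded

end Bounds

/-! ### The reduction for a one-way machine and a substitution of words for letters. -/

section Reduction

variable {A B : Type u}

theorem length_le_codeOf (st : List (List Bool)) (p : List Bool) (f : List (List Bool))
    (tr : List (List Bool × List A × List Bool)) : st.length ≤ (codeOf st p f tr).length := by
  have h : st.length ≤ (codeNames st : List (NFASym A)).length := by
    induction st with
    | nil => simp
    | cons q st ih =>
      rw [codeNames_cons]
      simp
      omega
  rw [codeOf_eq, List.length_append]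
  omega

/-- Whether an acyclic automaton accepts a word whose image is accepted by a one-way auxiliary
pushdown automaton can be decided in `LogCFL`. -/
theorem inLogCFL_acyclic [Finite A] [Finite B] {M : AuxPDA B} (hM : M.OneWay)
    (hspace : M.LogSpaceBounded) (htime : M.PolyTimeBounded) (h : A → List B) :
    InLogCFL ({s | ∃ (Q : Type) (_ : Finite Q) (𝒜 : WordNFA A Q), 𝒜.Acyclic ∧ 𝒜.IsEncoding s ∧
      ∃ w ∈ 𝒜.language, w.flatMap h ∈ M.language} : Language (NFASym A)) := by
  obtain ⟨C, hC⟩ := hspace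
  obtain ⟨p, hp⟩ := htime
  obtain ⟨K⟩ := exists_coding M
  obtain ⟨H, hH⟩ : ∃ H, ∀ a, (h a).length ≤ H := by
    obtain ⟨H, hH⟩ := (Set.finite_range fun a => (h a).length).bddAbove
    exact ⟨H, fun a => hH ⟨a, rfl⟩⟩
  obtain ⟨m₀, hm₀⟩ : ∃ m, ∀ q, K.ctrl q ≤ m := by
    have := M.finiteState
    have := M.finiteWork
    obtain ⟨m, hm⟩ := (Set.finite_range K.ctrl).bddAbove
    exact ⟨m, fun q => hm ⟨q, rfl⟩⟩
  -- This is the bound of `Accepts.exists_canRead` for an empty initial word and at most `s.length`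
  -- transitions. It also bounds the length of the word given to the machine.
  let g : List (NFASym A) → ℕ := fun s => (0 + 1 + s.length * (s.length + 1)) * (H + 1)
  have hg : PolyBounded g := ((PolyBounded.const (0 + 1)).add (PolyBounded.length.mul
    (PolyBounded.length.add (PolyBounded.const 1)))).mul (PolyBounded.const (H + 1))
  -- The loop bound has to exceed the positions, the offsets in images of letters, the codes of
  -- states and half tapes, the height of the store, and the number of joint steps.
  obtain ⟨D, hD⟩ := (((PolyBounded.length.add (PolyBounded.const 2)).add
    (PolyBounded.const (H + m₀))).add ((hg.pow_log K.base C).add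
    (hg.add (hg.eval p)))).exists_lt_loopBound
  have hN1 : ∀ s : List (NFASym A), s.length + 1 < EProg.loopBound D s := fun s => by
    have := hD s
    omega
  obtain ⟨R, h1, h2, h3⟩ := K.exists_acceptance h (EProg.loopBound D)
  obtain ⟨P, hP⟩ := Programmable.seq (((Dec.wellFormed hN1).1.and Dec.allListed.1).and
    (Tst.acyclic_follows fun s => by have := hN1 s; omega)) h1
  refine ⟨Tok, inferInstance, stackProgramLanguage, _, stackProgramLanguage_isContextFree,
    P.logSpaceComputable D, fun s => ?_⟩
  have hrun : P.out (EProg.loopBound D s) s (fun _ => 0) ∈ stackProgramLanguage ↔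
      ((WellFormed s ∧ AllListed (EProg.loopBound D s) s) ∧
      ∀ i, ¬ Relation.TransGen (Follows (EProg.loopBound D s) s) i i) ∧
      R s (fun _ => 0) [] [] := by
    have h4 := (hP s fun _ => 0).2 [] [] []
    rw [List.append_nil] at h4
    refine h4.trans ?_
    constructor
    · rintro ⟨ρ, ⟨_, ⟨rfl, h5⟩, h6⟩, h7⟩
      -- After the whole program nothing is left to be run, so the final stack must already be
      -- empty; a nonempty stack of numbers has a nonempty code.
      have : ρ = [] := by
        cases ρ with
        | nil => rfl
        | cons x ρ =>
          exfalso
          generalize hσ : codeStack (x :: ρ) = σ at h7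
          cases h7
          cases x <;> simp [codeStack, List.replicate_succ] at hσ
      subst this
      exact ⟨h5, h6⟩
    · rintro ⟨h5, h6⟩
      exact ⟨[], ⟨_, ⟨rfl, h5⟩, h6⟩, Run.nil _⟩
  rw [hrun]
  have hN := (Nat.lt_succ_self _).trans (hN1 s)
  refine (exists_isEncoding_iff (P := fun w => w.flatMap h ∈ M.language)).trans ?_
  constructor
  · rintro ⟨st, q, f, tr, hs, h4, h5, k, y, h6, h7⟩
    refine ⟨⟨⟨(foldl_eq_source_iff s).2 ⟨_, _, _, _, hs⟩, (allListed_iff hs hN).2 h4⟩,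
      (acyclic_follows_iff hs hN).2 h5⟩, ?_⟩
    have hst : (codeNames st : List (NFASym A)).length + 1 + 1 =
      (codeNames st ++ [NFASym.bar] : List (NFASym A)).length + 1 := by simp
    obtain ⟨v, h8⟩ := suffixAt_start hs ((roleAt_start_iff hs).2 hst)
    have hword : WordAt s ((codeNames st : List (NFASym A)).length + 1) [] q :=
      ⟨_, _, h8, Or.inr rfl, _, v, h8.cons, Or.inr rfl⟩
    have h9 := h8.le
    simp only [List.length_cons, List.length_append] at h9
    obtain ⟨n, hn, hread⟩ := h6.exists_canRead hs hN hH hword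
    -- Here acyclicity makes the path short: it has no more transitions than there are listed
    -- states.
    have hk : k ≤ s.length := (h6.le h4.2.2 h5).trans (hs ▸ length_le_codeOf st q f tr)
    have hng : n ≤ g s := hn.trans (by
      simp only [g, List.length_nil]
      gcongr)
    simp only [List.flatMap_nil, List.nil_append] at hread
    have hlen : (y.flatMap h).length ≤ g s := hread.length_le.trans hng
    -- The space and time bounds of the machine refer to the word it reads. They are transferred to
    -- the length of the code by monotonicity, since that word has length at most `g s`.
    have hC' : ∀ t c, M.ReachesIn (y.flatMap h) t c →
        c.workPos < C * (Nat.log 2 (g s) + 1) := fun t c hc =>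
      (hC _ t c hc).trans_le (Nat.mul_le_mul_left C
        (Nat.succ_le_succ (Nat.log_mono_right hlen)))
    have hT' : ∀ t c, M.ReachesIn (y.flatMap h) t c → t ≤ p.eval (g s) := fun t c hc =>
      (hp _ t c hc).trans (by
        rw [Polynomial.eval_eq_sum_range, Polynomial.eval_eq_sum_range]
        gcongr)
    obtain ⟨t, ht, hacc⟩ := exists_acceptingRun_of_mem_language hM hC' hT' h7
    have hC0 : 0 < C * (Nat.log 2 (g s) + 1) := hC' _ _ AuxPDA.ReachesIn.zero
    obtain ⟨m, hm, hsim⟩ := exists_simRun hH hacc hread ⟨by simpa [Zip.size, Zip.init] using hC0,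
      by simp [Zip.init]⟩
    have hDs := hD s
    have hbound : ∀ c : ℕ × ℕ × Zip M, (c.1 ≤ s.length + 1 ∧ c.2.1 ≤ H ∧
        c.2.2.size < C * (Nat.log 2 (g s) + 1) ∧ c.2.2.stack.length ≤ p.eval (g s)) →
        K.Bounded (EProg.loopBound D s) c ∧ c.2.2.stack.length ≤ EProg.loopBound D s := by
      rintro c ⟨h10, h11, h12, h13⟩
      have h14 := hm₀ (c.2.2.state, c.2.2.scanned)
      have htape : ∀ l : List M.Work, l.length ≤ c.2.2.size →
          tapeCode K.base K.work l < K.base ^ (C * (Nat.log 2 (g s) + 1)) := fun l hl =>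
        (tapeCode_lt K.work_lt l).trans_le (Nat.pow_le_pow_right
          (by have := K.work_lt M.blank; omega) (hl.trans h12.le))
      have h15 := htape c.2.2.left (by simp [Zip.size])
      have h16 := htape c.2.2.right (by simp [Zip.size])
      exact ⟨⟨by omega, by omega, by omega, by omega, by omega⟩, by omega⟩
    refine h3 s _ _ m ((roleAt_start_iff hs).2 hst) (by omega) (by omega)
      (hbound _ ⟨by simp only; omega, by simp, by simpa [Zip.size, Zip.init] using hC0,
        by simp [Zip.init]⟩).1 (hsim.mono hbound)
  · rintro ⟨⟨⟨h4, h5⟩, h6⟩, h7⟩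
    obtain ⟨st, q, f, tr, hs⟩ := (foldl_eq_source_iff s).1 h4
    refine ⟨st, q, f, tr, hs, (allListed_iff hs hN).1 h5, (acyclic_follows_iff hs hN).1 h6, ?_⟩
    obtain ⟨i, m, h8, h9⟩ := h2 s _ h7
    obtain ⟨v, h10⟩ := suffixAt_start hs h8
    obtain ⟨n, y, t, h11, h12⟩ := h9.exists_canRead
    obtain ⟨k, z, h13, rfl⟩ := h11.exists_accepts hs hN (x := []) (r := q)
      ⟨_, _, h10, Or.inr rfl, _, v, h10.cons, Or.inr rfl⟩
    refine ⟨k, z, h13, ?_⟩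
    simp only [List.flatMap_nil, List.drop_nil, List.nil_append] at h12
    exact h12.mem_language hM AuxPDA.ReachesIn.zero Zip.represents_init ⟨[], rfl, rfl⟩

end Reduction

/-! ### Passing from one generating set to another. -/

theorem exists_wordValue_eq {G : Type u} [Group G] {S : Finset G} (hS : IsSymmGenSet S) (x : G) :
    ∃ l : List S, wordValue l = x := by
  have hx : x ∈ Subgroup.closure (S : Set G) := by rw [hS.2]; trivial
  -- The generated subgroup is the submonoid generated by the generators and their inverses; by
  -- symmetry the inverses are generators again.
  rw [← Subgroup.mem_toSubmonoid, Subgroup.closure_toSubmonoid] at hx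
  obtain ⟨l, hl, rfl⟩ := Submonoid.exists_list_of_mem_closure hx
  have hl' : ∀ y ∈ l, y ∈ S := fun y hy => (hl y hy).elim id fun h => by
    simpa using hS.1 _ h
  exact ⟨l.attachWith _ hl', by simp [wordValue]⟩

theorem wordValue_flatMap {G : Type u} [Group G] {S S' : Finset G} (h : S → List S')
    (hh : ∀ a, wordValue (h a) = a) (y : List S) : wordValue (y.flatMap h) = wordValue y := by
  induction y with
  | nil => rfl
  | cons a y ih =>
    have h1 : wordValue (h a ++ y.flatMap h) = wordValue (h a) * wordValue (y.flatMap h) := by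
      simp [wordValue]
    rw [List.flatMap_cons, h1, hh, ih]
    simp [wordValue]

theorem mainTheorem7 {G : Type*} [Group G] (hG : InOWAuxPDA G)
    (S : Finset G) (hS : IsSymmGenSet S) :
    InLogCFL (acyclicNFAMembership S) := by
  obtain ⟨S', hS', M, h1, h2, h3, h4⟩ := hG
  -- Every letter is replaced by a word over `S'` with the same value, so a word and its image
  -- represent the same group element.
  choose h hh using fun a : S => exists_wordValue_eq hS' (a : G)
  have key := inLogCFL_acyclic h1 h2 h3 h
  have h5 : ∀ w : List S, w.flatMap h ∈ M.language ↔ wordValue w = 1 := fun w => by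
    rw [h4, ← wordValue_flatMap h hh w]
    rfl
  simp only [h5] at key
  exact key
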